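/- Let $k$ be a field and let $Q$ be a finite ordered quiver, that is, a quiver with finitely many vertices and arrows and without non-trivial oriented cycles. Let $R$ be a set of tensor relations on $Q$: a set of $k$-linear combinations of parallel non-trivial paths such that the unit representation ($k$ at every vertex, every arrow acting as the identity) satisfies $R$, and such that the finite dimensional representations of $Q$ over $k$ that satisfy $R$ are closed under the vertexwise tensor product. Let $T=D(Q)$ be the bounded derived category of the category of finite dimensional representations of $Q$ satisfying $R$, a $k$-linear tensor triangulated category under the vertexwise tensor product, and let $U$ be its unit object. Let $\mathrm{Spec}\,T=(\mathrm{Spc}\,T,\mathcal O_{\mathrm{Spec}\,T})$ be the Balmer spectrum of $T$: the points of $\mathrm{Spc}\,T$ are the prime (proper, thick) tensor ideals of $T$, with the topology whose closed subsets are the sets of primes that do not meet a given set of objects, and $\mathcal O_{\mathrm{Spec}\,T}$ is the sheaf of rings associated with the presheaf $W\mapsto\mathrm{End}_{T/T_Z}(U)$, where $Z$ is the complement of $W$, $T_Z$ is the full subcategory of the objects of $T$ with support in $Z$ (the support of an object is the set of primes that do not contain it), and $T/T_Z$ is the Verdier quotient. Let $\alpha:\mathrm{End}_T(U)\to\Gamma(\mathcal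 O_{\mathrm{Spec}\,T})$ be the canonical ring homomorphism. Let $D^b(k)$ be the bounded derived tensor category of finite dimensional $k$-vector spaces, and let $T(k)$ be the set of isomorphism classes of $k$-linear exact functors $T\to D^b(k)$ that preserve tensor products and unit objects. Then $T(k)$ is finite. Let $$A(T)=\prod_{F,G\in T(k)}\mathrm{Hom}(F,G),$$ where $\mathrm{Hom}(F,G)$ is the $k$-vector space of natural transformations of exact functors (those that commute with the shifts). This is a $k$-algebra under composition of natural transformations, the product of two elements that are not composable being zero. Let $z:\mathrm{End}_T(U)\to A(T)$ be the map that sends $\phi$ to the family $(F(\Phi))_{F\in T(k)}$, where $\Phi:\mathrm{Id}_T\to\mathrm{Id}_T$ is given by $\Phi_M:M\cong M\otimes U\xrightarrow{1\otimes\phi}M\otimes U\cong M$. Then the following hold. 1. There are ring homomorphisms $d:\Gamma(\mathcal O_{\mathrm{Spec}\,T})\to A(T)$ and $u:A(T)\to\Gamma(\mathcal O_{\mathrm{Spec}\,T})$ such that $d\circ\alpha=z$ and $u\circ z=\alpha$. 2. The map $z$ is an isomorphism of $k$-algebras from $\mathrm{End}_T(U)$ onto the center $Z(A(T))$. 3.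 There is an isomorphism of $k$-algebras $\mathrm{End}_T(U)\cong k^{\pi_0(Q)}$, where $\pi_0(Q)$ is the set of classes of vertices of $Q$ under the equivalence relation generated by the existence of an arrow between two vertices. -/

import Mathlib

open CategoryTheory Limits MonoidalCategory

set_option linter.unusedSectionVars false

noncomputable section

universe w v u

/-! ### Bounded derived tensor categories -/

/-- An abelian monoidal category with countable coproducts whose tensor product is additive and
commutes with coproducts in each variable; this is what is needed to form total tensor products
of complexes. -/
class TensorCocomplete (A : Type u) [Category.{v} A] [Abelian A] [MonoidalCategory A] : Prop
    extends MonoidalPreadditive A where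
  hasCoproducts : HasCoproducts.{0} A
  preservesLeft : ∀ X : A, PreservesColimitsOfSize.{0, 0} (tensorLeft X)
  preservesRight : ∀ X : A, PreservesColimitsOfSize.{0, 0} (tensorRight X)

namespace BoundedDerived

section Complexes

variable {A : Type u} [Category.{v} A] [Abelian A] [MonoidalCategory A] [TensorCocomplete A]

instance : HasCoproducts.{0} A := TensorCocomplete.hasCoproducts

instance (X : A) : PreservesColimitsOfSize.{0, 0} ((curriedTensor A).obj X) :=
  TensorCocomplete.preservesLeft X

instance (X : A) : PreservesColimitsOfSize.{0, 0} ((curriedTensor A).flip.obj X) :=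
  TensorCocomplete.preservesRight X

instance (X₁ X₂ : GradedObject ℤ A) : GradedObject.HasTensor X₁ X₂ := by
  intro j; infer_instance

instance (X₁ X₂ X₃ X₄ : GradedObject ℤ A) : GradedObject.HasTensor₄ObjExt X₁ X₂ X₃ X₄ := by
  intro j; infer_instance

instance (X₁ X₂ X₃ : GradedObject ℤ A) : GradedObject.HasGoodTensor₁₂Tensor X₁ X₂ X₃ := by
  intro j; infer_instance

instance (X₁ X₂ X₃ : GradedObject ℤ A) : GradedObject.HasGoodTensorTensor₂₃ X₁ X₂ X₃ := by
  intro j; infer_instance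

/-- The usual monoidal structure on cochain complexes, with
`(K ⊗ L)ⁿ = ⨁ Kⁱ ⊗ Lʲ` over `i + j = n`. -/
instance : MonoidalCategory (CochainComplex A ℤ) :=
  inferInstanceAs (MonoidalCategory (HomologicalComplex A (ComplexShape.up ℤ)))

/-- The property of being a bounded cochain complex all of whose terms satisfy `P`. -/
def bounded (P : ObjectProperty A) : ObjectProperty (CochainComplex A ℤ) := fun K =>
  (∃ a b : ℤ, ∀ n : ℤ, (n < a ∨ b < n) → IsZero (K.X n)) ∧ ∀ n : ℤ, P (K.X n)

variable (P : ObjectProperty A)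

lemma isZero_cofan {J : Type} {X : J → A} {c : Cofan X} (hc : IsColimit c)
    (hX : ∀ j, IsZero (X j)) : IsZero c.pt := by
  rw [IsZero.iff_id_eq_zero]
  exact Cofan.IsColimit.hom_ext hc _ _ (fun j => (hX j).eq_of_src _ _)

attribute [local instance] Abelian.hasFiniteBiproducts in
/-- A coproduct of objects, all but finitely many of which vanish, is a finite direct sum. -/
lemma prop_cofan [P.IsClosedUnderFiniteProducts] [P.IsClosedUnderIsomorphisms] {J : Type}
    {X : J → A} {c : Cofan X} (hc : IsColimit c) (S : Finset J)
    (hS : ∀ j, j ∉ S → IsZero (X j)) (hP : ∀ j, P (X j)) : P c.pt := by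
  classical
  let e : c.pt ≅ ⨁ (fun s : S => X s) :=
    { hom := Cofan.IsColimit.desc hc
        (fun j => if h : j ∈ S then biproduct.ι (fun s : S => X s) ⟨j, h⟩ else 0)
      inv := biproduct.desc (fun s : S => c.inj s)
      hom_inv_id := by
        refine Cofan.IsColimit.hom_ext hc _ _ (fun j => ?_)
        by_cases h : j ∈ S
        · simp [h]
        · exact (hS j h).eq_of_src _ _
      inv_hom_id := by
        refine biproduct.hom_ext' _ _ (fun s => ?_)
        simp }
  exact P.prop_of_iso (e ≪≫ biproduct.isoProduct _).symm (P.prop_product (fun s => hP s))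

variable [P.IsClosedUnderFiniteProducts] [P.IsClosedUnderIsomorphisms]

lemma prop_zero {X : A} (hX : IsZero X) : P X := by
  have := prop_cofan P (X := fun j : PEmpty.{1} => (j.elim : A))
    (c := Cofan.mk X (fun j => j.elim))
    (Cofan.IsColimit.mk _ (fun _ => 0) (fun _ j => j.elim) (fun _ _ _ => hX.eq_of_src _ _)) ∅
    (fun j => j.elim) (fun j => j.elim)
  exact this

lemma prop_biprod {X Y : A} (hX : P X) (hY : P Y) : P (X ⊞ Y) :=
  P.prop_of_iso (biprod.isoProd X Y).symm (P.prop_prod _ _ hX hY)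

lemma prop_homotopyCofiber {K L : CochainComplex A ℤ} (f : K ⟶ L)
    (hK : ∀ n : ℤ, P (K.X n)) (hL : ∀ n : ℤ, P (L.X n)) (n : ℤ) :
    P ((HomologicalComplex.homotopyCofiber f).X n) :=
  P.prop_of_iso (HomologicalComplex.homotopyCofiber.XIsoBiprod f n (n + 1) rfl).symm
    (prop_biprod P (hK _) (hL _))

lemma bounded_homotopyCofiber {K L : CochainComplex A ℤ} (f : K ⟶ L)
    (hK : bounded P K) (hL : bounded P L) :
    bounded P (HomologicalComplex.homotopyCofiber f) := by
  obtain ⟨⟨a, b, hab⟩, hK⟩ := hK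
  obtain ⟨⟨a', b', hab'⟩, hL⟩ := hL
  refine ⟨⟨min (a - 1) a', max b b', fun n hn => ?_⟩, prop_homotopyCofiber P f hK hL⟩
  refine HomologicalComplex.homotopyCofiber.isZero_X f _ (hab' _ (by grind)) (fun j hj => ?_)
  simp only [ComplexShape.up_Rel] at hj
  exact hab _ (by grind)

lemma bounded_biprod {K L : CochainComplex A ℤ} (hK : bounded P K) (hL : bounded P L) :
    bounded P (K ⊞ L) := by
  obtain ⟨⟨a, b, hab⟩, hK⟩ := hK
  obtain ⟨⟨a', b', hab'⟩, hL⟩ := hL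
  let e := fun n => (HomologicalComplex.eval A (.up ℤ) n).mapBiprod K L
  refine ⟨⟨min a a', max b b', fun n hn => ?_⟩, fun n => ?_⟩
  · refine IsZero.of_iso ?_ (e n)
    rw [biprod_isZero_iff]
    exact ⟨hab _ (by grind), hab' _ (by grind)⟩
  · exact P.prop_of_iso (e n).symm (prop_biprod P (hK n) (hL n))

lemma bounded_cylinder {K : CochainComplex A ℤ} (hK : bounded P K) :
    bounded P (HomologicalComplex.cylinder K) :=
  bounded_homotopyCofiber P _ hK (bounded_biprod P hK hK)

variable [P.IsMonoidal]

instance : (bounded P).IsMonoidal where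
  prop_unit := by
    refine ⟨⟨0, 0, fun n hn => ?_⟩, fun n => ?_⟩
    · exact HomologicalComplex.isZero_single_obj_X (.up ℤ) 0 (𝟙_ A) n (by grind)
    · by_cases h : n = 0
      · exact P.prop_of_iso (HomologicalComplex.singleObjXIsoOfEq (.up ℤ) 0 (𝟙_ A) n h).symm
          P.prop_unit
      · exact prop_zero P (HomologicalComplex.isZero_single_obj_X (.up ℤ) 0 (𝟙_ A) n h)
  prop_tensor K L hK hL := by
    obtain ⟨⟨a, b, hab⟩, hK⟩ := hK
    obtain ⟨⟨a', b', hab'⟩, hL⟩ := hL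
    have hz : ∀ p : ℤ × ℤ, (p.1 < a ∨ b < p.1 ∨ p.2 < a' ∨ b' < p.2) →
        IsZero (K.X p.1 ⊗ L.X p.2) := by
      intro p hp
      by_cases h : p.1 < a ∨ b < p.1
      · exact (tensorRight (L.X p.2)).map_isZero (hab _ h)
      · exact (tensorLeft (K.X p.1)).map_isZero (hab' _ (by grind))
    let X := ((GradedObject.mapBifunctor (curriedTensor A) ℤ ℤ).obj K.X).obj L.X
    have hX := fun n => X.isColimitCofanMapObj (fun p : ℤ × ℤ => p.1 + p.2) n
    refine ⟨⟨a + a', b + b', fun n hn => isZero_cofan (hX n) (fun j => ?_)⟩, fun n => ?_⟩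
    · obtain ⟨⟨i, j⟩, hij⟩ := j
      have hij : i + j = n := hij
      exact hz (i, j) (by dsimp only; omega)
    · classical
      refine prop_cofan P (hX n) (Finset.subtype _ (Finset.Icc a b ×ˢ Finset.Icc a' b'))
        (fun j hj => hz _ ?_) (fun j => P.prop_tensor (hK _) (hL _))
      simp only [Finset.mem_subtype, Finset.mem_product, Finset.mem_Icc] at hj
      grind

end Complexes

section HomotopyCat

variable {A : Type u} [Category.{v} A] [Abelian A] [MonoidalCategory A] [TensorCocomplete A]
  (P : ObjectProperty A) [P.IsClosedUnderFiniteProducts] [P.IsClosedUnderIsomorphisms]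

open Pretriangulated ZeroObject

/-- The property of objects of the homotopy category of `A` which come from bounded complexes
all of whose terms satisfy `P`. -/
def boundedH : ObjectProperty (HomotopyCategory A (ComplexShape.up ℤ)) :=
  fun K => bounded P K.as

instance : (boundedH P).ContainsZero where
  exists_zero := by
    refine ⟨(HomotopyCategory.quotient _ _).obj 0, Functor.map_isZero _ (isZero_zero _), ?_⟩
    have h : ∀ n : ℤ, IsZero ((0 : CochainComplex A ℤ).X n) := fun n =>
      (HomologicalComplex.eval A (.up ℤ) n).map_isZero (isZero_zero _)
    exact ⟨⟨0, 0, fun n _ => h n⟩, fun n => prop_zero P (h n)⟩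

instance : (boundedH P).IsStableUnderShift ℤ where
  isStableUnderShiftBy n :=
    { le_shift K hK := by
        obtain ⟨K : CochainComplex _ _, rfl⟩ := K.quotient_obj_surjective
        obtain ⟨⟨a, b, hab⟩, hK⟩ := hK
        rw [ObjectProperty.prop_shift_iff, HomotopyCategory.shift_quotient_obj]
        exact ⟨⟨a - n, b - n, fun i hi => hab (i + n) (by grind)⟩, fun i => hK (i + n)⟩ }

instance : (boundedH P).IsTriangulatedClosed₃ where
  ext₃' T hT h₁ h₂ := by
    obtain ⟨f : T.obj₁.as ⟶ T.obj₂.as, hf⟩ :=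
      (HomotopyCategory.quotient _ _).map_surjective T.mor₁
    refine ⟨_, ?_, ⟨Triangle.π₃.mapIso (isoTriangleOfIso₁₂ T _ hT
      (HomotopyCategory.mappingCone_triangleh_distinguished f) (Iso.refl _) (Iso.refl _) ?_)⟩⟩
    · exact bounded_homotopyCofiber P f h₁ h₂
    · exact (Category.comp_id _).trans (hf.symm.trans (Category.id_comp _).symm)

instance : (boundedH P).IsTriangulated where
  toIsTriangulatedClosed₂ := .of_isTriangulatedClosed₃

/-- The bounded homotopy category of the full additive subcategory of `A` given by `P`. -/
abbrev Kb := (boundedH P).FullSubcategory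

/-- The category of bounded complexes in the full additive subcategory of `A` given by `P`. -/
abbrev Cb := (bounded P).FullSubcategory

/-- The functor from bounded complexes to the bounded homotopy category. -/
def quotientKb : Cb P ⥤ Kb P :=
  (boundedH P).lift ((bounded P).ι ⋙ HomotopyCategory.quotient A (.up ℤ)) (fun K => K.property)

/-- The bounded acyclic complexes. -/
def acyclic : ObjectProperty (Kb P) :=
  (HomotopyCategory.subcategoryAcyclic A).inverseImage (boundedH P).ι

instance : (acyclic P).IsTriangulated := by
  dsimp only [acyclic]; infer_instance

instance : (acyclic P).IsClosedUnderIsomorphisms := by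
  dsimp only [acyclic]; infer_instance

/-- The quasi-isomorphisms between bounded complexes. -/
def qis : MorphismProperty (Cb P) :=
  (HomologicalComplex.quasiIso A (.up ℤ)).inverseImage (bounded P).ι

/-- The localization functor from bounded complexes to the bounded derived category. -/
def toDb : Cb P ⥤ (acyclic P).trW.Localization :=
  quotientKb P ⋙ (acyclic P).trW.Q

lemma quotientKb_obj_surjective (K : Kb P) : ∃ L : Cb P, (quotientKb P).obj L = K :=
  ⟨⟨K.obj.as, K.property⟩, rfl⟩

instance : (quotientKb P).EssSurj where
  mem_essImage K := ⟨⟨K.obj.as, K.property⟩, ⟨Iso.refl _⟩⟩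

instance : (quotientKb P).Full where
  map_surjective f := by
    obtain ⟨g, hg⟩ := (HomotopyCategory.quotient A (.up ℤ)).map_surjective f.hom
    exact ⟨ObjectProperty.homMk g, by ext; exact hg⟩

open HomologicalComplex in
instance : (quotientKb P).IsLocalization
    ((homotopyEquivalences A (.up ℤ)).inverseImage (bounded P).ι) :=
  Functor.isLocalization_of_essSurj_of_full_of_exists_cylinders _ _
    (fun _ _ f hf ↦ by
      simpa [← isIso_iff_of_reflects_iso _ (boundedH P).ι,
        ← HomotopyCategory.inverseImage_quotient_isomorphisms] using! hf) (by
    rintro K L f₀ f₁ hf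
    obtain ⟨f₀, rfl⟩ := ObjectProperty.homMk_surjective f₀
    obtain ⟨f₁, rfl⟩ := ObjectProperty.homMk_surjective f₁
    replace hf := HomotopyCategory.homotopyOfEq f₀ f₁ ((boundedH P).ι.congr_map hf)
    exact ⟨K.obj.precylinder.toFullSubcategory (bounded_cylinder P K.property),
      HomotopicalAlgebra.Precylinder.LeftHomotopy.fullSubcategoryEquiv.symm
      { h := cylinder.desc _ _ hf
        h₀ := cylinder.ι₀_desc _ _ hf
        h₁ := cylinder.ι₁_desc _ _ hf }, ⟨cylinder.homotopyEquiv _ (fun n ↦ ⟨n - 1, by simp⟩), rfl⟩⟩)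

lemma qis_iff {K L : Cb P} (f : K ⟶ L) :
    qis P f ↔ (acyclic P).trW ((quotientKb P).map f) := by
  obtain ⟨M, g, h, mem⟩ := distinguished_cocone_triangle ((quotientKb P).map f)
  have := (HomotopyCategory.subcategoryAcyclic A).trW_iff_of_distinguished _
    ((boundedH P).ι.map_distinguished _ mem)
  rw [← HomotopyCategory.quasiIso_eq_trW_subcategoryAcyclic] at this
  refine Iff.trans ?_ ((acyclic P).trW_iff_of_distinguished _ mem).symm
  refine Iff.trans ?_ this
  exact (HomotopyCategory.quotient_map_mem_quasiIso_iff f.hom).symm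

instance : (toDb P).IsLocalization (qis P) := by
  refine Functor.IsLocalization.comp (quotientKb P) (acyclic P).trW.Q
    ((HomologicalComplex.homotopyEquivalences A (.up ℤ)).inverseImage (bounded P).ι)
    (acyclic P).trW _ ?_ ?_ ?_
  · intro K L f hf
    exact Localization.inverts (acyclic P).trW.Q _ _ ((qis_iff P f).1 hf)
  · intro K L f hf
    exact homotopyEquivalences_le_quasiIso A (.up ℤ) _ hf
  · intro K L f hf
    obtain ⟨K, rfl⟩ := quotientKb_obj_surjective P K
    obtain ⟨L, rfl⟩ := quotientKb_obj_surjective P L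
    obtain ⟨f, rfl⟩ := (quotientKb P).map_surjective f
    exact MorphismProperty.map_mem_map _ (quotientKb P) _ ((qis_iff P f).2 hf)

end HomotopyCat

section Db

variable {A : Type u} [Category.{v} A] [Abelian A] [MonoidalCategory A] [TensorCocomplete A]
  (P : ObjectProperty A) [P.IsClosedUnderFiniteProducts] [P.IsClosedUnderIsomorphisms]
  [P.IsMonoidal] [(qis P).IsMonoidal]

/-- The bounded derived category of the exact subcategory of `A` given by `P`: the localization of
the bounded homotopy category at the quasi-isomorphisms (the morphisms with acyclic cone). It
carries the tensor product induced by the tensor product of complexes. -/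
def Db : Type _ := LocalizedMonoidal (toDb P) (qis P) (Iso.refl _)

instance : Category (Db P) := inferInstanceAs (Category (acyclic P).trW.Localization)
instance : Preadditive (Db P) := inferInstanceAs (Preadditive (acyclic P).trW.Localization)
instance : HasZeroObject (Db P) := inferInstanceAs (HasZeroObject (acyclic P).trW.Localization)
instance : HasShift (Db P) ℤ := inferInstanceAs (HasShift (acyclic P).trW.Localization ℤ)
instance (n : ℤ) : (shiftFunctor (Db P) n).Additive :=
  inferInstanceAs (shiftFunctor (acyclic P).trW.Localization n).Additive
instance : Pretriangulated (Db P) :=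
  inferInstanceAs (Pretriangulated (acyclic P).trW.Localization)
instance : IsTriangulated (Db P) :=
  inferInstanceAs (IsTriangulated (acyclic P).trW.Localization)
instance : MonoidalCategory (Db P) :=
  inferInstanceAs (MonoidalCategory (LocalizedMonoidal (toDb P) (qis P) (Iso.refl _)))

variable (k : Type w) [CommRing k] [Linear k A]

instance : Linear k (Db P) := inferInstanceAs (Linear k (acyclic P).trW.Localization)

end Db

section Diagrams

variable {J : Type u} [Category.{v} J] {C : Type*} [Category* C] [Abelian C]
  [MonoidalCategory C] [TensorCocomplete C]

instance : HasColimitsOfSize.{0, 0} C := has_colimits_of_hasCoequalizers_and_coproducts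

instance : TensorCocomplete (J ⥤ C) where
  whiskerLeft_zero := by intros; ext; exact MonoidalPreadditive.whiskerLeft_zero
  zero_whiskerRight := by intros; ext; exact MonoidalPreadditive.zero_whiskerRight
  whiskerLeft_add _ _ := by ext; exact MonoidalPreadditive.whiskerLeft_add _ _
  add_whiskerRight _ _ := by ext; exact MonoidalPreadditive.add_whiskerRight _ _
  hasCoproducts := inferInstance
  preservesLeft X := ⟨fun {I _} => ⟨fun {K} => by
    refine preservesColimit_of_evaluation _ _ (fun j => ?_)
    exact inferInstanceAs (PreservesColimit K
      ((evaluation J C).obj j ⋙ (curriedTensor C).obj (X.obj j)))⟩⟩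
  preservesRight X := ⟨fun {I _} => ⟨fun {K} => by
    refine preservesColimit_of_evaluation _ _ (fun j => ?_)
    exact inferInstanceAs (PreservesColimit K
      ((evaluation J C).obj j ⋙ (curriedTensor C).flip.obj (X.obj j)))⟩⟩

open HomologicalComplex

instance (K L : CochainComplex C ℤ) : HasMapBifunctor K L (curriedTensor C) (.up ℤ) :=
  inferInstanceAs (HomologicalComplex.HasTensor K L)

lemma ι_tensor_d (K L : CochainComplex C ℤ) (a b n : ℤ) (h : a + b = n) :
    ιTensorObj K L a b n h ≫ (HomologicalComplex.tensorObj K L).d n (n + 1) =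
      K.d a (a + 1) ▷ L.X b ≫ ιTensorObj K L (a + 1) b (n + 1) (by omega) +
      a.negOnePow • (K.X a ◁ L.d b (b + 1) ≫
        ιTensorObj K L a (b + 1) (n + 1) (by omega)) := by
  rw [mapBifunctor.d_eq, Preadditive.comp_add, mapBifunctor.ι_D₁, mapBifunctor.ι_D₂,
    mapBifunctor.d₁_eq K L _ _ (show (ComplexShape.up ℤ).Rel a (a + 1) from rfl) b (n + 1)
      (show a + 1 + b = n + 1 by omega),
    mapBifunctor.d₂_eq K L _ _ a (show (ComplexShape.up ℤ).Rel b (b + 1) from rfl) (n + 1)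
      (show a + (b + 1) = n + 1 by omega)]
  congr 1
  exact one_smul _ _

/-- The values at `j` of a complex of diagrams. -/
abbrev evalC (j : J) : CochainComplex (J ⥤ C) ℤ ⥤ CochainComplex C ℤ :=
  ((evaluation J C).obj j).mapHomologicalComplex (.up ℤ)

/-- The inclusion of a summand, evaluated at `j`. -/
def ιEval (j : J) (K L : CochainComplex (J ⥤ C) ℤ) (a b n : ℤ) (h : a + b = n) :
    ((evalC j).obj K).X a ⊗ ((evalC j).obj L).X b ⟶
      ((evalC j).obj (HomologicalComplex.tensorObj K L)).X n :=
  (ιTensorObj K L a b n h).app j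

lemma ιEval_d (j : J) (K L : CochainComplex (J ⥤ C) ℤ) (a b n : ℤ) (h : a + b = n) :
    ιEval j K L a b n h ≫ ((evalC j).obj (HomologicalComplex.tensorObj K L)).d n (n + 1) =
      ((evalC j).obj K).d a (a + 1) ▷ ((evalC j).obj L).X b ≫
        ιEval j K L (a + 1) b (n + 1) (by omega) +
      a.negOnePow • (((evalC j).obj K).X a ◁ ((evalC j).obj L).d b (b + 1) ≫
        ιEval j K L a (b + 1) (n + 1) (by omega)) := by
  exact NatTrans.congr_app (ι_tensor_d K L a b n h) j

/-- The tensor product of complexes is computed pointwise. -/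
def evalTensor (j : J) (K L : CochainComplex (J ⥤ C) ℤ) :
    HomologicalComplex.tensorObj ((evalC j).obj K) ((evalC j).obj L) ⟶
      (evalC j).obj (HomologicalComplex.tensorObj K L) where
  f n := mapBifunctorDesc (fun a b h => ιEval j K L a b n h)
  comm' n m hnm := by
    obtain rfl : n + 1 = m := hnm
    refine mapBifunctor.hom_ext (fun a b h => ?_)
    have h' : a + b = n := h
    rw [ι_mapBifunctorDesc_assoc, ιEval_d, ← Category.assoc]
    erw [ι_tensor_d _ _ a b n h']
    simp only [Preadditive.add_comp, Linear.units_smul_comp, Category.assoc]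
    erw [ι_mapBifunctorDesc, ι_mapBifunctorDesc]

lemma ι_evalTensor (j : J) (K L : CochainComplex (J ⥤ C) ℤ) (a b n : ℤ) (h : a + b = n) :
    ιTensorObj ((evalC j).obj K) ((evalC j).obj L) a b n h ≫ (evalTensor j K L).f n =
      ιEval j K L a b n h := by
  dsimp only [evalTensor]
  exact ι_mapBifunctorDesc _ a b h

instance (j : J) (K L : CochainComplex (J ⥤ C) ℤ) : IsIso (evalTensor j K L) := by
  have : ∀ n, IsIso ((evalTensor j K L).f n) := fun n => by
    let X := ((GradedObject.mapBifunctor (curriedTensor (J ⥤ C)) ℤ ℤ).obj K.X).obj L.X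
    let hX := X.isColimitCofanMapObj (fun p : ℤ × ℤ => p.1 + p.2) n
    let h2 := isColimitCofanMkObjOfIsColimit ((evaluation J C).obj j) _
      (fun p : (fun p : ℤ × ℤ => p.1 + p.2) ⁻¹' {n} =>
        X.ιMapObj (fun p : ℤ × ℤ => p.1 + p.2) p.1 n p.2) hX
    let g : ((evalC j).obj (HomologicalComplex.tensorObj K L)).X n ⟶
      (HomologicalComplex.tensorObj ((evalC j).obj K) ((evalC j).obj L)).X n :=
      Cofan.IsColimit.desc h2 (fun p => ιTensorObj ((evalC j).obj K) ((evalC j).obj L)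
        p.1.1 p.1.2 n p.2)
    have hg : ∀ a b h, ιEval j K L a b n h ≫ g =
        ιTensorObj ((evalC j).obj K) ((evalC j).obj L) a b n h := fun a b h =>
      Cofan.IsColimit.fac h2 _ ⟨(a, b), h⟩
    refine ⟨g, ?_, ?_⟩
    · refine mapBifunctor.hom_ext (fun a b h => ?_)
      have := ι_evalTensor j K L a b n h
      rw [reassoc_of% this, hg]
      exact (Category.comp_id _).symm
    · refine Cofan.IsColimit.hom_ext h2 _ _ (fun p => ?_)
      have hp : p.1.1 + p.1.2 = n := p.2
      have h3 := ι_evalTensor j K L p.1.1 p.1.2 n hp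
      have h4 : ιEval j K L p.1.1 p.1.2 n hp ≫ g ≫ (evalTensor j K L).f n =
        ιEval j K L p.1.1 p.1.2 n hp := by
        rw [reassoc_of% hg, h3]
      exact h4.trans (Category.comp_id _).symm
  exact HomologicalComplex.Hom.isIso_of_components _

lemma evalTensor_naturality (j : J) {K K' L L' : CochainComplex (J ⥤ C) ℤ}
    (f : K ⟶ K') (g : L ⟶ L') :
    HomologicalComplex.tensorHom ((evalC j).map f) ((evalC j).map g) ≫ evalTensor j K' L' =
      evalTensor j K L ≫ (evalC j).map (HomologicalComplex.tensorHom f g) := by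
  ext n : 1
  refine mapBifunctor.hom_ext (fun a b h => ?_)
  have h1 := ι_evalTensor j K L a b n h
  have h2 := ι_evalTensor j K' L' a b n h
  rw [HomologicalComplex.comp_f, HomologicalComplex.comp_f, ι_mapBifunctorMap_assoc,
    reassoc_of% h1, h2]
  have h3 := NatTrans.congr_app (ι_mapBifunctorMap f g (curriedTensor (J ⥤ C)) (.up ℤ) a b n h) j
  exact h3.symm

lemma homotopyEquiv_tensor₁ {K K' : CochainComplex C ℤ} (L : CochainComplex C ℤ) {f : K ⟶ K'}
    (hf : homotopyEquivalences C (.up ℤ) f) :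
    homotopyEquivalences C (.up ℤ) (HomologicalComplex.tensorHom f (𝟙 L)) := by
  obtain ⟨e, rfl⟩ := hf
  have h1 := mapBifunctorMapHomotopy₁ e.homotopyHomInvId (𝟙 L) (curriedTensor C) (.up ℤ)
  have h2 := mapBifunctorMapHomotopy₁ e.homotopyInvHomId (𝟙 L) (curriedTensor C) (.up ℤ)
  exact ⟨⟨_, HomologicalComplex.tensorHom e.inv (𝟙 L),
    (Homotopy.ofEq (comp_whiskerRight e.hom e.inv L).symm).trans
      (h1.trans (Homotopy.ofEq (id_whiskerRight K L))),
    (Homotopy.ofEq (comp_whiskerRight e.inv e.hom L).symm).trans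
      (h2.trans (Homotopy.ofEq (id_whiskerRight K' L)))⟩, rfl⟩

lemma homotopyEquiv_tensor₂ {K K' : CochainComplex C ℤ} (L : CochainComplex C ℤ) {f : K ⟶ K'}
    (hf : homotopyEquivalences C (.up ℤ) f) :
    homotopyEquivalences C (.up ℤ) (HomologicalComplex.tensorHom (𝟙 L) f) := by
  obtain ⟨e, rfl⟩ := hf
  have h1 := mapBifunctorMapHomotopy₂ (𝟙 L) e.homotopyHomInvId (curriedTensor C) (.up ℤ)
  have h2 := mapBifunctorMapHomotopy₂ (𝟙 L) e.homotopyInvHomId (curriedTensor C) (.up ℤ)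
  exact ⟨⟨_, HomologicalComplex.tensorHom (𝟙 L) e.inv,
    (Homotopy.ofEq (MonoidalCategory.whiskerLeft_comp L e.hom e.inv).symm).trans
      (h1.trans (Homotopy.ofEq (MonoidalCategory.whiskerLeft_id L K))),
    (Homotopy.ofEq (MonoidalCategory.whiskerLeft_comp L e.inv e.hom).symm).trans
      (h2.trans (Homotopy.ofEq (MonoidalCategory.whiskerLeft_id L K')))⟩, rfl⟩

lemma qis_eval (P : ObjectProperty (J ⥤ C)) {K L : Cb P} (f : K ⟶ L) :
    qis P f ↔ ∀ j, QuasiIso ((evalC j).map f.hom) :=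
  HomologicalComplex.quasiIso_iff_evaluation f.hom

variable [∀ X : C, Injective X]

lemma homotopyEquiv_eval (P : ObjectProperty (J ⥤ C)) {K L : Cb P} (f : K ⟶ L)
    (hf : qis P f) (j : J) : homotopyEquivalences C (.up ℤ) ((evalC j).map f.hom) := by
  have : ∀ K : Cb P, ((evalC j).obj K.obj).IsKInjective := fun K => by
    obtain ⟨a, b, hab⟩ := K.property.1
    have : ((evalC j).obj K.obj).IsStrictlyGE a := by
      rw [CochainComplex.isStrictlyGE_iff]
      exact fun i hi => ((evaluation J C).obj j).map_isZero (hab i (Or.inl hi))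
    exact CochainComplex.isKInjective_of_injective _ a
  have h₁ := this K
  have h₂ := this L
  rw [← CochainComplex.IsKInjective.quasiIso_iff]
  exact (qis_eval P f).1 hf j

variable (P : ObjectProperty (J ⥤ C)) [P.IsClosedUnderFiniteProducts]
  [P.IsClosedUnderIsomorphisms] [P.IsMonoidal]

/-- If `C` is semisimple then the tensor product of diagrams is exact, so that the tensor
product of complexes preserves quasi-isomorphisms. -/
instance : (qis P).IsMonoidal := by
  have hiso (j : J) {K K' L L' : Cb P} (f : K ⟶ K') (g : L ⟶ L')
      (h : homotopyEquivalences C (.up ℤ)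
        (HomologicalComplex.tensorHom ((evalC j).map f.hom) ((evalC j).map g.hom))) :
      QuasiIso ((evalC j).map (HomologicalComplex.tensorHom f.hom g.hom)) := by
    have h1 : QuasiIso (HomologicalComplex.tensorHom ((evalC j).map f.hom) ((evalC j).map g.hom)) :=
      homotopyEquivalences_le_quasiIso _ _ _ h
    have h2 := evalTensor_naturality j f.hom g.hom
    have h3 : QuasiIso (HomologicalComplex.tensorHom ((evalC j).map f.hom)
      ((evalC j).map g.hom) ≫ evalTensor j _ _) := inferInstance
    rw [h2] at h3
    exact quasiIso_of_comp_left (evalTensor j _ _) _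
  have : (qis P).IsMultiplicative := by dsimp only [qis]; infer_instance
  refine { whiskerLeft := ?_, whiskerRight := ?_ }
  · intro K L L' f hf
    refine (qis_eval P _).2 (fun j => hiso j (𝟙 K) f ?_)
    exact homotopyEquiv_tensor₂ _ (homotopyEquiv_eval P f hf j)
  · intro K K' f hf L
    refine (qis_eval P _).2 (fun j => hiso j f (𝟙 L) ?_)
    exact homotopyEquiv_tensor₁ _ (homotopyEquiv_eval P f hf j)

end Diagrams

section Semisimple

open HomologicalComplex

variable {C : Type*} [Category* C] [Abelian C] [MonoidalCategory C] [TensorCocomplete C]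
  [∀ X : C, Injective X] (P : ObjectProperty C) [P.IsClosedUnderFiniteProducts]
  [P.IsClosedUnderIsomorphisms] [P.IsMonoidal]

lemma homotopyEquiv_of_qis {K L : Cb P} (f : K ⟶ L) (hf : qis P f) :
    homotopyEquivalences C (.up ℤ) f.hom := by
  have : ∀ K : Cb P, K.obj.IsKInjective := fun K => by
    obtain ⟨a, b, hab⟩ := K.property.1
    have : K.obj.IsStrictlyGE a := by
      rw [CochainComplex.isStrictlyGE_iff]
      exact fun i hi => hab i (Or.inl hi)
    exact CochainComplex.isKInjective_of_injective _ a
  have h₁ := this K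
  have h₂ := this L
  exact (CochainComplex.IsKInjective.quasiIso_iff _).1 hf

instance isMonoidal_qis_of_injective : (qis P).IsMonoidal := by
  have : (qis P).IsMultiplicative := by dsimp only [qis]; infer_instance
  refine { whiskerLeft := ?_, whiskerRight := ?_ }
  · intro K L L' f hf
    exact homotopyEquivalences_le_quasiIso C (.up ℤ) _
      (homotopyEquiv_tensor₂ _ (homotopyEquiv_of_qis P f hf))
  · intro K K' f hf L
    exact homotopyEquivalences_le_quasiIso C (.up ℤ) _
      (homotopyEquiv_tensor₁ _ (homotopyEquiv_of_qis P f hf))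

end Semisimple

section VectorSpaces

variable (k : Type u) [Field k]

instance : TensorCocomplete (ModuleCat.{u} k) where
  hasCoproducts := inferInstance
  preservesLeft _ := inferInstance
  preservesRight X := preservesColimits_of_natIso (BraidedCategory.tensorLeftIsoTensorRight X)

instance (M : ModuleCat.{u} k) : Injective M := by
  have := Module.injective_of_isSemisimpleRing k M
  exact Module.injective_object_of_injective_module k M

instance : (ModuleCat.isFG.{u} k).IsClosedUnderIsomorphisms where
  of_iso e h := by
    have : Module.Finite k _ := h
    exact Module.Finite.equiv e.toLinearEquiv

lemma isFG_of_isLimit {J : Type} [Finite J] {F : Discrete J ⥤ ModuleCat.{u} k} {c : Cone F}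
    (hc : IsLimit c) (h : ∀ j, Module.Finite k (F.obj j)) : Module.Finite k c.pt := by
  refine Module.Finite.of_injective (LinearMap.pi (fun j => (c.π.app ⟨j⟩).hom)) ?_
  intro x y hxy
  exact Concrete.isLimit_ext F hc x y (fun j => congr_fun hxy j.as)

instance : (ModuleCat.isFG.{u} k).IsClosedUnderFiniteProducts :=
  .of_isClosedUnderLimitsOfShape (fun (J : Type) _ => ⟨by
    rintro X ⟨p⟩
    exact isFG_of_isLimit k p.isLimit p.prop_diag_obj⟩)

/-- The bounded derived tensor category of finite dimensional vector spaces. -/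
abbrev DVect : Type _ := Db (ModuleCat.isFG.{u} k)

end VectorSpaces

section Quivers

variable (k : Type u) [Field k] (V : Type v) [Quiver.{w} V]

/-- All representations of a quiver (without relations). -/
abbrev BigRep := Paths V ⥤ ModuleCat.{u} k

/-- A set of relations on a quiver: linear combinations of parallel paths. Recall that the
objects of `Paths V` are the vertices, that the morphisms are the paths, and that the identities
are the trivial paths. -/
abbrev Relations := ∀ a b : Paths V, Set ((a ⟶ b) →₀ k)

variable {k V}

/-- A linear combination of parallel paths acts on a representation. -/
def act (M : BigRep k V) {a b : Paths V} (r : (a ⟶ b) →₀ k) :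
    M.obj a ⟶ M.obj b :=
  r.sum (fun p c => c • M.map p)

/-- A representation satisfies the relations if all of them act by zero. -/
def Satisfies (R : Relations k V) (M : BigRep k V) : Prop :=
  ∀ (a b : Paths V), ∀ r ∈ R a b, act M r = 0

/-- The finite dimensional representations of a quiver with relations. -/
def isRep (R : Relations k V) : ObjectProperty (BigRep k V) := fun M =>
  (∀ a : Paths V, ModuleCat.isFG k (M.obj a)) ∧ Satisfies R M

/-- Tensor relations: they only involve non-trivial paths, the unit representation
(`k` at every vertex, all arrows acting by the identity) satisfies them, and the finite dimensional
representations satisfying them are closed under the vertexwise tensor product. -/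
class IsTensor (R : Relations k V) : Prop where
  nontrivial (a : Paths V) (r : (a ⟶ a) →₀ k) : r ∈ R a a → r (𝟙 a) = 0
  unit : isRep R (𝟙_ (BigRep k V))
  tensor (M N : BigRep k V) : isRep R M → isRep R N → isRep R (M ⊗ N)

variable (R : Relations k V)

lemma act_naturality {M N : BigRep k V} (f : M ⟶ N) {a b : Paths V} (r : (a ⟶ b) →₀ k) :
    act M r ≫ f.app b = f.app a ≫ act N r := by
  simp only [act, Finsupp.sum, Preadditive.sum_comp, Preadditive.comp_sum, Linear.smul_comp,
    Linear.comp_smul]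
  exact Finset.sum_congr rfl (fun p _ => congrArg _ (f.naturality p))

instance : (isRep R).IsClosedUnderIsomorphisms where
  of_iso {M N} e h := by
    refine ⟨fun a => (ModuleCat.isFG k).prop_of_iso (e.app a) (h.1 a), fun a b r hr => ?_⟩
    have h1 := act_naturality e.inv r
    rw [h.2 a b r hr, comp_zero] at h1
    rw [← cancel_mono (e.app b).inv, Iso.app_inv, h1, zero_comp]

instance : (isRep R).IsClosedUnderFiniteProducts :=
  .of_isClosedUnderLimitsOfShape (fun (J : Type) _ => ⟨by
    rintro X ⟨p⟩
    have hl (a : Paths V) := isLimitOfPreserves ((evaluation (Paths V) (ModuleCat.{u} k)).obj a) p.isLimit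
    refine ⟨fun a => isFG_of_isLimit k (hl a) (fun j => (p.prop_diag_obj j).1 a),
      fun a b r hr => (hl b).hom_ext (fun j => ?_)⟩
    have h1 := act_naturality (p.π.app j) r
    rw [(p.prop_diag_obj j).2 a b r hr, comp_zero] at h1
    exact h1.trans zero_comp.symm⟩)

instance [IsTensor R] : (isRep R).IsMonoidal where
  prop_unit := IsTensor.unit
  prop_tensor M N hM hN := IsTensor.tensor M N hM hN

/-- The bounded derived category of finite dimensional representations of a quiver with tensor
relations, with the vertexwise tensor product. -/
abbrev DRep [IsTensor R] : Type _ := Db (isRep R)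

end Quivers

section Shift

variable {A : Type u} [Category.{v} A] [Abelian A] [MonoidalCategory A] [TensorCocomplete A]
  (P : ObjectProperty A) [P.IsClosedUnderFiniteProducts] [P.IsClosedUnderIsomorphisms]

lemma bounded_shift {K : CochainComplex A ℤ} (hK : bounded P K) (n : ℤ) :
    bounded P (K⟦n⟧) := by
  obtain ⟨⟨a, b, hab⟩, hK⟩ := hK
  exact ⟨⟨a - n, b - n, fun i hi => hab (i + n) (by grind)⟩, fun i => hK (i + n)⟩

/-- The shift of bounded complexes. -/
def shiftCb (n : ℤ) : Cb P ⥤ Cb P :=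
  (bounded P).lift ((bounded P).ι ⋙ shiftFunctor _ n) (fun K => bounded_shift P K.property n)

/-- The passage to the homotopy category commutes with shifts. -/
def quotientKbShift (n : ℤ) :
    shiftCb P n ⋙ quotientKb P ≅ quotientKb P ⋙ shiftFunctor (Kb P) n :=
  Functor.fullyFaithfulCancelRight (boundedH P).ι
    (Functor.isoWhiskerLeft (bounded P).ι
      ((HomotopyCategory.quotient A (.up ℤ)).commShiftIso n) ≪≫
      Functor.isoWhiskerLeft (quotientKb P) ((boundedH P).ι.commShiftIso n).symm)

/-- The localization functor to the bounded derived category commutes with shifts. -/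
def toDbShift (n : ℤ) :
    shiftCb P n ⋙ toDb P ≅ toDb P ⋙ shiftFunctor ((acyclic P).trW.Localization) n :=
  Functor.isoWhiskerRight (quotientKbShift P n) (acyclic P).trW.Q ≪≫
    Functor.isoWhiskerLeft (quotientKb P) ((acyclic P).trW.Q.commShiftIso n)

variable [P.IsMonoidal]

/-- The tensor product of complexes commutes with shifts in the first variable. -/
def tensorShift (K : CochainComplex A ℤ) (n : ℤ) :
    tensorLeft (K⟦n⟧) ≅ tensorLeft K ⋙ shiftFunctor (CochainComplex A ℤ) n :=
  NatIso.ofComponents (fun L => CochainComplex.mapBifunctorShift₁Iso K L (curriedTensor A) n)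
    (fun {L L'} g => by
      exact NatTrans.congr_app
        (NatTrans.shift_comm ((curriedTensor A).map₂CochainComplex.flip.map g) n).symm K)

lemma bounded_tensor {K L : CochainComplex A ℤ} (hK : bounded P K) (hL : bounded P L) :
    bounded P (K ⊗ L) :=
  (bounded P).prop_tensor hK hL

/-- The tensor product of bounded complexes commutes with shifts in the first variable. -/
def tensorShiftCb (K : Cb P) (n : ℤ) :
    tensorLeft ((shiftCb P n).obj K) ≅ tensorLeft K ⋙ shiftCb P n :=
  Functor.fullyFaithfulCancelRight (bounded P).ι
    (Functor.isoWhiskerLeft (bounded P).ι (tensorShift K.obj n))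

variable [(qis P).IsMonoidal]

/-- The monoidal localization functor to the bounded derived category. -/
def locDb : Cb P ⥤ Db P :=
  Localization.Monoidal.toMonoidalCategory (toDb P) (qis P) (Iso.refl _)

instance : (locDb P).IsLocalization (qis P) := inferInstanceAs ((toDb P).IsLocalization (qis P))

instance : (locDb P).Monoidal :=
  inferInstanceAs (Localization.Monoidal.toMonoidalCategory (toDb P) (qis P)
    (Iso.refl _)).Monoidal

/-- Tensoring in the derived category lifts the tensor product of complexes. -/
instance (K : Cb P) : Localization.Lifting (locDb P) (qis P) (tensorLeft K ⋙ locDb P)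
    (tensorLeft ((locDb P).obj K)) :=
  ⟨Functor.Monoidal.commTensorLeft (locDb P) K⟩

/-- The tensor product of the bounded derived category commutes with shifts in the first
variable. -/
lemma tensorShiftDb (X : Db P) (n : ℤ) :
    Nonempty (tensorLeft (X⟦n⟧) ≅ tensorLeft X ⋙ shiftFunctor (Db P) n) := by
  have : (locDb P).EssSurj := Localization.essSurj (locDb P) (qis P)
  let e : shiftCb P n ⋙ locDb P ≅ locDb P ⋙ shiftFunctor (Db P) n := toDbShift P n
  let K := (locDb P).objPreimage X
  let i : (locDb P).obj K ≅ X := (locDb P).objObjPreimageIso X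
  let i₁ : (locDb P).obj ((shiftCb P n).obj K) ≅ X⟦n⟧ := e.app K ≪≫ (shiftFunctor _ n).mapIso i
  refine ⟨(curriedTensor (Db P)).mapIso i₁.symm ≪≫ ?_ ≪≫
    Functor.isoWhiskerRight ((curriedTensor (Db P)).mapIso i) (shiftFunctor (Db P) n)⟩
  exact Localization.liftNatIso (locDb P) (qis P)
    (tensorLeft ((shiftCb P n).obj K) ⋙ locDb P)
    ((tensorLeft K ⋙ locDb P) ⋙ shiftFunctor (Db P) n) _ _
    (Functor.isoWhiskerRight (tensorShiftCb P K n) (locDb P) ≪≫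
      Functor.isoWhiskerLeft (tensorLeft K) e)

end Shift

end BoundedDerived

namespace TensorTriangulated

/-! ### The spectrum of a tensor triangulated category -/

section Spectrum

variable (T : Type u) [Category.{v} T] [Preadditive T] [HasZeroObject T] [HasShift T ℤ]
  [∀ n : ℤ, (shiftFunctor T n).Additive] [Pretriangulated T] [MonoidalCategory T]

/-- A tensor ideal: a full triangulated subcategory which is thick (closed under direct summands)
and closed under tensoring with arbitrary objects. -/
class IsTensorIdeal {T : Type u} [Category.{v} T] [Preadditive T] [HasZeroObject T] [HasShift T ℤ]
    [∀ n : ℤ, (shiftFunctor T n).Additive] [Pretriangulated T] [MonoidalCategory T]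
    (I : ObjectProperty T) : Prop extends I.IsTriangulated, I.IsStableUnderRetracts where
  tensorLeft (X Y : T) : I Y → I (X ⊗ Y)
  tensorRight (X Y : T) : I X → I (X ⊗ Y)

/-- The set of prime tensor ideals: proper tensor ideals `P` such that `X ⊗ Y ∈ P` implies
`X ∈ P` or `Y ∈ P`. -/
@[ext]
structure Spc : Type (max u v) where
  /-- The underlying full subcategory. -/
  ideal : ObjectProperty T
  isTensorIdeal : IsTensorIdeal ideal
  proper : ∃ X, ¬ ideal X
  prime (X Y : T) : ideal (X ⊗ Y) → ideal X ∨ ideal Y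

attribute [instance] Spc.isTensorIdeal

variable {T}

instance (p : Spc T) : p.ideal.IsClosedUnderIsomorphisms where
  of_iso e h := p.ideal.prop_of_retract ⟨e.inv, e.hom, e.inv_hom_id⟩ h

/-- The closed subset `Z(S)` of the primes which do not meet `S`. -/
def Spc.zeros (S : Set T) : Set (Spc T) := {p | ∀ X ∈ S, ¬ p.ideal X}

open ZeroObject in
/-- The Zariski topology: the closed subsets are the subsets `Z(S)`. -/
instance : TopologicalSpace (Spc T) :=
  TopologicalSpace.ofClosed {C | ∃ S : Set T, C = Spc.zeros S}
    ⟨{0}, by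
      ext p
      simp only [Set.mem_empty_iff_false, Spc.zeros, Set.mem_singleton_iff, forall_eq,
        Set.mem_ofPred_eq, false_iff, not_not]
      exact p.ideal.prop_zero⟩
    (fun F hF => ⟨{X | ∃ C ∈ F, ∃ S, C = Spc.zeros S ∧ X ∈ S}, by
      ext p
      constructor
      · rintro h X ⟨C, hC, S, rfl, hX⟩
        exact h _ hC X hX
      · intro h C hC
        obtain ⟨S, rfl⟩ := hF hC
        exact fun X hX => h X ⟨_, hC, S, rfl, hX⟩⟩)
    (by
      rintro _ ⟨S, rfl⟩ _ ⟨S', rfl⟩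
      refine ⟨{X | ∃ a ∈ S, ∃ b ∈ S', X = (a ⊞ b)}, ?_⟩
      ext p
      constructor
      · rintro (h | h) _ ⟨a, ha, b, hb, rfl⟩ hab
        · exact h a ha (p.ideal.prop_of_retract ⟨biprod.inl, biprod.fst, biprod.inl_fst⟩ hab)
        · exact h b hb (p.ideal.prop_of_retract ⟨biprod.inr, biprod.snd, biprod.inr_snd⟩ hab)
      · intro h
        by_contra hn
        simp only [Spc.zeros, Set.mem_union, Set.mem_ofPred_eq, not_or, not_forall, not_not] at hn
        obtain ⟨⟨a, ha, hpa⟩, ⟨b, hb, hpb⟩⟩ := hn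
        exact h _ ⟨a, ha, b, hb, rfl⟩
          (p.ideal.prop_of_iso (biprod.isoProd a b).symm (p.ideal.prop_prod a b hpa hpb)))

/-- The support of an object: the set of primes which do not contain it. -/
def supp (X : T) : Set (Spc T) := {p | ¬ p.ideal X}

/-- The full subcategory of the objects whose support is contained in `Z`. -/
def supported (Z : Set (Spc T)) : ObjectProperty T := fun X => supp X ⊆ Z

lemma supported_iff (Z : Set (Spc T)) (X : T) :
    supported Z X ↔ ∀ p : Spc T, p ∉ Z → p.ideal X := by
  constructor
  · intro h p hp
    by_contra hn
    exact hp (h hn)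
  · intro h p hp
    by_contra hn
    exact hp (h p hn)

lemma supported_mono {Z Z' : Set (Spc T)} (h : Z ⊆ Z') : supported Z ≤ supported Z' :=
  fun _ hX => hX.trans h

open Pretriangulated ZeroObject in
instance (Z : Set (Spc T)) : (supported Z).IsTriangulated where
  exists_zero := ⟨0, isZero_zero T, (supported_iff Z _).2 (fun p _ => p.ideal.prop_zero)⟩
  isStableUnderShiftBy n := ⟨fun _ hX => (supported_iff Z _).2 (fun p hp =>
    p.ideal.le_shift n _ ((supported_iff Z _).1 hX p hp))⟩
  ext₂' D hD h₁ h₃ := ObjectProperty.le_isoClosure _ _ ((supported_iff Z _).2 (fun p hp =>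
    p.ideal.ext_of_isTriangulatedClosed₂ D hD ((supported_iff Z _).1 h₁ p hp)
      ((supported_iff Z _).1 h₃ p hp)))

variable [IsTriangulated T]

/-- The Verdier quotient of `T` by the objects supported on `Z`. -/
abbrev Quot (Z : Set (Spc T)) : Type _ := (supported Z).trW.Localization

/-- The localization functor to the Verdier quotient. -/
abbrev toQuot (Z : Set (Spc T)) : T ⥤ Quot Z := (supported Z).trW.Q

/-- The functor between Verdier quotients induced by an inclusion. -/
def quotMap {Z Z' : Set (Spc T)} (h : Z ⊆ Z') : Quot Z ⥤ Quot Z' :=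
  Localization.Construction.lift (toQuot Z')
    (fun _ _ _ hf => (supported Z').trW.Q_inverts _
      ((supported Z).trW_monotone (supported_mono h) _ hf))

lemma toQuot_quotMap {Z Z' : Set (Spc T)} (h : Z ⊆ Z') : toQuot Z ⋙ quotMap h = toQuot Z' :=
  Localization.Construction.fac _ _

lemma quotMap_refl (Z : Set (Spc T)) : quotMap (subset_refl Z) = 𝟭 (Quot Z) :=
  Localization.Construction.uniq _ _ (toQuot_quotMap _)

lemma quotMap_trans {Z Z' Z'' : Set (Spc T)} (h : Z ⊆ Z') (h' : Z' ⊆ Z'') :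
    quotMap h ⋙ quotMap h' = quotMap (h.trans h') :=
  Localization.Construction.uniq _ _ (by
    rw [toQuot_quotMap, ← Functor.assoc, toQuot_quotMap, toQuot_quotMap])

instance {Z Z' : Set (Spc T)} (h : Z ⊆ Z') : (quotMap h).Additive := by
  rw [Localization.functor_additive_iff (toQuot Z) (supported Z).trW, toQuot_quotMap]
  infer_instance

/-- The ring of endomorphisms of the unit object in the Verdier quotient. -/
abbrev EndQuot (Z : Set (Spc T)) : Type _ := End ((toQuot Z).obj (𝟙_ T))

/-- The map between endomorphism rings of the unit induced by an inclusion. -/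
def endQuotMap {Z Z' : Set (Spc T)} (h : Z ⊆ Z') : EndQuot Z →+* EndQuot Z' where
  toFun f := (quotMap h).map f
  map_one' := (quotMap h).map_id _
  map_mul' f g := (quotMap h).map_comp g f
  map_zero' := (quotMap h).map_zero _ _
  map_add' _ _ := (quotMap h).map_add

/-- The presheaf of rings `W ↦ End (U)`, where the endomorphisms are taken in the Verdier
quotient of `T` by the objects supported on the complement of `W`. -/
def presheaf : (TopologicalSpace.Opens (Spc T))ᵒᵖ ⥤ RingCat where
  obj W := RingCat.of (EndQuot (W.unop : Set (Spc T))ᶜ)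
  map {W W'} i := RingCat.ofHom (endQuotMap (Set.compl_subset_compl.2 (leOfHom i.unop)))
  map_id W := by
    ext f
    exact (Functor.congr_hom (quotMap_refl _) f).trans
      ((Category.id_comp _).trans (Category.comp_id _))
  map_comp {W W' W''} i j := by
    ext f
    have h := Functor.congr_hom (quotMap_trans (Set.compl_subset_compl.2 (leOfHom i.unop))
      (Set.compl_subset_compl.2 (leOfHom j.unop))) f
    exact (h.trans ((Category.id_comp _).trans (Category.comp_id _))).symm

variable (T)

/-- The structure sheaf on `Spc T`: the sheaf associated with `presheaf`. -/
def structureSheaf : Sheaf (Opens.grothendieckTopology (Spc T)) RingCat.{max u v} :=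
  (presheafToSheaf _ _).obj presheaf

/-- The ring of global sections of the structure sheaf. -/
abbrev globalSections : Type (max u v) := (structureSheaf T).obj.obj (.op ⊤)

/-- The canonical map from the endomorphisms of the unit object to the global sections of the
structure sheaf. -/
def toGlobalSections : End (𝟙_ T) →+* globalSections T :=
  ((toSheafify (Opens.grothendieckTopology (Spc T)) presheaf).app (.op ⊤)).hom.comp
    { toFun f := (toQuot _).map f
      map_one' := (toQuot _).map_id _
      map_mul' f g := (toQuot _).map_comp g f
      map_zero' := (toQuot _).map_zero _ _
      map_add' _ _ := (toQuot _).map_add }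

end Spectrum

/-! ### Points and the algebra of natural transformations between them -/

section Points

variable (k : Type w) [CommRing k]
variable (T : Type u) [Category.{v} T] [Preadditive T] [HasZeroObject T] [HasShift T ℤ]
  [∀ n : ℤ, (shiftFunctor T n).Additive] [Pretriangulated T] [MonoidalCategory T] [Linear k T]
variable (S : Type*) [Category* S] [Preadditive S] [HasZeroObject S] [HasShift S ℤ]
  [∀ n : ℤ, (shiftFunctor S n).Additive] [Pretriangulated S] [MonoidalCategory S] [Linear k S]

/-- A `k`-linear exact (that is, triangulated) functor between `k`-linear tensor triangulated
categories which preserves tensor products and unit objects. -/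
structure TensorFunctor where
  /-- The underlying functor. -/
  functor : T ⥤ S
  /-- The compatibility with the shifts which is part of the structure of an exact functor. -/
  commShift : functor.CommShift ℤ
  isTriangulated : functor.IsTriangulated
  linear : functor.Linear k
  monoidal : Nonempty functor.Monoidal

attribute [instance] TensorFunctor.commShift TensorFunctor.isTriangulated TensorFunctor.linear

namespace TensorFunctor

variable {k T S} [∀ n : ℤ, (shiftFunctor S n).Linear k]

/-- The `k`-module of natural transformations of exact functors, which are the natural
transformations that commute with the shifts. -/
def homs (F G : TensorFunctor k T S) : Submodule k (F.functor ⟶ G.functor) where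
  carrier := {τ | NatTrans.CommShift τ ℤ}
  add_mem' {τ τ'} h h' := ⟨fun n => by
    ext X
    have h1 := NatTrans.congr_app (h.shift_comm n) X
    have h2 := NatTrans.congr_app (h'.shift_comm n) X
    simp only [NatTrans.comp_app, Functor.whiskerRight_app, Functor.whiskerLeft_app,
      NatTrans.app_add, Functor.map_add, Preadditive.comp_add, Preadditive.add_comp] at h1 h2 ⊢
    rw [h1, h2]⟩
  zero_mem' := ⟨fun n => by
    ext X
    simp⟩
  smul_mem' c τ h := ⟨fun n => by
    ext X
    have h1 := NatTrans.congr_app (h.shift_comm n) X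
    simp only [NatTrans.comp_app, Functor.whiskerRight_app, Functor.whiskerLeft_app,
      NatTrans.app_smul, Functor.map_smul, Linear.comp_smul, Linear.smul_comp] at h1 ⊢
    rw [h1]⟩

instance : Category (TensorFunctor k T S) where
  Hom F G := homs F G
  id F := ⟨𝟙 F.functor, inferInstanceAs (NatTrans.CommShift (𝟙 F.functor) ℤ)⟩
  comp {F G H} a b := ⟨a.1 ≫ b.1, by
    have h₁ : NatTrans.CommShift a.1 ℤ := a.2
    have h₂ : NatTrans.CommShift b.1 ℤ := b.2
    exact inferInstanceAs (NatTrans.CommShift (a.1 ≫ b.1) ℤ)⟩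
  id_comp a := Subtype.ext (Category.id_comp a.1)
  comp_id a := Subtype.ext (Category.comp_id a.1)
  assoc a b c := Subtype.ext (Category.assoc a.1 b.1 c.1)

instance : Preadditive (TensorFunctor k T S) where
  homGroup F G := inferInstanceAs (AddCommGroup (homs F G))
  add_comp _ _ _ a b c := Subtype.ext (Preadditive.add_comp _ _ _ a.1 b.1 c.1)
  comp_add _ _ _ a b c := Subtype.ext (Preadditive.comp_add _ _ _ a.1 b.1 c.1)

instance : Linear k (TensorFunctor k T S) where
  homModule F G := inferInstanceAs (Module k (homs F G))
  smul_comp _ _ _ r a b := Subtype.ext (Linear.smul_comp _ _ _ r a.1 b.1)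
  comp_smul _ _ _ a r b := Subtype.ext (Linear.comp_smul _ _ _ a.1 r b.1)

end TensorFunctor

variable [∀ n : ℤ, (shiftFunctor S n).Linear k]

/-- The set `T(S)` of `S`-valued points of `T`: isomorphism classes of tensor functors. -/
def Points : Type _ := Quotient (isIsomorphicSetoid (TensorFunctor k T S))

variable {k T S} in
/-- A representative of a point. -/
def Points.functor (x : Points k T S) : TensorFunctor k T S := Quotient.out x

/-- The product `A(T, S)` of the spaces of natural transformations between all pairs of
`S`-valued points of `T`. -/
def PointAlgebra : Type _ := ∀ x y : Points k T S, (x.functor ⟶ y.functor)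

namespace PointAlgebra

instance : AddCommGroup (PointAlgebra k T S) :=
  inferInstanceAs (AddCommGroup (∀ x y : Points k T S, (x.functor ⟶ y.functor)))

instance : Module k (PointAlgebra k T S) :=
  inferInstanceAs (Module k (∀ x y : Points k T S, (x.functor ⟶ y.functor)))

variable {k T S}

open Classical in
/-- The diagonal element with given components. -/
def diagonal (f : ∀ x : Points k T S, (x.functor ⟶ x.functor)) : PointAlgebra k T S :=
  fun x y => if h : x = y then f x ≫ eqToHom (h ▸ rfl) else 0

variable [Finite (Points k T S)]

/-- The product is given by composition of natural transformations, the product of two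
non-composable ones being zero. -/
instance : Mul (PointAlgebra k T S) where
  mul a b x z := ∑ᶠ y, a x y ≫ b y z

instance : One (PointAlgebra k T S) where
  one := diagonal (fun _ => 𝟙 _)

lemma mul_apply (a b : PointAlgebra k T S) [Fintype (Points k T S)] (x z : Points k T S) :
    (a * b) x z = ∑ y, a x y ≫ b y z :=
  finsum_eq_sum_of_fintype _

lemma diagonal_self (f : ∀ x : Points k T S, (x.functor ⟶ x.functor)) (x : Points k T S) :
    diagonal f x x = f x := by
  simp [diagonal]

lemma diagonal_ne (f : ∀ x : Points k T S, (x.functor ⟶ x.functor)) {x y : Points k T S}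
    (h : x ≠ y) : diagonal f x y = 0 :=
  dif_neg h

@[ext]
lemma ext {a b : PointAlgebra k T S} (h : ∀ x y, a x y = b x y) : a = b :=
  funext₂ h

lemma add_apply (a b : PointAlgebra k T S) (x y : Points k T S) :
    (a + b) x y = a x y + b x y := rfl

lemma smul_apply (c : k) (a : PointAlgebra k T S) (x y : Points k T S) :
    (c • a) x y = c • a x y := rfl

lemma zero_apply (x y : Points k T S) : (0 : PointAlgebra k T S) x y = 0 := rfl

lemma one_mul' (a : PointAlgebra k T S) : 1 * a = a := by
  have := Fintype.ofFinite (Points k T S)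
  ext x z
  rw [mul_apply, Finset.sum_eq_single x]
  · exact (congrArg (· ≫ a x z) (diagonal_self _ x)).trans (Category.id_comp _)
  · intro y _ hy
    exact (congrArg (· ≫ a y z) (diagonal_ne _ hy.symm)).trans zero_comp
  · simp

lemma mul_one' (a : PointAlgebra k T S) : a * 1 = a := by
  have := Fintype.ofFinite (Points k T S)
  ext x z
  rw [mul_apply, Finset.sum_eq_single z]
  · exact (congrArg (a x z ≫ ·) (diagonal_self _ z)).trans (Category.comp_id _)
  · intro y _ hy
    exact (congrArg (a x y ≫ ·) (diagonal_ne _ hy)).trans comp_zero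
  · simp

lemma mul_assoc' (a b c : PointAlgebra k T S) : a * b * c = a * (b * c) := by
  have := Fintype.ofFinite (Points k T S)
  ext x z
  simp only [mul_apply, Preadditive.sum_comp, Preadditive.comp_sum, Category.assoc]
  exact Finset.sum_comm

instance : Ring (PointAlgebra k T S) where
  __ := (inferInstance : AddCommGroup (PointAlgebra k T S))
  mul_assoc := mul_assoc'
  one_mul := one_mul'
  mul_one := mul_one'
  left_distrib a b c := by
    have := Fintype.ofFinite (Points k T S)
    ext x z
    simp only [mul_apply, add_apply, Preadditive.comp_add, Finset.sum_add_distrib]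
  right_distrib a b c := by
    have := Fintype.ofFinite (Points k T S)
    ext x z
    simp only [mul_apply, add_apply, Preadditive.add_comp, Finset.sum_add_distrib]
  zero_mul a := by
    have := Fintype.ofFinite (Points k T S)
    ext x z
    simp only [mul_apply, zero_apply, zero_comp, Finset.sum_const_zero]
  mul_zero a := by
    have := Fintype.ofFinite (Points k T S)
    ext x z
    simp only [mul_apply, zero_apply, comp_zero, Finset.sum_const_zero]

instance : Algebra k (PointAlgebra k T S) :=
  Algebra.ofModule
    (fun c a b => by
      have := Fintype.ofFinite (Points k T S)
      ext x z
      simp only [mul_apply, smul_apply, Linear.smul_comp, Finset.smul_sum])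
    (fun c a b => by
      have := Fintype.ofFinite (Points k T S)
      ext x z
      simp only [mul_apply, smul_apply, Linear.comp_smul, Finset.smul_sum])

end PointAlgebra

end Points

/-! ### The action of the endomorphisms of the unit object -/

section UnitAction

variable (k : Type w) [CommRing k]
variable {T : Type u} [Category.{v} T] [Preadditive T] [HasZeroObject T] [HasShift T ℤ]
  [∀ n : ℤ, (shiftFunctor T n).Additive] [Pretriangulated T] [MonoidalCategory T] [Linear k T]

/-- The natural transformation of the identity functor induced by an endomorphism `φ` of the unit
object: on `M` it is `M ≅ M ⊗ U ⟶ M ⊗ U ≅ M`, where the middle map is `1 ⊗ φ`. -/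
@[simps]
def unitAction (φ : End (𝟙_ T)) : 𝟭 T ⟶ 𝟭 T where
  app M := (ρ_ M).inv ≫ M ◁ φ ≫ (ρ_ M).hom
  naturality {M N} f := by
    simp only [Functor.id_obj, Functor.id_map, Category.assoc]
    rw [rightUnitor_inv_naturality_assoc, ← whisker_exchange_assoc, rightUnitor_naturality]

variable (T) in
/-- The tensor product commutes with shifts in the first variable. -/
class TensorShift : Prop where
  nonempty_iso (X : T) (n : ℤ) :
    Nonempty (tensorLeft (X⟦n⟧) ≅ tensorLeft X ⋙ shiftFunctor T n)

lemma unitAction_shift [TensorShift T] (φ : End (𝟙_ T)) (M : T) (n : ℤ) :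
    (unitAction φ).app (M⟦n⟧) = ((unitAction φ).app M)⟦n⟧' := by
  obtain ⟨E, hE, hn⟩ : ∃ E : (M⟦n⟧) ⊗ 𝟙_ T ⟶ (M ⊗ 𝟙_ T)⟦n⟧, IsIso E ∧
      (M⟦n⟧) ◁ φ ≫ E = E ≫ (M ◁ φ)⟦n⟧' := by
    obtain ⟨e⟩ := TensorShift.nonempty_iso M n
    exact ⟨e.hom.app (𝟙_ T), inferInstanceAs (IsIso (e.hom.app (𝟙_ T))), e.hom.naturality φ⟩
  let u : M⟦n⟧ ⟶ M⟦n⟧ := (ρ_ (M⟦n⟧)).inv ≫ E ≫ ((ρ_ M).hom)⟦n⟧'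
  have hu : IsIso u := by dsimp only [u]; infer_instance
  have h1 : (unitAction φ).app (M⟦n⟧) ≫ u = u ≫ ((unitAction φ).app M)⟦n⟧' := by
    have h2 : ((unitAction φ).app M)⟦n⟧' =
        ((ρ_ M).inv)⟦n⟧' ≫ (M ◁ φ)⟦n⟧' ≫ ((ρ_ M).hom)⟦n⟧' := by
      rw [← Functor.map_comp, ← Functor.map_comp]
      rfl
    have h3 : ((ρ_ M).hom)⟦n⟧' ≫ ((ρ_ M).inv)⟦n⟧' = 𝟙 _ := by
      rw [← Functor.map_comp, Iso.hom_inv_id, CategoryTheory.Functor.map_id]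
    rw [h2]
    calc _ = (ρ_ (M⟦n⟧)).inv ≫ ((M⟦n⟧) ◁ φ ≫ E) ≫ ((ρ_ M).hom)⟦n⟧' := by
          simp [unitAction, u]
      _ = (ρ_ (M⟦n⟧)).inv ≫ E ≫ (((ρ_ M).hom)⟦n⟧' ≫ ((ρ_ M).inv)⟦n⟧') ≫
            (M ◁ φ)⟦n⟧' ≫ ((ρ_ M).hom)⟦n⟧' := by
          rw [hn, h3, Category.id_comp, Category.assoc]
      _ = _ := by
          simp only [u, Category.assoc]
  rw [← cancel_epi u, ← h1]
  exact ((unitAction φ).naturality u)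

variable {S : Type*} [Category* S] [Preadditive S] [HasZeroObject S] [HasShift S ℤ]
  [∀ n : ℤ, (shiftFunctor S n).Additive] [Pretriangulated S] [MonoidalCategory S] [Linear k S]
  [∀ n : ℤ, (shiftFunctor S n).Linear k]

variable {k} in
/-- The endomorphism `F(Φ)` of a tensor functor `F` induced by an endomorphism of the unit
object. -/
def TensorFunctor.mapUnitAction [TensorShift T] (F : TensorFunctor k T S) (φ : End (𝟙_ T)) :
    F ⟶ F :=
  ⟨{ app := fun M => F.functor.map ((unitAction φ).app M)
     naturality := fun M N f => by
      rw [← F.functor.map_comp, ← F.functor.map_comp]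
      exact congrArg _ ((unitAction φ).naturality f) },
    ⟨fun n => by
      ext M
      have h := (F.functor.commShiftIso n).hom.naturality ((unitAction φ).app M)
      have h' := unitAction_shift φ M n
      exact h.symm.trans (congrArg (· ≫ (F.functor.commShiftIso n).hom.app M)
        (congrArg F.functor.map h'.symm))⟩⟩

variable (S) in
/-- The map from the endomorphisms of the unit object to the algebra `A(T, S)`, which sends `φ`
to the family of the `F(Φ)`. -/
def unitToPointAlgebra [TensorShift T] (φ : End (𝟙_ T)) : PointAlgebra k T S :=
  PointAlgebra.diagonal (fun x => x.functor.mapUnitAction φ)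

end UnitAction

end TensorTriangulated

namespace BoundedDerived

section Instances

variable {A : Type u} [Category.{v} A] [Abelian A] [MonoidalCategory A] [TensorCocomplete A]
  (P : ObjectProperty A) [P.IsClosedUnderFiniteProducts] [P.IsClosedUnderIsomorphisms]

instance (k : Type w) [CommRing k] [Linear k A] (n : ℤ) : (shiftFunctor (Kb P) n).Linear k where
  map_smul {X Y} f r := by
    apply (boundedH P).ι.map_injective
    have h₁ := NatIso.naturality_2 ((boundedH P).ι.commShiftIso n) f
    have h₂ := NatIso.naturality_2 ((boundedH P).ι.commShiftIso n) (r • f)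
    simp only [Functor.comp_map] at h₁ h₂
    refine h₂.symm.trans (Eq.trans ?_ (congrArg (r • ·) h₁))
    rw [Functor.map_smul, Functor.map_smul, Linear.smul_comp, Linear.comp_smul]

variable [P.IsMonoidal] [(qis P).IsMonoidal]

instance : TensorTriangulated.TensorShift (Db P) := ⟨tensorShiftDb P⟩

instance (k : Type w) [CommRing k] [Linear k A] (n : ℤ) : (shiftFunctor (Db P) n).Linear k :=
  inferInstanceAs ((shiftFunctor (acyclic P).trW.Localization n).Linear k)

end Instances

end BoundedDerived

end

universe w v u

noncomputable section

namespace BoundedDerived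

/-! ### Evaluation of complexes of diagrams as a monoidal functor -/

section EvalMonoidal

open HomologicalComplex

variable {J : Type u} [Category.{v} J] {C : Type*} [Category* C] [Abelian C]
  [MonoidalCategory C] [TensorCocomplete C]

/-! Write `U` for the unit of `T`. Each vertex `i` gives a tensor functor `ev_i : T ⥤ D^b(k)`, which
sends a complex of representations to its complex of values at `i`. The theorem follows from three
facts about these functors.

Points. Let `S_i` be the one-dimensional representation at `i`. For `i ≠ j` the tensor product of
`S_i` and `S_j` is zero, and `D^b(k)` has no zero divisors, so a tensor functor `F` kills all the
`S_j` with at most one exception. It cannot kill all of them, because the unit is built from them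
and `F(U) ≠ 0`. As there are no oriented cycles, representations can be cut along convex sets of
vertices. If `S_i` is the survivor, the maps in the zigzag `M ← (part of M reachable from i) → (part
of M at i)` have cones built from the other `S_j`, so `F` inverts them, and `F` only depends on the
stalk complex at `i` (`exists_stalkKb_iso`). Bounded complexes of finite dimensional vector spaces
are, up to homotopy, summands of finite sums of shifts of `k`, and the graded endomorphism ring of
`k` is `k`. So linear functors on them which commute with shifts, and their transformations, are
determined by the value at `k`. Hence `F ≅ ev_i` (`exists_iso_evalTensorFunctor`) and all
endomorphisms of `F` are scalars (`end_eq_smul`).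

Unit. An endomorphism of `U` acts on each `ev_i(U) ≅ k` by a scalar. A path from `i` to `j` induces
a transformation `ev_i ⟶ ev_j` which is non-zero at `U`, so the scalars are constant along paths.
They determine the endomorphism, because a chain map from `U` to a complex in non-negative degrees
admits no homotopies (`end_unit_eq_zero`), and every function constant along paths occurs
(`exists_end_unit`). This gives `k^{π₀(Q)}`.

Comparison. A central element of `A(T)` commutes with the idempotents of the points, so it is
diagonal with scalar entries; commuting with the transformations given by paths makes the scalars
constant along paths. So the center is the image of `End(U)`. The kernel of a point `F` is a prime,
and `F` extends to the Verdier quotients that enter the stalk there; mapping the presheaf to a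
skyscraper sheaf yields a character of the global sections for each point, and together these form
`d`. Conversely, a composition of transformations from one point to another and back is zero, so
taking the diagonal scalar at a point is a ring homomorphism. Doing this at one vertex of each
component gives a map `A(T) → k^{π₀(Q)} ≅ End(U)`, and `u` is its composite with `α`. -/

def evalUnit (j : J) : 𝟙_ (CochainComplex C ℤ) ≅ (evalC j).obj (𝟙_ (CochainComplex (J ⥤ C) ℤ)) :=
  ((singleMapHomologicalComplex ((evaluation J C).obj j) (.up ℤ) 0).app (𝟙_ (J ⥤ C))).symm

lemma evalUnit_hom_f (j : J) :
    (singleObjXSelf (.up ℤ) 0 (𝟙_ C)).inv ≫ (evalUnit (C := C) j).hom.f 0 =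
      (singleObjXSelf (.up ℤ) 0 (𝟙_ (J ⥤ C))).inv.app j := by
  dsimp only [evalUnit, Iso.symm_hom, Iso.app_inv]
  rw [singleMapHomologicalComplex_inv_app_self]
  exact Iso.inv_hom_id_assoc (singleObjXSelf (.up ℤ) 0 (𝟙_ C)) _

lemma leftUnitor_inv_f (K : CochainComplex C ℤ) (n : ℤ) :
    (λ_ K).inv.f n = (λ_ (K.X n)).inv ≫ ((singleObjXSelf (.up ℤ) 0 (𝟙_ C)).inv ▷ (K.X n)) ≫
      ιTensorObj (tensorUnit C (.up ℤ)) K 0 n n (zero_add n) :=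
  leftUnitor'_inv K n

lemma rightUnitor_inv_f (K : CochainComplex C ℤ) (n : ℤ) :
    (ρ_ K).inv.f n = (ρ_ (K.X n)).inv ≫ ((K.X n) ◁ (singleObjXSelf (.up ℤ) 0 (𝟙_ C)).inv) ≫
      ιTensorObj K (tensorUnit C (.up ℤ)) n 0 n (add_zero n) :=
  rightUnitor'_inv K n

lemma ι_tensorHom_f {K K' L L' : CochainComplex C ℤ} (f : K ⟶ K') (g : L ⟶ L') (a b n : ℤ)
    (h : a + b = n) :
    ιTensorObj K L a b n h ≫ (f ⊗ₘ g).f n = (f.f a ⊗ₘ g.f b) ≫ ιTensorObj K' L' a b n h := by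
  refine (ι_mapBifunctorMap f g (curriedTensor C) (.up ℤ) a b n h).trans ?_
  rw [MonoidalCategory.tensorHom_def, Category.assoc]
  rfl

lemma ι_whiskerRight_f {K K' : CochainComplex C ℤ} (f : K ⟶ K') (L : CochainComplex C ℤ)
    (a b n : ℤ) (h : a + b = n) :
    ιTensorObj K L a b n h ≫ (f ▷ L).f n = (f.f a ▷ L.X b) ≫ ιTensorObj K' L a b n h := by
  refine (ι_tensorHom_f f (𝟙 L) a b n h).trans ?_
  rw [id_f, MonoidalCategory.tensorHom_id]

lemma ι_whiskerLeft_f (K : CochainComplex C ℤ) {L L' : CochainComplex C ℤ} (g : L ⟶ L')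
    (a b n : ℤ) (h : a + b = n) :
    ιTensorObj K L a b n h ≫ (K ◁ g).f n = (K.X a ◁ g.f b) ≫ ιTensorObj K L' a b n h := by
  refine (ι_tensorHom_f (𝟙 K) g a b n h).trans ?_
  rw [id_f, MonoidalCategory.id_tensorHom]

lemma ι_associator_hom_f (K L M : CochainComplex C ℤ) (a b c n m m' : ℤ)
    (hm : a + b = m) (hm' : b + c = m') (h : m + c = n) (h' : a + m' = n) :
    (ιTensorObj K L a b m hm ▷ M.X c) ≫ ιTensorObj (K ⊗ L) M m c n h ≫ (α_ K L M).hom.f n =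
      (α_ _ _ _).hom ≫ (K.X a ◁ ιTensorObj L M b c m' hm') ≫
        ιTensorObj K (L ⊗ M) a m' n h' := by
  subst hm hm'
  have := GradedObject.Monoidal.ιTensorObj₃'_associator_hom K.X L.X M.X a b c n h
  refine (Category.assoc _ _ _).symm.trans (this.trans ?_)
  rfl

/-- The tensorator of the evaluation functor on complexes of diagrams. -/
def evalμ (j : J) (K L : CochainComplex (J ⥤ C) ℤ) :
    (evalC j).obj K ⊗ (evalC j).obj L ≅ (evalC j).obj (K ⊗ L) :=
  asIso (evalTensor j K L)

lemma ι_evalμ_f (j : J) (K L : CochainComplex (J ⥤ C) ℤ) (a b n : ℤ) (h : a + b = n) :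
    ιTensorObj ((evalC j).obj K) ((evalC j).obj L) a b n h ≫ (evalμ j K L).hom.f n =
      (ιTensorObj K L a b n h).app j :=
  ι_evalTensor j K L a b n h

lemma tensorObj₃'_hom_ext {K L M : CochainComplex C ℤ} {n : ℤ} {X : C}
    {f g : ((K ⊗ L) ⊗ M).X n ⟶ X}
    (h : ∀ a b c m (hm : a + b = m) (hn : m + c = n),
      (ιTensorObj K L a b m hm ▷ M.X c) ≫ ιTensorObj (K ⊗ L) M m c n hn ≫ f =
      (ιTensorObj K L a b m hm ▷ M.X c) ≫ ιTensorObj (K ⊗ L) M m c n hn ≫ g) :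
    f = g := by
  refine GradedObject.Monoidal.tensorObj₃'_ext (X₁ := K.X) (X₂ := L.X) (X₃ := M.X) f g
    (fun a b c hn => ?_)
  have := h a b c _ rfl hn
  exact (Category.assoc _ _ _).trans (this.trans (Category.assoc _ _ _).symm)

/-- On a summand of the triple tensor product both sides reduce to `ι_associator_hom_f`: once for
the evaluated complexes, and once for the complexes of diagrams, evaluated at `j`. -/
lemma evalμ_associativity (j : J) (K L M : CochainComplex (J ⥤ C) ℤ) :
    (evalμ j K L).hom ▷ (evalC j).obj M ≫ (evalμ j (K ⊗ L) M).hom ≫ (evalC j).map (α_ K L M).hom =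
      (α_ ((evalC j).obj K) ((evalC j).obj L) ((evalC j).obj M)).hom ≫
        (evalC j).obj K ◁ (evalμ j L M).hom ≫ (evalμ j K (L ⊗ M)).hom := by
  ext n
  refine tensorObj₃'_hom_ext (fun a b c m hm hn => ?_)
  have hm' : b + c = b + c := rfl
  have hn' : a + (b + c) = n := by omega
  have e1 := NatTrans.congr_app (ι_associator_hom_f K L M a b c n m _ hm hm' hn hn') j
  have e2 := ι_associator_hom_f ((evalC j).obj K) ((evalC j).obj L) ((evalC j).obj M)
    a b c n m _ hm hm' hn hn'
  have e3 := ι_whiskerRight_f (evalμ j K L).hom ((evalC j).obj M) m c n hn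
  have e4 := ι_whiskerLeft_f ((evalC j).obj K) (evalμ j L M).hom a (b + c) n hn'
  have e5 := ι_evalμ_f j K L a b m hm
  have e6 := ι_evalμ_f j L M b c _ hm'
  have e7 := ι_evalμ_f j (K ⊗ L) M m c n hn
  have e8 := ι_evalμ_f j K (L ⊗ M) a _ n hn'
  simp only [comp_f]
  rw [reassoc_of% e3, reassoc_of% e2, reassoc_of% e4, e8, ← comp_whiskerRight_assoc]
  erw [e5, reassoc_of% e7]
  have e9 := (MonoidalCategory.whiskerLeft_comp (((evalC j).obj K).X a) _ _).symm.trans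
    (congrArg (((evalC j).obj K).X a ◁ ·) e6)
  erw [reassoc_of% e9]
  exact e1

lemma evalμ_left_unitality (j : J) (K : CochainComplex (J ⥤ C) ℤ) :
    (λ_ ((evalC j).obj K)).hom =
      (evalUnit j).hom ▷ (evalC j).obj K ≫ (evalμ j (𝟙_ _) K).hom ≫ (evalC j).map (λ_ K).hom := by
  -- The inverse of the unitor has an explicit formula, the inclusion of the summand with the unit
  -- in degree `0`; so the identity is checked for inverses.
  have h : (λ_ ((evalC j).obj K)).inv ≫ (evalUnit j).hom ▷ (evalC j).obj K ≫
      (evalμ j (𝟙_ _) K).hom = (evalC j).map (λ_ K).inv := by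
    ext n
    have e1 := leftUnitor_inv_f ((evalC j).obj K) n
    have e2 := NatTrans.congr_app (leftUnitor_inv_f K n) j
    have e3 := ι_whiskerRight_f (evalUnit j).hom ((evalC j).obj K) 0 n n (zero_add n)
    have e4 := ι_evalμ_f j (𝟙_ _) K 0 n n (zero_add n)
    have e5 := (comp_whiskerRight _ _ _).symm.trans
      (congrArg (· ▷ ((evalC j).obj K).X n) (evalUnit_hom_f (C := C) j))
    simp only [comp_f]
    rw [e1, Category.assoc, Category.assoc]
    erw [reassoc_of% e3, e4, reassoc_of% e5]
    exact e2.symm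
  rw [← cancel_epi (λ_ ((evalC j).obj K)).inv, Iso.inv_hom_id, reassoc_of% h, ← Functor.map_comp,
    Iso.inv_hom_id, CategoryTheory.Functor.map_id]

lemma evalμ_right_unitality (j : J) (K : CochainComplex (J ⥤ C) ℤ) :
    (ρ_ ((evalC j).obj K)).hom =
      (evalC j).obj K ◁ (evalUnit j).hom ≫ (evalμ j K (𝟙_ _)).hom ≫ (evalC j).map (ρ_ K).hom := by
  have h : (ρ_ ((evalC j).obj K)).inv ≫ (evalC j).obj K ◁ (evalUnit j).hom ≫
      (evalμ j K (𝟙_ _)).hom = (evalC j).map (ρ_ K).inv := by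
    ext n
    have e1 := rightUnitor_inv_f ((evalC j).obj K) n
    have e2 := NatTrans.congr_app (rightUnitor_inv_f K n) j
    have e3 := ι_whiskerLeft_f ((evalC j).obj K) (evalUnit j).hom n 0 n (add_zero n)
    have e4 := ι_evalμ_f j K (𝟙_ _) n 0 n (add_zero n)
    have e5 := (MonoidalCategory.whiskerLeft_comp _ _ _).symm.trans
      (congrArg (((evalC j).obj K).X n ◁ ·) (evalUnit_hom_f (C := C) j))
    simp only [comp_f]
    rw [e1, Category.assoc, Category.assoc]
    erw [reassoc_of% e3, e4, reassoc_of% e5]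
    exact e2.symm
  rw [← cancel_epi (ρ_ ((evalC j).obj K)).inv, Iso.inv_hom_id, reassoc_of% h, ← Functor.map_comp,
    Iso.inv_hom_id, CategoryTheory.Functor.map_id]

lemma evalμ_naturality (j : J) {K K' L L' : CochainComplex (J ⥤ C) ℤ} (f : K ⟶ K') (g : L ⟶ L') :
    ((evalC j).map f ⊗ₘ (evalC j).map g) ≫ (evalμ j K' L').hom =
      (evalμ j K L).hom ≫ (evalC j).map (f ⊗ₘ g) :=
  evalTensor_naturality j f g

/-- The evaluation of complexes of diagrams is a monoidal functor. -/
instance evalCMonoidal (j : J) : (evalC (C := C) j).Monoidal :=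
  Functor.CoreMonoidal.toMonoidal
    { εIso := evalUnit j
      μIso := evalμ j
      μIso_hom_natural_left := fun f L => by
        have := evalμ_naturality j f (𝟙 L)
        rwa [CategoryTheory.Functor.map_id, MonoidalCategory.tensorHom_id, MonoidalCategory.tensorHom_id] at this
      μIso_hom_natural_right := fun K g => by
        have := evalμ_naturality j (𝟙 K) g
        rwa [CategoryTheory.Functor.map_id, MonoidalCategory.id_tensorHom, MonoidalCategory.id_tensorHom] at this
      associativity := evalμ_associativity j
      left_unitality := evalμ_left_unitality j
      right_unitality := evalμ_right_unitality j }

end EvalMonoidal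

end BoundedDerived

/-! ### Detecting compatibility with shifts -/

namespace CategoryTheory.NatTrans.CommShift

variable {C D E : Type*} [Category* C] [Category* D] [Category* E]
  {A : Type*} [AddMonoid A] [HasShift C A] [HasShift D A] [HasShift E A]

/-- Faithfulness of `H` reflects the required equation. This serves to pass from the homotopy
category to its full subcategory of bounded complexes. -/
lemma of_whiskerRight {F G : C ⥤ D} (τ : F ⟶ G) (H : D ⥤ E) [F.CommShift A] [G.CommShift A]
    [H.CommShift A] [H.Faithful] (h : NatTrans.CommShift (Functor.whiskerRight τ H) A) :
    NatTrans.CommShift τ A where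
  shift_comm a := by
    ext X
    apply H.map_injective
    have := NatTrans.shift_app_comm (Functor.whiskerRight τ H) a X
    simp only [Functor.commShiftIso_comp_hom_app, Functor.whiskerRight_app, Category.assoc,
      Functor.comp_obj] at this
    simpa [Functor.commShiftIso_hom_naturality, ← cancel_mono ((H.commShiftIso a).hom.app (G.obj X))] using this

/-- The equation holds at the objects `L.obj X`, and naturality carries it to all objects isomorphic
to these. It serves for `L` the passage from complexes to the homotopy category, and for `L` the
localization functor. -/
lemma of_whiskerLeft {F G : D ⥤ E} (τ : F ⟶ G) (L : C ⥤ D) [F.CommShift A] [G.CommShift A]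
    [L.CommShift A] [L.EssSurj] (h : NatTrans.CommShift (Functor.whiskerLeft L τ) A) :
    NatTrans.CommShift τ A where
  shift_comm a := by
    have key (X : C) : (F.commShiftIso a).hom.app (L.obj X) ≫ (τ.app (L.obj X))⟦a⟧' =
        τ.app ((L.obj X)⟦a⟧) ≫ (G.commShiftIso a).hom.app (L.obj X) := by
      have := NatTrans.shift_app_comm (Functor.whiskerLeft L τ) a X
      simp only [Functor.commShiftIso_comp_hom_app, Functor.whiskerLeft_app, Category.assoc,
        Functor.comp_obj] at this
      rw [← NatTrans.naturality_assoc] at this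
      exact (cancel_epi _).1 this
    ext Y
    let e := L.objObjPreimageIso Y
    dsimp
    rw [← cancel_epi (F.map (e.hom⟦a⟧')), Functor.commShiftIso_hom_naturality_assoc,
      ← Functor.map_comp, NatTrans.naturality, Functor.map_comp, reassoc_of% (key _),
      NatTrans.naturality_assoc, Functor.commShiftIso_hom_naturality]

end CategoryTheory.NatTrans.CommShift

namespace BoundedDerived

open HomologicalComplex

/-! ### Functors induced on bounded homotopy categories -/

section MapKb

variable {A : Type*} [Category* A] [Abelian A] {B : Type*} [Category* B] [Abelian B]

/-- Shifts and induced functors both act termwise, so the commutation isomorphisms are identities in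
every degree. -/
instance mapHomologicalComplex_commShift {F G : A ⥤ B} [F.Additive] [G.Additive] (α : F ⟶ G) :
    NatTrans.CommShift (NatTrans.mapHomologicalComplex α (.up ℤ)) ℤ where
  shift_comm n := by
    ext K i
    exact (Category.id_comp _).trans (Category.comp_id _).symm

instance mapHomotopyCategory_commShift {F G : A ⥤ B} [F.Additive] [G.Additive] (α : F ⟶ G) :
    NatTrans.CommShift (NatTrans.mapHomotopyCategory α (.up ℤ)) ℤ := by
  -- On complexes the transformation is a composite of transformations already known to commute with
  -- shifts.
  refine .of_whiskerLeft _ (HomotopyCategory.quotient A (.up ℤ)) ?_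
  have : Functor.whiskerLeft (HomotopyCategory.quotient A (.up ℤ))
      (NatTrans.mapHomotopyCategory α (.up ℤ)) =
      (F.mapHomotopyCategoryFactors (.up ℤ)).hom ≫
      Functor.whiskerRight (NatTrans.mapHomologicalComplex α (.up ℤ))
        (HomotopyCategory.quotient B (.up ℤ)) ≫
      (G.mapHomotopyCategoryFactors (.up ℤ)).inv := by
    ext K
    exact ((Category.id_comp _).trans (Category.comp_id _)).symm
  rw [this]
  infer_instance

end MapKb

section MapKb

variable {A : Type*} [Category* A] [Abelian A] [MonoidalCategory A] [TensorCocomplete A]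
  {B : Type*} [Category* B] [Abelian B] [MonoidalCategory B] [TensorCocomplete B]
  (P : ObjectProperty A) [P.IsClosedUnderFiniteProducts] [P.IsClosedUnderIsomorphisms]
  (P' : ObjectProperty B) [P'.IsClosedUnderFiniteProducts] [P'.IsClosedUnderIsomorphisms]

lemma bounded_map (Φ : A ⥤ B) [Φ.Additive] (hΦ : ∀ X, P X → P' (Φ.obj X))
    {K : CochainComplex A ℤ} (hK : bounded P K) :
    bounded P' ((Φ.mapHomologicalComplex (.up ℤ)).obj K) := by
  obtain ⟨⟨a, b, hab⟩, hK⟩ := hK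
  exact ⟨⟨a, b, fun n hn => Φ.map_isZero (hab n hn)⟩, fun n => hΦ _ (hK n)⟩

/-- The functor on bounded complexes induced by an additive functor. -/
def mapCb (Φ : A ⥤ B) [Φ.Additive] (hΦ : ∀ X, P X → P' (Φ.obj X)) : Cb P ⥤ Cb P' :=
  (bounded P').lift ((bounded P).ι ⋙ Φ.mapHomologicalComplex (.up ℤ))
    (fun K => bounded_map P P' Φ hΦ K.property)

lemma boundedH_map (Φ : A ⥤ B) [Φ.Additive] (hΦ : ∀ X, P X → P' (Φ.obj X)) (K : Kb P) :
    boundedH P' (((boundedH P).ι ⋙ Φ.mapHomotopyCategory (.up ℤ)).obj K) :=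
  bounded_map P P' Φ hΦ K.property

/-- The functor on bounded homotopy categories induced by an additive functor. -/
abbrev mapKb (Φ : A ⥤ B) [Φ.Additive] (hΦ : ∀ X, P X → P' (Φ.obj X)) : Kb P ⥤ Kb P' :=
  (boundedH P').lift ((boundedH P).ι ⋙ Φ.mapHomotopyCategory (.up ℤ))
    (boundedH_map P P' Φ hΦ)

variable (Φ Ψ : A ⥤ B) [Φ.Additive] [Ψ.Additive] (hΦ : ∀ X, P X → P' (Φ.obj X))
  (hΨ : ∀ X, P X → P' (Ψ.obj X))

/-- The functor induced on bounded homotopy categories is compatible with the functor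
induced on bounded complexes. -/
def quotientMapKb : quotientKb P ⋙ mapKb P P' Φ hΦ ≅ mapCb P P' Φ hΦ ⋙ quotientKb P' :=
  NatIso.ofComponents (fun K => Iso.refl _) (fun f => by
    exact (Category.comp_id _).trans (Category.id_comp _).symm)

variable {Φ Ψ} in
/-- The natural transformation on bounded homotopy categories. -/
def mapKbNat (α : Φ ⟶ Ψ) : mapKb P P' Φ hΦ ⟶ mapKb P P' Ψ hΨ where
  app K := ObjectProperty.homMk ((NatTrans.mapHomotopyCategory α (.up ℤ)).app K.obj)
  naturality K L f := by
    ext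
    exact (NatTrans.mapHomotopyCategory α (.up ℤ)).naturality f.hom

instance (α : Φ ⟶ Ψ) : NatTrans.CommShift (mapKbNat P P' hΦ hΨ α) ℤ := by
  refine .of_whiskerRight _ (boundedH P').ι ?_
  have : Functor.whiskerRight (mapKbNat P P' hΦ hΨ α) (boundedH P').ι =
      ((boundedH P').liftCompιIso _ _).hom ≫
      Functor.whiskerLeft (boundedH P).ι (NatTrans.mapHomotopyCategory α (.up ℤ)) ≫
      ((boundedH P').liftCompιIso _ _).inv := by
    ext K
    exact ((Category.id_comp _).trans (Category.comp_id _)).symm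
  rw [this]
  infer_instance

variable (k : Type*) [CommRing k] [Linear k A] [Linear k B] 

lemma quotientKb_map_smul {K L : Cb P} (f : K ⟶ L) (c : k) :
    (quotientKb P).map (c • f) = c • (quotientKb P).map f := by
  ext
  exact (HomotopyCategory.quotient A (.up ℤ)).map_smul c f.hom

lemma quotientKb_map_add {K L : Cb P} (f g : K ⟶ L) :
    (quotientKb P).map (f + g) = (quotientKb P).map f + (quotientKb P).map g := by
  ext
  exact (HomotopyCategory.quotient A (.up ℤ)).map_add

instance : (quotientKb P).Additive where
  map_add := quotientKb_map_add P _ _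

instance : (quotientKb P).Linear k where
  map_smul f c := quotientKb_map_smul P k f c

instance [Φ.Linear k] : (mapKb P P' Φ hΦ).Linear k where
  map_smul {K L} f c := by
    obtain ⟨K, rfl⟩ := quotientKb_obj_surjective P K
    obtain ⟨L, rfl⟩ := quotientKb_obj_surjective P L
    obtain ⟨f, rfl⟩ := (quotientKb P).map_surjective f
    have h : (mapCb P P' Φ hΦ).map (c • f) = c • (mapCb P P' Φ hΦ).map f := by
      ext n
      exact Φ.map_smul _ _
    rw [← Functor.map_smul]
    exact (congrArg (quotientKb P').map h).trans (quotientKb_map_smul P' k _ c)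

end MapKb

/-! ### Extending functors to the bounded derived category -/

section QDb

variable {A : Type u} [Category.{v} A] [Abelian A] [MonoidalCategory A] [TensorCocomplete A]
  (P : ObjectProperty A) [P.IsClosedUnderFiniteProducts] [P.IsClosedUnderIsomorphisms]
  [P.IsMonoidal] [(qis P).IsMonoidal]

/-- The localization functor from the bounded homotopy category to the bounded derived
category. -/
def QDb : Kb P ⥤ Db P := (acyclic P).trW.Q

instance : (QDb P).IsLocalization (acyclic P).trW :=
  inferInstanceAs ((acyclic P).trW.Q.IsLocalization (acyclic P).trW)

instance : (QDb P).CommShift ℤ :=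
  inferInstanceAs ((acyclic P).trW.Q.CommShift ℤ)

instance : (QDb P).IsTriangulated :=
  inferInstanceAs ((acyclic P).trW.Q.IsTriangulated)

instance (k : Type w) [CommRing k] [Linear k A] : (QDb P).Linear k :=
  inferInstanceAs ((acyclic P).trW.Q.Linear k)

instance : (QDb P).EssSurj := Localization.essSurj (QDb P) (acyclic P).trW

instance : (QDb P).mapArrow.EssSurj := Localization.essSurj_mapArrow (QDb P) (acyclic P).trW

section Lift

variable {S : Type*} [Category* S] [Preadditive S] [HasZeroObject S] [HasShift S ℤ]
  [∀ n : ℤ, (shiftFunctor S n).Additive] [Pretriangulated S]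
  (F : Kb P ⥤ S) [F.CommShift ℤ] [F.IsTriangulated]
  (hF : ∀ K, acyclic P K → IsZero (F.obj K))

include hF in
-- A morphism of this class has an acyclic cone; its image has a zero cone, hence is invertible.
lemma trW_isInvertedBy : (acyclic P).trW.IsInvertedBy F := by
  intro K L f hf
  rw [ObjectProperty.trW_iff] at hf
  obtain ⟨M, g, h, mem, hM⟩ := hf
  exact (Pretriangulated.Triangle.isZero₃_iff_isIso₁ _ (F.map_distinguished _ mem)).1 (hF M hM)

/-- A triangulated functor which vanishes on acyclic complexes extends to the derived
category. -/
def liftDb : Db P ⥤ S := Localization.lift F (trW_isInvertedBy P F hF) (QDb P)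

instance : Localization.Lifting (QDb P) (acyclic P).trW F (liftDb P F hF) :=
  inferInstanceAs (Localization.Lifting (QDb P) (acyclic P).trW F
    (Localization.lift F (trW_isInvertedBy P F hF) (QDb P)))

/-- The compatibility of `liftDb` with the localization functor. -/
def liftDbIso : QDb P ⋙ liftDb P F hF ≅ F :=
  Localization.Lifting.iso (QDb P) (acyclic P).trW F (liftDb P F hF)

instance : (liftDb P F hF).CommShift ℤ :=
  Functor.commShiftOfLocalization (QDb P) (acyclic P).trW ℤ F (liftDb P F hF)

instance : NatTrans.CommShift (liftDbIso P F hF).hom ℤ :=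
  NatTrans.commShift_iso_hom_of_localization (QDb P) (acyclic P).trW ℤ F (liftDb P F hF)

instance : (liftDb P F hF).IsTriangulated :=
  Functor.isTriangulated_of_precomp_iso (liftDbIso P F hF)

instance (k : Type w) [CommRing k] [Linear k A] [Linear k S] [F.Linear k] :
    (liftDb P F hF).Linear k :=
  (Localization.functor_linear_iff (QDb P) (acyclic P).trW k F (liftDb P F hF)).1 inferInstance

end Lift

end QDb

end BoundedDerived

namespace BoundedDerived

open HomologicalComplex

section

variable {A : Type u} [Category.{v} A] [Abelian A] [MonoidalCategory A] [TensorCocomplete A]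
  (P : ObjectProperty A) [P.IsClosedUnderFiniteProducts] [P.IsClosedUnderIsomorphisms]
  [P.IsMonoidal] [(qis P).IsMonoidal]

open Pretriangulated ZeroObject in
-- The morphism `0 ⟶ K` has cone `K`, so it becomes invertible when `K` is acyclic.
lemma isZero_QDb_obj {K : Kb P} (hK : acyclic P K) : IsZero ((QDb P).obj K) := by
  have h : (acyclic P).trW (0 : (0 : Kb P) ⟶ K) := by
    rw [ObjectProperty.trW_iff]
    exact ⟨K, 𝟙 K, 0, contractible_distinguished₁ K, hK⟩
  have := Localization.inverts (QDb P) (acyclic P).trW _ h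
  exact ((QDb P).map_isZero (isZero_zero _)).of_iso (asIso ((QDb P).map (0 : (0 : Kb P) ⟶ K))).symm

lemma acyclic_quotientKb_obj_iff (K : Cb P) :
    acyclic P ((quotientKb P).obj K) ↔ ∀ n, K.obj.ExactAt n :=
  HomotopyCategory.quotient_obj_mem_subcategoryAcyclic_iff_exactAt _

end

/-! ### Evaluation at an object as a tensor functor on derived categories -/

section Eval

variable {J : Type u} [Category.{v} J] {C : Type*} [Category* C] [Abelian C]
  [MonoidalCategory C] [TensorCocomplete C] [∀ X : C, Injective X]
  (P : ObjectProperty (J ⥤ C)) [P.IsClosedUnderFiniteProducts]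
  [P.IsClosedUnderIsomorphisms] [P.IsMonoidal]
  (P' : ObjectProperty C) [P'.IsClosedUnderFiniteProducts]
  [P'.IsClosedUnderIsomorphisms] [P'.IsMonoidal]
  (j : J) (hP : ∀ M, P M → P' (((evaluation J C).obj j).obj M))

/-- The evaluation functor on bounded complexes is monoidal. -/
instance mapCbEvalMonoidal : (mapCb P P' ((evaluation J C).obj j) hP).Monoidal :=
  Functor.CoreMonoidal.toMonoidal
    { εIso := (bounded P').fullyFaithfulι.preimageIso (Functor.Monoidal.εIso (evalC (C := C) j))
      μIso := fun K L => (bounded P').fullyFaithfulι.preimageIso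
        (Functor.Monoidal.μIso (evalC (C := C) j) K.obj L.obj)
      μIso_hom_natural_left := fun f L => by
        ext1
        exact Functor.LaxMonoidal.μ_natural_left (evalC (C := C) j) f.hom L.obj
      μIso_hom_natural_right := fun K g => by
        ext1
        exact Functor.LaxMonoidal.μ_natural_right (evalC (C := C) j) K.obj g.hom
      associativity := fun K L M => by
        ext1
        exact Functor.LaxMonoidal.associativity (evalC (C := C) j) K.obj L.obj M.obj
      left_unitality := fun K => by
        ext1
        exact Functor.LaxMonoidal.left_unitality (evalC (C := C) j) K.obj
      right_unitality := fun K => by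
        ext1
        exact Functor.LaxMonoidal.right_unitality (evalC (C := C) j) K.obj }

/-- The evaluation functor from the bounded homotopy category of diagrams to the derived
category. -/
abbrev evalKb : Kb P ⥤ Db P' := mapKb P P' ((evaluation J C).obj j) hP ⋙ QDb P'

/-- Evaluation is exact, so it preserves acyclic complexes, and these vanish in the derived
category. -/
lemma isZero_evalKb (K : Kb P) (hK : acyclic P K) : IsZero ((evalKb P P' j hP).obj K) := by
  obtain ⟨K, rfl⟩ := quotientKb_obj_surjective P K
  refine isZero_QDb_obj P' ((acyclic_quotientKb_obj_iff P' ((mapCb P P' _ hP).obj K)).2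
    (fun n => ?_))
  exact ((acyclic_quotientKb_obj_iff P K).1 hK n).map ((evaluation J C).obj j)

/-- The evaluation functor on bounded derived categories of diagrams. -/
abbrev evalDb : Db P ⥤ Db P' := liftDb P (evalKb P P' j hP) (isZero_evalKb P P' j hP)

/-- The compatibility of evaluation on complexes and on derived categories. -/
def locDbEvalDb : locDb P ⋙ evalDb P P' j hP ≅
    mapCb P P' ((evaluation J C).obj j) hP ⋙ locDb P' :=
  Functor.isoWhiskerLeft (quotientKb P) (liftDbIso P _ _) ≪≫
    Functor.isoWhiskerRight (quotientMapKb P P' ((evaluation J C).obj j) hP) (QDb P')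

/-- The evaluation functor on bounded derived categories is monoidal. -/
instance evalDbMonoidal : (evalDb P P' j hP).Monoidal :=
  letI : Localization.Lifting (locDb P) (qis P)
    (mapCb P P' ((evaluation J C).obj j) hP ⋙ locDb P') (evalDb P P' j hP) :=
    ⟨locDbEvalDb P P' j hP⟩
  -- `locDb` is a monoidal localization, so it is enough that the composite with `locDb` is
  -- monoidal, and this composite is isomorphic to the evaluation of complexes followed by
  -- localization.
  Localization.Monoidal.functorMonoidalOfComp (locDb P) (qis P) (evalDb P P' j hP)
    (mapCb P P' ((evaluation J C).obj j) hP ⋙ locDb P')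

end Eval

end BoundedDerived

namespace BoundedDerived

variable {k : Type u} [Field k] {V : Type v} [Quiver.{w} V] (R : Relations k V) [IsTensor R]

instance (i : Paths V) : ((evaluation (Paths V) (ModuleCat.{u} k)).obj i).Linear k where
  map_smul _ _ := rfl

/-- Evaluation at a vertex as a tensor functor. -/
def evalTensorFunctor (i : Paths V) : TensorTriangulated.TensorFunctor k (DRep R) (DVect k) where
  functor := evalDb (isRep R) (ModuleCat.isFG k) i (fun _ h => h.1 i)
  commShift := inferInstance
  isTriangulated := inferInstance
  linear := inferInstance
  monoidal := ⟨inferInstance⟩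

end BoundedDerived

/-! ### Categories generated by the shifts of one object -/

namespace CategoryTheory

section ShiftGenerated

variable (k : Type*) [Field k] {D : Type*} [Category* D] [Preadditive D] [HasShift D ℤ]
  [∀ n : ℤ, (shiftFunctor D n).Additive] [Linear k D]
  {S : Type*} [Category* S] [Preadditive S] [HasShift S ℤ]
  [∀ n : ℤ, (shiftFunctor S n).Additive] [Linear k S]

/-- Every object is a direct summand of a finite direct sum of shifts of `U`. -/
def ShiftGenerates (U : D) : Prop :=
  ∀ X : D, ∃ (ι : Type) (_ : Fintype ι) (n : ι → ℤ) (a : ∀ t, U⟦n t⟧ ⟶ X) (b : ∀ t, X ⟶ U⟦n t⟧),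
    ∑ t, b t ≫ a t = 𝟙 X

/-- The graded endomorphism ring of `U` is the ground field. -/
structure ShiftExceptional (U : D) : Prop where
  eq_zero {n m : ℤ} (h : n ≠ m) (f : U⟦n⟧ ⟶ U⟦m⟧) : f = 0
  eq_smul {n : ℤ} (f : U⟦n⟧ ⟶ U⟦n⟧) : ∃ c : k, f = c • 𝟙 _

variable {U : D} {k}

/-- A natural transformation between additive functors is determined by its values on the shifts
of a generator. -/
lemma ShiftGenerates.natTrans_app_eq (hU : ShiftGenerates U) {F G : D ⥤ S} [G.Additive]
    {τ τ' : F ⟶ G} (h : ∀ n : ℤ, τ.app (U⟦n⟧) = τ'.app (U⟦n⟧)) : τ = τ' := by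
  ext X
  obtain ⟨ι, _, n, a, b, hab⟩ := hU X
  rw [← Category.comp_id (τ.app X), ← Category.comp_id (τ'.app X), ← G.map_id, ← hab]
  simp only [Functor.map_sum, Preadditive.comp_sum, Functor.map_comp, ← NatTrans.naturality_assoc,
    ← NatTrans.naturality, h]

/-- Compatibility with shifts expresses the component at `U⟦n⟧` through the component at `U`. -/
lemma ShiftGenerates.natTrans_commShift_eq (hU : ShiftGenerates U) {F G : D ⥤ S} [G.Additive]
    [F.CommShift ℤ] [G.CommShift ℤ]
    {τ τ' : F ⟶ G} [NatTrans.CommShift τ ℤ] [NatTrans.CommShift τ' ℤ]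
    (h : τ.app U = τ'.app U) : τ = τ' :=
  hU.natTrans_app_eq (fun n => by rw [NatTrans.app_shift, NatTrans.app_shift, h])

variable (F G : D ⥤ S) [F.Additive] [G.Additive] [F.Linear k] [G.Linear k] [F.CommShift ℤ]
  [G.CommShift ℤ]

variable {F G} in
/-- The morphism induced on the shifts. -/
def shiftExt (θ : F.obj U ⟶ G.obj U) (n : ℤ) : F.obj (U⟦n⟧) ⟶ G.obj (U⟦n⟧) :=
  (F.commShiftIso n).hom.app U ≫ θ⟦n⟧' ≫ (G.commShiftIso n).inv.app U

variable {F G} in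
-- Morphisms between shifts of `U` are zero or scalars, and every family of maps is natural for
-- these since `F` and `G` are linear.
lemma ShiftExceptional.shiftExt_naturality (h : ShiftExceptional k U) (θ : F.obj U ⟶ G.obj U)
    {n m : ℤ} (f : U⟦n⟧ ⟶ U⟦m⟧) :
    F.map f ≫ shiftExt θ m = shiftExt θ n ≫ G.map f := by
  by_cases hnm : n = m
  · subst hnm
    obtain ⟨c, rfl⟩ := h.eq_smul f
    simp [Functor.map_smul]
  · rw [h.eq_zero hnm f]
    simp

variable {F G} in
/-- A morphism between the values at a generator extends to a natural transformation. -/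
lemma exists_natTrans_commShift (hU : ShiftGenerates U) (h : ShiftExceptional k U)
    (θ : F.obj U ⟶ G.obj U) :
    ∃ τ : F ⟶ G, NatTrans.CommShift τ ℤ ∧ τ.app U = θ := by
  -- Decompose each identity through shifts of `U`. The component at `X` is then forced: it is the
  -- sum over `t` of `F(b_t)`, the extension of `θ` to the shift, and `G(a_t)`.
  choose ι hι n a b hab using hU
  have nat {X Y : D} (f : X ⟶ Y) :
      F.map f ≫ (∑ t, F.map (b Y t) ≫ shiftExt θ (n Y t) ≫ G.map (a Y t)) =
      (∑ t, F.map (b X t) ≫ shiftExt θ (n X t) ≫ G.map (a X t)) ≫ G.map f := by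
    -- Inserting the decomposition of the identity of `X` as well turns one side of naturality into
    -- a double sum in which the sum over the decomposition of `Y` can be contracted.
    have h1 : F.map f ≫ (∑ t, F.map (b Y t) ≫ shiftExt θ (n Y t) ≫ G.map (a Y t)) =
        ∑ s, ∑ t, F.map (b X s) ≫ shiftExt θ (n X s) ≫ G.map (a X s ≫ f ≫ b Y t ≫ a Y t) := by
      have : F.map f = ∑ s, F.map (b X s ≫ a X s ≫ f) := by
        rw [← Functor.map_sum]
        simp only [← Category.assoc]
        rw [← Preadditive.sum_comp, hab, Category.id_comp]
      rw [this, Preadditive.sum_comp]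
      refine Finset.sum_congr rfl (fun s _ => ?_)
      rw [Preadditive.comp_sum]
      refine Finset.sum_congr rfl (fun t _ => ?_)
      have := h.shiftExt_naturality θ (a X s ≫ f ≫ b Y t)
      simp only [Functor.map_comp, Category.assoc] at this ⊢
      rw [reassoc_of% this]
    rw [h1, Preadditive.sum_comp]
    refine Finset.sum_congr rfl (fun s _ => ?_)
    rw [← Preadditive.comp_sum, ← Preadditive.comp_sum, ← Functor.map_sum,
      ← Preadditive.comp_sum, ← Preadditive.comp_sum, hab]
    simp
  let τ : F ⟶ G :=
    { app := fun X => ∑ t, F.map (b X t) ≫ shiftExt θ (n X t) ≫ G.map (a X t)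
      naturality := fun X Y f => nat f }
  have hτ (m : ℤ) : τ.app (U⟦m⟧) = shiftExt θ m := by
    have (t : ι (U⟦m⟧)) := h.shiftExt_naturality θ (b (U⟦m⟧) t)
    dsimp [τ]
    simp only [reassoc_of% this, ← Functor.map_comp]
    rw [← Preadditive.comp_sum, ← Functor.map_sum, hab]
    simp
  -- Compatibility with shifts is checked first at the shifts of `U`, where it follows from the
  -- description of the commutation isomorphism for `m + p` by those for `m` and `p`.
  have hs (m p : ℤ) : (F.commShiftIso p).hom.app (U⟦m⟧) ≫ (τ.app (U⟦m⟧))⟦p⟧' =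
      τ.app ((U⟦m⟧)⟦p⟧) ≫ (G.commShiftIso p).hom.app (U⟦m⟧) := by
    have e := τ.naturality ((shiftFunctorAdd D m p).hom.app U)
    rw [hτ (m + p)] at e
    dsimp at e
    rw [← cancel_epi (F.map ((shiftFunctorAdd D m p).hom.app U)), reassoc_of% e, hτ]
    simp only [shiftExt, F.commShiftIso_add, G.commShiftIso_add, Functor.CommShift.isoAdd_hom_app,
      Functor.CommShift.isoAdd_inv_app, Category.assoc, Functor.map_comp]
    have e2 : G.map ((shiftFunctorAdd D m p).inv.app U) ≫
        G.map ((shiftFunctorAdd D m p).hom.app U) = 𝟙 _ := by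
      rw [← G.map_comp, Iso.inv_hom_id_app, G.map_id]
    have e3 := (shiftFunctorAdd S m p).inv.naturality θ
    dsimp at e2 e3
    rw [← reassoc_of% e3, Iso.inv_hom_id_app_assoc, reassoc_of% e2]
    simp
  refine ⟨τ, ⟨fun p => ?_⟩, ?_⟩
  · ext X
    -- For general `X` the decomposition of its identity is shifted by `p`, which reduces the claim
    -- to `hs`.
    have h1 : 𝟙 (F.obj (X⟦p⟧)) = ∑ t, F.map ((b X t)⟦p⟧') ≫ F.map ((a X t)⟦p⟧') := by
      rw [← F.map_id, ← Functor.map_id, ← hab X]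
      simp [Functor.map_sum]
    dsimp
    rw [← cancel_epi (𝟙 (F.obj (X⟦p⟧))), h1, Preadditive.sum_comp, Preadditive.sum_comp]
    refine Finset.sum_congr rfl (fun t _ => ?_)
    have e1 := Functor.commShiftIso_hom_naturality F (a X t) p
    have e2 := Functor.commShiftIso_hom_naturality G (a X t) p
    simp only [Category.assoc]
    rw [reassoc_of% e1, ← Functor.map_comp, τ.naturality, Functor.map_comp,
      reassoc_of% (hs (n X t) p), ← e2]
    simp only [NatTrans.naturality_assoc]
  · have e := τ.naturality ((shiftFunctorZero D ℤ).hom.app U)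
    dsimp at e
    rw [hτ 0] at e
    rw [← cancel_epi (F.map ((shiftFunctorZero D ℤ).hom.app U)), e, shiftExt,
      F.commShiftIso_zero, G.commShiftIso_zero]
    simp

end ShiftGenerated

end CategoryTheory

/-! ### Bounded complexes of vector spaces -/

namespace BoundedDerived

open HomologicalComplex

section Semisimple

variable {C : Type*} [Category* C] [Abelian C] [MonoidalCategory C] [TensorCocomplete C]
  [∀ X : C, Injective X] (P : ObjectProperty C) [P.IsClosedUnderFiniteProducts]
  [P.IsClosedUnderIsomorphisms] [P.IsMonoidal]

/-- All objects of `C` are injective, so bounded complexes are K-injective and quasi-isomorphisms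
between them are homotopy equivalences. -/
lemma isIso_of_acyclic_trW {K L : Kb P} (f : K ⟶ L) (hf : (acyclic P).trW f) : IsIso f := by
  obtain ⟨K, rfl⟩ := quotientKb_obj_surjective P K
  obtain ⟨L, rfl⟩ := quotientKb_obj_surjective P L
  obtain ⟨f, rfl⟩ := (quotientKb P).map_surjective f
  exact Localization.inverts (quotientKb P)
    ((homotopyEquivalences C (.up ℤ)).inverseImage (bounded P).ι) f (homotopyEquiv_of_qis P f ((qis_iff P f).2 hf))

/-- The inverted morphisms are already isomorphisms, so the identity functor is a localization at
the same class; localizations are unique. -/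
instance : (QDb P).IsEquivalence := by
  have : (𝟭 (Kb P)).IsLocalization (acyclic P).trW :=
    Functor.IsLocalization.for_id (acyclic P).trW (fun _ _ f hf => isIso_of_acyclic_trW P f hf)
  exact Functor.isEquivalence_of_iso
    (Localization.compUniqFunctor (𝟭 (Kb P)) (QDb P) (acyclic P).trW)

end Semisimple

section VectorSpaces

variable (k : Type u) [Field k]

/-- A linear section of the map onto the range of `f` extends to all of `Y`. Applied to the
differentials, this supplies the homotopy which contracts a complex onto its cohomology. -/
lemma exists_generalized_inverse {X Y : ModuleCat.{u} k} (f : X ⟶ Y) :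
    ∃ s : Y ⟶ X, f ≫ s ≫ f = f := by
  obtain ⟨s, hs⟩ := (LinearMap.rangeRestrict f.hom).exists_rightInverse_of_surjective
    f.hom.range_rangeRestrict
  obtain ⟨t, ht⟩ := s.exists_extend
  refine ⟨ModuleCat.ofHom t, ?_⟩
  ext x
  have h1 : t (f.hom x) = s ⟨f.hom x, ⟨x, rfl⟩⟩ :=
    LinearMap.congr_fun ht ⟨f.hom x, ⟨x, rfl⟩⟩
  have h2 := congrArg Subtype.val (LinearMap.congr_fun hs ⟨f.hom x, ⟨x, rfl⟩⟩)
  change f.hom (t (f.hom x)) = f.hom x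
  rw [h1]
  exact h2

/-- Take a basis of the range of `f`: its coordinate functions give `α` and its vectors give `β`.
The `α t` vanish on the image of `d` because `f` does, and the `β t` are killed by `d'` because they
take values in the range of `f`. -/
lemma exists_sum_factor {X Y Z W : ModuleCat.{u} k} (f : X ⟶ Y) [Module.Finite k Y]
    (d : W ⟶ X) (d' : Y ⟶ Z) (h : d ≫ f = 0) (h' : f ≫ d' = 0) :
    ∃ (N : ℕ) (α : Fin N → (X ⟶ 𝟙_ (ModuleCat.{u} k))) (β : Fin N → (𝟙_ (ModuleCat.{u} k) ⟶ Y)),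
      (∀ t, d ≫ α t = 0) ∧ (∀ t, β t ≫ d' = 0) ∧ f = ∑ t, α t ≫ β t := by
  let b := Module.finBasis k (LinearMap.range f.hom)
  have hα (t) : ModuleCat.Hom.hom (d ≫ ModuleCat.ofHom (b.coord t ∘ₗ f.hom.rangeRestrict)) = 0 := by
    ext x
    have : f.hom.rangeRestrict (d.hom x) = 0 := Subtype.ext (ConcreteCategory.congr_hom h x)
    simp [this]
  refine ⟨_, fun t => ModuleCat.ofHom (b.coord t ∘ₗ f.hom.rangeRestrict),
    fun t => ModuleCat.ofHom (LinearMap.toSpanSingleton k _ (b t).1),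
    fun t => ModuleCat.hom_ext (hα t), fun t => ?_, ?_⟩
  · ext
    obtain ⟨x, hx⟩ := (b t).2
    have := ConcreteCategory.congr_hom h' x
    change d'.hom ((1 : k) • (b t).1) = 0
    rw [one_smul, ← hx]
    exact this
  · ext x
    rw [ModuleCat.hom_sum, LinearMap.sum_apply]
    have := congrArg Subtype.val (b.sum_repr (f.hom.rangeRestrict x))
    rw [AddSubmonoidClass.coe_finsetSum] at this
    exact this.symm

/-- The one-dimensional vector space, placed in degree `n`. -/
def singleCb (n : ℤ) : Cb (ModuleCat.isFG.{u} k) :=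
  ⟨(single _ (.up ℤ) n).obj (𝟙_ (ModuleCat.{u} k)), by
    refine ⟨⟨n, n, fun m hm => isZero_single_obj_X _ _ _ _ (by grind)⟩, fun m => ?_⟩
    by_cases h : m = n
    · exact (ModuleCat.isFG k).prop_of_iso (singleObjXIsoOfEq (.up ℤ) n _ m h).symm
        (ModuleCat.isFG k).prop_unit
    · exact prop_zero _ (isZero_single_obj_X (.up ℤ) n _ m h)⟩

/-- The ground field as an object of the bounded homotopy category of vector spaces. -/
abbrev unitKb : Kb (ModuleCat.isFG.{u} k) := (quotientKb _).obj (𝟙_ (Cb (ModuleCat.isFG.{u} k)))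

/-- The shifts of the ground field. -/
def unitKbShift (n : ℤ) : (quotientKb _).obj (singleCb k (-n)) ≅ (unitKb k)⟦n⟧ :=
  (quotientKb _).mapIso ((bounded (ModuleCat.isFG.{u} k)).fullyFaithfulι.preimageIso
    (X := singleCb k (-n)) (Y := (shiftCb _ n).obj (𝟙_ _))
    -- Shifting by `n` moves degree `0` to degree `-n`.
    (((CochainComplex.singleFunctors (ModuleCat.{u} k)).shiftIso n (-n) 0 (by lia)).symm.app
      (𝟙_ (ModuleCat.{u} k)))) ≪≫
    (quotientKbShift (ModuleCat.isFG.{u} k) n).app (𝟙_ _)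

lemma singleCb_hom_eq_zero {n m : ℤ} (h : n ≠ m) (f : singleCb k n ⟶ singleCb k m) : f = 0 := by
  ext1
  exact from_single_hom_ext ((isZero_single_obj_X _ _ _ _ h).eq_of_tgt _ _)

lemma unit_hom_eq_smul (f : 𝟙_ (ModuleCat.{u} k) ⟶ 𝟙_ (ModuleCat.{u} k)) :
    ∃ c : k, f = c • 𝟙 _ := by
  refine ⟨f.hom (1 : k), ?_⟩
  ext
  exact (mul_one _).symm

lemma singleCb_hom_eq_smul {n : ℤ} (f : singleCb k n ⟶ singleCb k n) : ∃ c : k, f = c • 𝟙 _ := by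
  obtain ⟨g, hg⟩ := (single (ModuleCat.{u} k) (.up ℤ) n).map_surjective f.hom
  obtain ⟨c, rfl⟩ := unit_hom_eq_smul k g
  refine ⟨c, ?_⟩
  ext1
  rw [← hg]
  exact from_single_hom_ext (by
    rw [single_map_f_self]
    simp
    rfl)

/-- Morphisms in the homotopy category lift to chain maps, and chain maps between copies of `k` in
single degrees are zero or scalars. -/
lemma shiftExceptional_unitKb : ShiftExceptional k (unitKb k) where
  eq_zero {n m} h f := by
    obtain ⟨g, hg⟩ := (quotientKb _).map_surjective
      ((unitKbShift k n).hom ≫ f ≫ (unitKbShift k m).inv)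
    rw [singleCb_hom_eq_zero k (by simpa using h) g, Functor.map_zero] at hg
    rw [← cancel_epi (unitKbShift k n).hom, ← cancel_mono (unitKbShift k m).inv, Category.assoc,
      ← hg]
    simp
  eq_smul {n} f := by
    obtain ⟨g, hg⟩ := (quotientKb _).map_surjective
      ((unitKbShift k n).hom ≫ f ≫ (unitKbShift k n).inv)
    obtain ⟨c, rfl⟩ := singleCb_hom_eq_smul k g
    refine ⟨c, ?_⟩
    rw [Functor.map_smul, CategoryTheory.Functor.map_id] at hg
    rw [← cancel_epi (unitKbShift k n).hom, ← cancel_mono (unitKbShift k n).inv, Category.assoc,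
      ← hg]
    simp

/-- With generalized inverses `s` of the differentials, the map `e = 1 - (ds + sd)` is homotopic to
the identity and composes to zero with the differential on both sides. Each `e.f n` has finite rank,
so it is a sum of maps of rank one, and these factor by chain maps through copies of `k` in degree
`n`. -/
lemma exists_sum_singleCb (K : Cb (ModuleCat.isFG.{u} k)) :
    ∃ (ι : Type) (_ : Fintype ι) (n : ι → ℤ) (b : ∀ t, K ⟶ singleCb k (n t))
      (a : ∀ t, singleCb k (n t) ⟶ K),
      Nonempty (Homotopy (∑ t, b t ≫ a t).hom (𝟙 K.obj)) := by
  obtain ⟨l, r, hlr⟩ := K.property.1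
  have hs (i j : ℤ) (_ : (ComplexShape.up ℤ).Rel j i) :
      ∃ s : K.obj.X i ⟶ K.obj.X j, K.obj.d j i ≫ s ≫ K.obj.d j i = K.obj.d j i :=
    exists_generalized_inverse k _
  choose s hs using hs
  let e : K.obj ⟶ K.obj := 𝟙 _ - Homotopy.nullHomotopicMap' s
  have he (n : ℤ) : e.f n = 𝟙 _ - (K.obj.d n (n + 1) ≫ s (n + 1) n rfl +
      s n (n - 1) (by simp) ≫ K.obj.d (n - 1) n) := by
    exact congrArg (𝟙 (K.obj.X n) - ·) (Homotopy.nullHomotopicMap'_f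
      (show (ComplexShape.up ℤ).Rel (n - 1) n by simp)
      (show (ComplexShape.up ℤ).Rel n (n + 1) from rfl) s)
  have hd (n m : ℤ) : e.f n ≫ K.obj.d n m = 0 := by
    by_cases h : n + 1 = m
    · subst h
      rw [he]
      have := hs (n + 1) n rfl
      simp [this]
    · rw [K.obj.shape _ _ h, comp_zero]
  have hd' (n m : ℤ) : K.obj.d n m ≫ e.f m = 0 := by rw [← e.comm, hd]
  have (n : ℤ) : Module.Finite k (K.obj.X n) := K.property.2 n
  have hf (n : ℤ) := exists_sum_factor k (e.f n) (K.obj.d (n - 1) n) (K.obj.d n (n + 1))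
    (hd' _ _) (hd _ _)
  choose N α β hα hβ hαβ using hf
  have hα' (n : ℤ) (t : Fin (N n)) (i : ℤ) (hi : (ComplexShape.up ℤ).Rel i n) :
      K.obj.d i n ≫ α n t = 0 := by
    obtain rfl : i = n - 1 := by simp at hi; lia
    exact hα _ _
  have hβ' (n : ℤ) (t : Fin (N n)) (i : ℤ) (hi : (ComplexShape.up ℤ).Rel n i) :
      β n t ≫ K.obj.d n i = 0 := by
    obtain rfl : n + 1 = i := hi
    exact hβ _ _
  let b (t : Σ n : Finset.Icc l r, Fin (N n)) : K ⟶ singleCb k t.1 :=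
    ObjectProperty.homMk (mkHomToSingle (α t.1 t.2) (hα' _ _))
  let a (t : Σ n : Finset.Icc l r, Fin (N n)) : singleCb k t.1 ⟶ K :=
    ObjectProperty.homMk (mkHomFromSingle (β t.1 t.2) (hβ' _ _))
  have hz (t : Σ n : Finset.Icc l r, Fin (N n)) (m : ℤ) (hm : m ≠ t.1) :
      (b t ≫ a t).hom.f m = 0 := by
    have : (a t).hom.f m = 0 := (isZero_single_obj_X _ _ _ _ hm).eq_of_src _ _
    exact (congrArg (_ ≫ ·) this).trans comp_zero
  have hself (n : Finset.Icc l r) (t : Fin (N n)) :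
      (b ⟨n, t⟩ ≫ a ⟨n, t⟩).hom.f n = α n t ≫ β n t := by
    change (mkHomToSingle (α n t) (hα' _ _)).f n.1 ≫
      (mkHomFromSingle (β n t) (hβ' _ _)).f n.1 = _
    rw [mkHomToSingle_f, mkHomFromSingle_f]
    simp
  have hsum : (∑ t, b t ≫ a t).hom = e := by
    ext m : 1
    have h1 : (∑ t, b t ≫ a t).hom.f m = ∑ t, (b t ≫ a t).hom.f m := by
      exact map_sum (((bounded _).ι ⋙ HomologicalComplex.eval _ _ m).mapAddHom) _ _
    rw [h1, Fintype.sum_sigma]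
    by_cases hm : m ∈ Finset.Icc l r
    · rw [Finset.sum_eq_single ⟨m, hm⟩, hαβ]
      · exact Finset.sum_congr rfl (fun t _ => hself ⟨m, hm⟩ t)
      · intro n _ hn
        exact Finset.sum_eq_zero (fun t _ => hz _ _ (fun h => hn (Subtype.ext h.symm)))
      · simp
    · have : IsZero (K.obj.X m) := hlr _ (by simp at hm; grind)
      exact this.eq_of_src _ _
  refine ⟨_, inferInstance, _, b, a, ⟨(Homotopy.ofEq hsum).trans ?_⟩⟩
  -- The difference of the identity and `e` is null-homotopic by construction.
  refine (Homotopy.equivSubZero.symm ?_).symm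
  exact (Homotopy.ofEq (by simp [e])).trans (Homotopy.nullHomotopy' s)

lemma shiftGenerates_unitKb : ShiftGenerates (unitKb k) := by
  intro X
  obtain ⟨K, rfl⟩ := quotientKb_obj_surjective _ X
  obtain ⟨ι, _, n, b, a, ⟨h⟩⟩ := exists_sum_singleCb k K
  have e (m : ℤ) : (quotientKb _).obj (singleCb k m) ≅ (unitKb k)⟦-m⟧ :=
    (quotientKb _).mapIso (eqToIso (by simp)) ≪≫ unitKbShift k (-m)
  refine ⟨ι, inferInstance, fun t => -(n t), fun t => (e (n t)).inv ≫ (quotientKb _).map (a t),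
    fun t => (quotientKb _).map (b t) ≫ (e (n t)).hom, ?_⟩
  simp only [Category.assoc, Iso.hom_inv_id_assoc, ← Functor.map_comp, ← Functor.map_sum]
  rw [← CategoryTheory.Functor.map_id]
  ext
  exact HomotopyCategory.eq_of_homotopy _ _ h

end VectorSpaces

end BoundedDerived

/-! ### Transport of generators, and retracts of non-zero objects -/

namespace CategoryTheory

section ShiftGenerated

variable {k : Type*} [Field k] {D : Type*} [Category* D] [Preadditive D] [HasShift D ℤ]
  [∀ n : ℤ, (shiftFunctor D n).Additive] [Linear k D] [∀ n : ℤ, (shiftFunctor D n).Linear k]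
  {S : Type*} [Category* S] [Preadditive S] [HasShift S ℤ]
  [∀ n : ℤ, (shiftFunctor S n).Additive] [Linear k S]

lemma ShiftGenerates.map {U : D} (hU : ShiftGenerates U) (F : D ⥤ S) [F.CommShift ℤ] [F.Additive]
    [F.EssSurj] {U' : S} (e : F.obj U ≅ U') : ShiftGenerates U' := by
  intro X
  obtain ⟨ι, _, n, a, b, hab⟩ := hU (F.objPreimage X)
  let E (n : ℤ) : F.obj (U⟦n⟧) ≅ U'⟦n⟧ :=
    (F.commShiftIso n).app U ≪≫ (shiftFunctor S n).mapIso e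
  let i := F.objObjPreimageIso X
  refine ⟨ι, inferInstance, n, fun t => (E _).inv ≫ F.map (a t) ≫ i.hom,
    fun t => i.inv ≫ F.map (b t) ≫ (E _).hom, ?_⟩
  simp only [Category.assoc, Iso.hom_inv_id_assoc]
  have h := congrArg (fun f => i.inv ≫ F.map f ≫ i.hom) hab
  simpa [Functor.map_sum, Preadditive.sum_comp, Preadditive.comp_sum] using h

lemma ShiftExceptional.map {U : D} (hU : ShiftExceptional k U) (F : D ⥤ S) [F.CommShift ℤ]
    [F.Additive] [F.Linear k]
    [F.Full] {U' : S} (e : F.obj U ≅ U') : ShiftExceptional k U' := by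
  let E (n : ℤ) : F.obj (U⟦n⟧) ≅ U'⟦n⟧ :=
    (F.commShiftIso n).app U ≪≫ (shiftFunctor S n).mapIso e
  constructor
  · intro n m h f
    obtain ⟨g, hg⟩ := F.map_surjective ((E n).hom ≫ f ≫ (E m).inv)
    rw [hU.eq_zero h g, F.map_zero] at hg
    rw [← cancel_epi (E n).hom, ← cancel_mono (E m).inv, Category.assoc, ← hg]
    simp
  · intro n f
    obtain ⟨g, hg⟩ := F.map_surjective ((E n).hom ≫ f ≫ (E n).inv)
    obtain ⟨c, rfl⟩ := hU.eq_smul g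
    refine ⟨c, ?_⟩
    rw [F.map_smul, F.map_id] at hg
    rw [← cancel_epi (E n).hom, ← cancel_mono (E n).inv, Category.assoc, ← hg]
    simp

/-- If all composites `a s ≫ b t` vanished, the identity of `X` would be zero. A non-zero composite
joins equal shifts of `U` and is there a non-zero scalar, so after rescaling it exhibits a shift of
`U` as a retract of `X`. -/
lemma ShiftExceptional.exists_retract {U : D} (h : ShiftExceptional k U) (hU : ShiftGenerates U)
    {X : D} (hX : ¬ IsZero X) : ∃ n : ℤ, Nonempty (Retract (U⟦n⟧) X) := by
  obtain ⟨ι, _, n, a, b, hab⟩ := hU X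
  have : ∃ s t, a s ≫ b t ≠ 0 := by
    by_contra! h0
    refine hX ((IsZero.iff_id_eq_zero X).2 ?_)
    rw [← Category.comp_id (𝟙 X), ← hab, Preadditive.comp_sum]
    refine Finset.sum_eq_zero (fun t _ => ?_)
    rw [Preadditive.sum_comp]
    refine Finset.sum_eq_zero (fun s _ => ?_)
    rw [Category.assoc, ← Category.assoc (a s), h0]
    simp
  obtain ⟨s, t, hst⟩ := this
  have hn : n s = n t := by
    by_contra hn
    exact hst (h.eq_zero hn _)
  let i := eqToIso (congrArg (fun m : ℤ => U⟦m⟧) hn)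
  obtain ⟨c, hc⟩ := h.eq_smul (a s ≫ b t ≫ i.inv)
  have hc0 : c ≠ 0 := by
    rintro rfl
    apply hst
    rw [← cancel_mono i.inv, Category.assoc, hc]
    simp
  refine ⟨n s, ⟨⟨a s, c⁻¹ • (b t ≫ i.inv), ?_⟩⟩⟩
  rw [Linear.comp_smul, hc, smul_smul, inv_mul_cancel₀ hc0, one_smul]

end ShiftGenerated

end CategoryTheory

/-! ### Vanishing of tensor products, and the unit of the derived category of vector spaces -/

namespace BoundedDerived

open HomologicalComplex ZeroObject

section Zero

variable {A : Type u} [Category.{v} A] [Abelian A] [MonoidalCategory A] [TensorCocomplete A]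

lemma isZero_tensor_complex {K L : CochainComplex A ℤ} (hK : IsZero K ∨ IsZero L) :
    IsZero (K ⊗ L) := by
  have h (n : ℤ) : IsZero ((K ⊗ L).X n) := by
    let X := ((GradedObject.mapBifunctor (curriedTensor A) ℤ ℤ).obj K.X).obj L.X
    refine isZero_cofan (X.isColimitCofanMapObj (fun p : ℤ × ℤ => p.1 + p.2) n) (fun j => ?_)
    rcases hK with hK | hK
    · exact (tensorRight (L.X j.1.2)).map_isZero ((HomologicalComplex.eval A _ _).map_isZero hK)
    · exact (tensorLeft (K.X j.1.1)).map_isZero ((HomologicalComplex.eval A _ _).map_isZero hK)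
  rw [IsZero.iff_id_eq_zero]
  ext n : 1
  exact (h n).eq_of_src _ _

variable (P : ObjectProperty A) [P.IsClosedUnderFiniteProducts] [P.IsClosedUnderIsomorphisms]
  [P.IsMonoidal] [(qis P).IsMonoidal]

lemma isZero_cb {K : Cb P} (hK : IsZero K.obj) : IsZero K := by
  rw [IsZero.iff_id_eq_zero]
  ext1
  exact hK.eq_of_src _ _

/-- A zero object among the bounded complexes. -/
def zeroCb : Cb P := ⟨0, ⟨0, 0, fun n _ => (HomologicalComplex.eval A (.up ℤ) n).map_isZero
  (isZero_zero _)⟩, fun n => prop_zero P ((HomologicalComplex.eval A (.up ℤ) n).map_isZero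
  (isZero_zero _))⟩

lemma isZero_locDb_obj {K : Cb P} (hK : IsZero K.obj) : IsZero ((locDb P).obj K) :=
  (QDb P).map_isZero ((quotientKb P).map_isZero (isZero_cb P hK))

/-- A zero object is represented by the zero complex, and the tensorator of `locDb` reduces the
claim to complexes. -/
lemma isZero_tensor {X Y : Db P} (h : IsZero X ∨ IsZero Y) : IsZero (X ⊗ Y) := by
  have : (locDb P).EssSurj := Localization.essSurj (locDb P) (qis P)
  have h0 : IsZero ((locDb P).obj (zeroCb P)) := isZero_locDb_obj P (isZero_zero _)
  let i := (locDb P).objObjPreimageIso X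
  let j := (locDb P).objObjPreimageIso Y
  rcases h with h | h
  · refine IsZero.of_iso ?_ (((h.iso h0) ⊗ᵢ j.symm) ≪≫ Functor.Monoidal.μIso (locDb P) _ _)
    exact isZero_locDb_obj P (isZero_tensor_complex (.inl (isZero_zero _)))
  · refine IsZero.of_iso ?_ ((i.symm ⊗ᵢ (h.iso h0)) ≪≫ Functor.Monoidal.μIso (locDb P) _ _)
    exact isZero_locDb_obj P (isZero_tensor_complex (.inr (isZero_zero _)))

end Zero

section DVect

variable (k : Type u) [Field k]

/-- The unit object of the derived category of vector spaces comes from the homotopy category. -/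
def QDbUnitKb : (QDb _).obj (unitKb k) ≅ 𝟙_ (DVect k) :=
  (Functor.Monoidal.εIso (locDb (ModuleCat.isFG.{u} k))).symm

lemma shiftGenerates_unit : ShiftGenerates (𝟙_ (DVect k)) :=
  (shiftGenerates_unitKb k).map (QDb _) (QDbUnitKb k)

lemma shiftExceptional_unit : ShiftExceptional k (𝟙_ (DVect k)) :=
  (shiftExceptional_unitKb k).map (QDb _) (QDbUnitKb k)

/-- `QDb` is faithful here, so a zero unit would be zero up to homotopy, hence acyclic; but its
cohomology in degree `0` is `k`. -/
lemma not_isZero_unit : ¬ IsZero (𝟙_ (DVect k)) := by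
  intro h
  have h1 := h.of_iso (QDbUnitKb k)
  have h2 : IsZero (unitKb k) := by
    rw [IsZero.iff_id_eq_zero]
    exact (QDb _).map_injective (h1.eq_of_src _ _)
  have h3 : acyclic _ (unitKb k) := (acyclic _).prop_of_iso (h2.isoZero).symm (acyclic _).prop_zero
  have h4 := (acyclic_quotientKb_obj_iff _ _).1 h3 0
  have h5 : IsZero (((single (ModuleCat.{u} k) (.up ℤ) 0).obj (𝟙_ _)).homology 0) :=
    (exactAt_iff_isZero_homology _ _).1 h4
  have h6 : IsZero (𝟙_ (ModuleCat.{u} k)) := h5.of_iso ((homologyFunctorSingleIso _ _ _).app _).symm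
  have := ModuleCat.subsingleton_of_isZero h6
  have h7 : (1 : k) = 0 := this.elim _ _
  exact one_ne_zero h7

variable {k}

/-- A non-zero `X` has a shift of the unit as a retract, so a shift of `Y` is a retract of `X ⊗ Y`.
This absence of zero divisors makes kernels of tensor functors prime. -/
lemma isZero_or_isZero_of_tensor {X Y : DVect k} (h : IsZero (X ⊗ Y)) : IsZero X ∨ IsZero Y := by
  by_contra! hXY
  obtain ⟨n, ⟨r⟩⟩ := (shiftExceptional_unit k).exists_retract (shiftGenerates_unit k) hXY.1
  obtain ⟨e⟩ := TensorTriangulated.TensorShift.nonempty_iso (𝟙_ (DVect k)) n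
  have h1 : IsZero ((𝟙_ (DVect k))⟦n⟧ ⊗ Y) := by
    have := (r.map (tensorRight Y))
    exact IsZero.of_mono this.i h
  have h2 : IsZero ((𝟙_ (DVect k) ⊗ Y)⟦n⟧) := h1.of_iso (e.app Y).symm
  have h3 : IsZero (𝟙_ (DVect k) ⊗ Y) := by
    rw [IsZero.iff_id_eq_zero]
    exact (shiftFunctor (DVect k) n).map_injective (h2.eq_of_src _ _)
  exact hXY.2 (h3.of_iso (λ_ Y).symm)

lemma unit_end_eq_smul (f : 𝟙_ (DVect k) ⟶ 𝟙_ (DVect k)) : ∃ c : k, f = c • 𝟙 _ := by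
  -- `ShiftExceptional` speaks about shifts, so `f` is replaced by its shift by `0`, which is
  -- faithful.
  obtain ⟨c, hc⟩ := (shiftExceptional_unit k).eq_smul (f⟦(0 : ℤ)⟧')
  refine ⟨c, (shiftFunctor (DVect k) (0 : ℤ)).map_injective ?_⟩
  rw [hc, Functor.map_smul, CategoryTheory.Functor.map_id]

end DVect

end BoundedDerived

/-! ### Distinguished triangles from short exact sequences of complexes -/

namespace BoundedDerived

open HomologicalComplex Pretriangulated

section ShortExact

variable {A : Type u} [Category.{v} A] [Abelian A] [MonoidalCategory A] [TensorCocomplete A]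
  (P : ObjectProperty A) [P.IsClosedUnderFiniteProducts] [P.IsClosedUnderIsomorphisms]
  [P.IsMonoidal] [(qis P).IsMonoidal]

/-- The mapping cone of `f` maps to `Z` by a quasi-isomorphism. A cone `M` taken in the bounded
homotopy category is isomorphic to the mapping cone, so `M` may be replaced by `Z` after
localization. -/
lemma exists_distinguished_of_shortExact {X Y Z : Cb P} (f : X ⟶ Y) (g : Y ⟶ Z)
    (w : f.hom ≫ g.hom = 0) (hS : (ShortComplex.mk f.hom g.hom w).ShortExact) :
    ∃ h, Triangle.mk ((locDb P).map f) ((locDb P).map g) h ∈ distTriang (Db P) := by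
  obtain ⟨M, a, b, mem⟩ := distinguished_cocone_triangle ((quotientKb P).map f)
  let e := isoTriangleOfIso₁₂ _ _ ((boundedH P).ι.map_distinguished _ mem)
    (HomotopyCategory.mappingCone_triangleh_distinguished f.hom) (Iso.refl _) (Iso.refl _)
    ((Category.comp_id _).trans (Category.id_comp _).symm)
  let e₃ : M.obj ⟶ (HomotopyCategory.quotient A (.up ℤ)).obj
    (CochainComplex.mappingCone f.hom) := e.hom.hom₃
  have he : a.hom ≫ e₃ =
      (HomotopyCategory.quotient A (.up ℤ)).map (CochainComplex.mappingCone.inr f.hom) := by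
    have := e.hom.comm₂
    exact this.trans (Category.id_comp _)
  have hq := CochainComplex.mappingCone.quasiIso_descShortComplex hS
  let d := CochainComplex.mappingCone.descShortComplex (ShortComplex.mk f.hom g.hom w)
  let φ : M ⟶ (quotientKb P).obj Z := ObjectProperty.homMk
    (e₃ ≫ (HomotopyCategory.quotient A (.up ℤ)).map d)
  have hφ : a ≫ φ = (quotientKb P).map g := by
    ext
    refine (Category.assoc a.hom e₃ _).symm.trans ((congrArg (· ≫ _) he).trans ?_)
    refine ((HomotopyCategory.quotient A (.up ℤ)).map_comp _ _).symm.trans ?_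
    exact congrArg _ (CochainComplex.mappingCone.inr_descShortComplex
      (ShortComplex.mk f.hom g.hom w))
  have : IsIso e₃ := inferInstanceAs (IsIso e.hom.hom₃)
  have hφ' : IsIso ((QDb P).map φ) := by
    have h1 : HomotopyCategory.quasiIso A (.up ℤ) φ.hom := by
      refine (HomotopyCategory.quasiIso A (.up ℤ)).comp_mem _ _
        (MorphismProperty.of_isIso _ _) ?_
      exact (HomotopyCategory.quotient_map_mem_quasiIso_iff d).2 hq
    clear_value φ
    clear hφ
    -- Lifting to a chain map between bounded complexes makes the criterion `qis_iff` available.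
    obtain ⟨L, rfl⟩ := quotientKb_obj_surjective P M
    obtain ⟨ψ, rfl⟩ := (quotientKb P).map_surjective φ
    exact Localization.inverts (QDb P) (acyclic P).trW _ ((qis_iff P ψ).1
      ((HomotopyCategory.quotient_map_mem_quasiIso_iff ψ.hom).1 h1))
  have hT := (QDb P).map_distinguished _ mem
  let ψ := @asIso _ _ _ _ _ hφ'
  refine ⟨ψ.inv ≫ ((QDb P).mapTriangle.obj (Triangle.mk ((quotientKb P).map f) a b)).mor₃,
    isomorphic_distinguished _ hT _ (Triangle.isoMk _ _ (Iso.refl _) (Iso.refl _)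
    ψ.symm ?_ ?_ ?_)⟩
  · exact (Category.comp_id _).trans (Category.id_comp _).symm
  · refine Eq.trans ?_ (Category.id_comp _).symm
    change (QDb P).map ((quotientKb P).map g) ≫ ψ.inv = (QDb P).map a
    rw [Iso.comp_inv_eq, ← hφ, Functor.map_comp]
    rfl
  · refine Eq.trans ?_ (Category.comp_id _)
    exact congrArg _ (CategoryTheory.Functor.map_id _ _)

end ShortExact

end BoundedDerived

namespace CategoryTheory

lemma ShortComplex.exact_of_evaluation {J : Type*} [Category* J] {C : Type*} [Category* C]
    [Abelian C] (S : ShortComplex (J ⥤ C)) (h : ∀ j, (S.map ((evaluation J C).obj j)).Exact) :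
    S.Exact := by
  rw [ShortComplex.exact_iff_isZero_homology]
  refine Functor.isZero _ (fun j => ?_)
  exact (((ShortComplex.exact_iff_isZero_homology _).1 (h j)).of_iso
    (S.mapHomologyIso ((evaluation J C).obj j)).symm)

lemma ShortComplex.shortExact_of_evaluation {J : Type*} [Category* J] {C : Type*} [Category* C]
    [Abelian C] (S : ShortComplex (J ⥤ C))
    (h : ∀ j, (S.map ((evaluation J C).obj j)).ShortExact) : S.ShortExact where
  exact := S.exact_of_evaluation (fun j => (h j).exact)
  mono_f := by
    have (j : J) : Mono (S.f.app j) := (h j).mono_f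
    exact NatTrans.mono_of_mono_app _
  epi_g := by
    have (j : J) : Epi (S.g.app j) := (h j).epi_g
    exact NatTrans.epi_of_epi_app _

end CategoryTheory

/-! ### Truncation of representations to convex sets of vertices -/

namespace BoundedDerived

open HomologicalComplex Pretriangulated

variable {k : Type u} [Field k] {V : Type v} [Quiver.{w} V]

/-- A set of vertices which contains all the vertices on the paths between its members. -/
def PathConvex (C : Set (Paths V)) : Prop :=
  ∀ ⦃x y z : Paths V⦄ (_ : x ⟶ y) (_ : y ⟶ z), x ∈ C → z ∈ C → y ∈ C

/-- The whole module at the vertices of `C`, and zero elsewhere. -/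
def truncSub (C : Set (Paths V)) (x : Paths V) (M : ModuleCat.{u} k) : Submodule k M where
  carrier := {m | x ∉ C → m = 0}
  add_mem' hm hn hx := by rw [hm hx, hn hx, add_zero]
  zero_mem' _ := rfl
  smul_mem' c m hm hx := by rw [hm hx, smul_zero]

open Classical in
/-- Restriction of a linear map to the vertices of `C`. -/
def truncMap (C D : Set (Paths V)) (x y : Paths V) {M N : ModuleCat.{u} k} (f : M ⟶ N) :
    ModuleCat.of k (truncSub C x M) ⟶ ModuleCat.of k (truncSub D y N) :=
  ModuleCat.ofHom (LinearMap.codRestrict _ ((if y ∈ D then f.hom else 0) ∘ₗ Submodule.subtype _)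
    (fun m hy => by simp [hy]))

open Classical in
lemma truncMap_val (C D : Set (Paths V)) (x y : Paths V) {M N : ModuleCat.{u} k} (f : M ⟶ N)
    (m : truncSub C x M) : ((truncMap C D x y f).hom m).1 = if y ∈ D then f.hom m.1 else 0 := by
  change (if y ∈ D then f.hom else 0) m.1 = _
  split_ifs <;> rfl

/-- The composite is cut to zero if `y ∉ D`. The hypothesis allows this only if `x ∉ C` or `z ∉ E`,
and then the other side is zero too. For a single set this condition along paths is convexity. -/
lemma truncMap_comp (C D E : Set (Paths V)) (x y z : Paths V) {M N L : ModuleCat.{u} k}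
    (f : M ⟶ N) (g : N ⟶ L) (h : x ∈ C → z ∈ E → y ∈ D) :
    truncMap C D x y f ≫ truncMap D E y z g = truncMap C E x z (f ≫ g) := by
  ext m
  refine (truncMap_val D E y z g _).trans ?_
  refine Eq.trans ?_ (truncMap_val C E x z (f ≫ g) _).symm
  split_ifs with hz
  · have h1 := truncMap_val C D x y f m
    refine (congrArg g.hom h1).trans ?_
    split_ifs with hy
    · rfl
    · by_cases hx : x ∈ C
      · exact absurd (h hx hz) hy
      · have := m.2 hx
        change _ = g.hom (f.hom m.1)
        rw [this, map_zero, map_zero, map_zero]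
  · rfl

lemma truncMap_id (C : Set (Paths V)) (x : Paths V) (M : ModuleCat.{u} k) :
    truncMap C C x x (𝟙 M) = 𝟙 _ := by
  ext m
  refine (truncMap_val C C x x (𝟙 M) _).trans ?_
  split_ifs with hx
  · rfl
  · exact (m.2 hx).symm

lemma truncMap_add (C D : Set (Paths V)) (x y : Paths V) {M N : ModuleCat.{u} k} (f g : M ⟶ N) :
    truncMap C D x y (f + g) = truncMap C D x y f + truncMap C D x y g := by
  ext m
  refine (truncMap_val ..).trans (Eq.trans ?_ (congrArg₂ (· + ·) (truncMap_val C D x y f m)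
    (truncMap_val C D x y g m)).symm)
  split_ifs
  · rfl
  · exact (add_zero _).symm

lemma truncMap_smul (C D : Set (Paths V)) (x y : Paths V) {M N : ModuleCat.{u} k} (f : M ⟶ N)
    (c : k) : truncMap C D x y (c • f) = c • truncMap C D x y f := by
  ext m
  refine (truncMap_val ..).trans (Eq.trans ?_ (congrArg (c • ·) (truncMap_val C D x y f m)).symm)
  split_ifs
  · rfl
  · exact (smul_zero _).symm

/-- The truncation of representations to a convex set of vertices. -/
def trunc (C : Set (Paths V)) (hC : PathConvex C) : BigRep k V ⥤ BigRep k V where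
  obj M :=
    { obj x := ModuleCat.of k (truncSub C x (M.obj x))
      map {x y} p := truncMap C C x y (M.map p)
      map_id x := by rw [M.map_id, truncMap_id]
      map_comp {x y z} p q := by
        rw [M.map_comp, truncMap_comp _ _ _ _ _ _ _ _ (fun hx hz => hC p q hx hz)] }
  map {M N} f :=
    { app x := truncMap C C x x (f.app x)
      naturality x y p := by
        dsimp only
        rw [truncMap_comp _ _ _ _ _ _ _ _ (fun _ h => h),
          truncMap_comp _ _ _ _ _ _ _ _ (fun h _ => h), f.naturality] }
  map_id M := by
    ext x : 2
    exact truncMap_id _ _ _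
  map_comp f g := by
    ext x : 2
    exact (truncMap_comp _ _ _ _ _ _ _ _ (fun h _ => h)).symm

/-- The natural transformations between truncations. -/
def truncNat {C D : Set (Paths V)} (hC : PathConvex C) (hD : PathConvex D)
    (h : ∀ ⦃x y : Paths V⦄ (_ : x ⟶ y), x ∈ C → y ∈ D → y ∈ C ∧ x ∈ D) :
    trunc (k := k) C hC ⟶ trunc D hD where
  app M :=
    { app x := truncMap C D x x (𝟙 _)
      naturality x y p := by
        dsimp only [trunc]
        rw [truncMap_comp _ _ _ _ _ _ _ _ (fun h1 h2 => (h p h1 h2).1),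
          truncMap_comp _ _ _ _ _ _ _ _ (fun h1 h2 => (h p h1 h2).2), Category.id_comp,
          Category.comp_id] }
  naturality M N f := by
    ext x : 2
    dsimp [trunc]
    rw [truncMap_comp _ _ _ _ _ _ _ _ (fun h _ => h), truncMap_comp _ _ _ _ _ _ _ _ (fun _ h => h),
      Category.id_comp, Category.comp_id]

instance (C : Set (Paths V)) (hC : PathConvex C) : (trunc (k := k) C hC).Additive where
  map_add {M N f g} := by
    ext x : 2
    exact truncMap_add _ _ _ _ _ _

instance (C : Set (Paths V)) (hC : PathConvex C) : (trunc (k := k) C hC).Linear k where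
  map_smul f c := by
    ext x : 2
    exact truncMap_smul _ _ _ _ _ _

/-- Truncation of linear maps is linear, so a relation acts on the truncation by the truncation of
its action on `M`. -/
lemma isRep_trunc (R : Relations k V) (C : Set (Paths V)) (hC : PathConvex C) (M : BigRep k V)
    (hM : isRep R M) : isRep R ((trunc C hC).obj M) := by
  refine ⟨fun a => ?_, fun a b r hr => ?_⟩
  · have : Module.Finite k (M.obj a) := hM.1 a
    exact Module.Finite.of_injective (truncSub C a (M.obj a)).subtype
      (truncSub C a (M.obj a)).injective_subtype
  · have h1 : act ((trunc C hC).obj M) r = truncMap C C a b (act M r) := by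
      simp only [act, Finsupp.sum]
      have (s : Finset (a ⟶ b)) : truncMap C C a b (∑ p ∈ s, r p • M.map p) =
          ∑ p ∈ s, truncMap C C a b (r p • M.map p) :=
        map_sum (AddMonoidHom.mk' (truncMap C C a b (M := M.obj a) (N := M.obj b))
          (truncMap_add C C a b)) _ _
      rw [this]
      exact Finset.sum_congr rfl (fun p _ => (truncMap_smul _ _ _ _ _ _).symm)
    rw [h1, hM.2 a b r hr]
    have := truncMap_smul C C a b (0 : M.obj a ⟶ M.obj b) (0 : k)
    rwa [zero_smul, zero_smul] at this

/-- A convex set of vertices cut into two parts, the first of which is closed under successors. -/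
structure PathCut (B C A : Set (Paths V)) : Prop where
  left : PathConvex B
  mid : PathConvex C
  right : PathConvex A
  mem_iff (x : Paths V) : x ∈ C ↔ x ∈ A ∨ x ∈ B
  disjoint (x : Paths V) : x ∈ A → x ∉ B
  closed ⦃x y : Paths V⦄ (p : x ⟶ y) : x ∈ B → y ∈ C → y ∈ B

namespace PathCut

variable {A B C : Set (Paths V)} (h : PathCut B C A)
include h

lemma subset_left {x : Paths V} (hx : x ∈ B) : x ∈ C := (h.mem_iff x).2 (.inr hx)

lemma subset_right {x : Paths V} (hx : x ∈ A) : x ∈ C := (h.mem_iff x).2 (.inl hx)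

/-- The inclusion of the truncation to the part closed under successors. -/
def inl : trunc (k := k) B h.left ⟶ trunc C h.mid :=
  truncNat _ _ (fun _ _ p hx hy => ⟨h.closed p hx hy, h.subset_left hx⟩)

/-- The projection to the truncation to the part closed under predecessors. -/
def proj : trunc (k := k) C h.mid ⟶ trunc A h.right :=
  truncNat _ _ (fun x _ p hx hy => ⟨h.subset_right hy, by
    by_contra hxA
    exact h.disjoint _ hy (h.closed p (((h.mem_iff x).1 hx).resolve_left hxA)
      (h.subset_right hy))⟩)

lemma inl_app_val (M : BigRep k V) (x : Paths V) (m : truncSub B x (M.obj x)) :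
    (((h.inl.app M).app x).hom m).1 = m.1 := by
  classical
  refine (truncMap_val B C x x (𝟙 _) m).trans ?_
  split_ifs with hx
  · rfl
  · exact (m.2 (fun hB => hx (h.subset_left hB))).symm

open Classical in
lemma proj_app_val (M : BigRep k V) (x : Paths V) (m : truncSub C x (M.obj x)) :
    (((h.proj.app M).app x).hom m).1 = if x ∈ A then m.1 else 0 :=
  truncMap_val C A x x (𝟙 _) m

lemma inl_proj : (h.inl (k := k)) ≫ h.proj = 0 := by
  ext M x m
  refine Subtype.ext ((h.proj_app_val M x _).trans ?_)
  split_ifs with hx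
  · refine (h.inl_app_val M x m).trans ?_
    exact m.2 (h.disjoint x hx)
  · rfl

/-- Exactness is tested at each vertex. There the middle term is the whole of `M` at the vertex if
it lies in `C`, and exactly one of the outer terms equals it; otherwise all three vanish. -/
lemma shortExact (M : BigRep k V) :
    (ShortComplex.mk (h.inl.app M) (h.proj.app M)
      (by rw [← NatTrans.comp_app, h.inl_proj]; rfl)).ShortExact := by
  refine ShortComplex.shortExact_of_evaluation _ (fun x => ?_)
  refine { exact := ?_, mono_f := ?_, epi_g := ?_ }
  · rw [ShortComplex.moduleCat_exact_iff]
    intro m hm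
    have hm1 := (h.proj_app_val M x m).symm.trans (congrArg Subtype.val hm)
    have hB : m.1 ∈ truncSub B x (M.obj x) := by
      intro hx
      split_ifs at hm1 with hxA
      · exact hm1
      · exact m.2 (fun hC => by rcases (h.mem_iff x).1 hC with h' | h' <;> contradiction)
    exact ⟨⟨m.1, hB⟩, Subtype.ext (h.inl_app_val M x ⟨m.1, hB⟩)⟩
  · refine (ModuleCat.mono_iff_injective _).2 (fun m m' hm => Subtype.ext ?_)
    exact (h.inl_app_val M x m).symm.trans ((congrArg Subtype.val hm).trans (h.inl_app_val M x m'))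
  · refine (ModuleCat.epi_iff_surjective _).2 (fun m => ?_)
    have hC : m.1 ∈ truncSub C x (M.obj x) := fun hx => m.2 (fun hA => hx (h.subset_right hA))
    refine ⟨⟨m.1, hC⟩, Subtype.ext ((h.proj_app_val M x _).trans ?_)⟩
    split_ifs with hxA
    · rfl
    · exact (m.2 hxA).symm

end PathCut

variable (R : Relations k V) [IsTensor R]

/-- The truncation functor on bounded homotopy categories. -/
abbrev truncKb (C : Set (Paths V)) (hC : PathConvex C) : Kb (isRep R) ⥤ Kb (isRep R) :=
  mapKb (isRep R) (isRep R) (trunc C hC) (isRep_trunc R C hC)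

namespace PathCut

variable {A B C : Set (Paths V)} (h : PathCut B C A)

/-- The natural transformation induced on homotopy categories by an inclusion. -/
abbrev inlKb : truncKb R B h.left ⟶ truncKb R C h.mid :=
  mapKbNat (isRep R) (isRep R) (isRep_trunc R B h.left) (isRep_trunc R C h.mid) h.inl

/-- The natural transformation induced on homotopy categories by a projection. -/
abbrev projKb : truncKb R C h.mid ⟶ truncKb R A h.right :=
  mapKbNat (isRep R) (isRep R) (isRep_trunc R C h.mid) (isRep_trunc R A h.right) h.proj

/-- The exact sequences of representations, applied in each degree, form a short exact sequence of
complexes. These triangles replace the triangles of a semi-orthogonal decomposition. -/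
lemma exists_distinguished (K : Kb (isRep R)) :
    ∃ δ, Triangle.mk ((QDb (isRep R)).map ((h.inlKb R).app K))
      ((QDb (isRep R)).map ((h.projKb R).app K)) δ ∈ distTriang (DRep R) := by
  obtain ⟨K, rfl⟩ := quotientKb_obj_surjective _ K
  let f : (mapCb (isRep R) (isRep R) (trunc B h.left) (isRep_trunc R B h.left)).obj K ⟶
    (mapCb (isRep R) (isRep R) (trunc C h.mid) (isRep_trunc R C h.mid)).obj K :=
    ObjectProperty.homMk ((NatTrans.mapHomologicalComplex h.inl (.up ℤ)).app K.obj)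
  let g : (mapCb (isRep R) (isRep R) (trunc C h.mid) (isRep_trunc R C h.mid)).obj K ⟶
    (mapCb (isRep R) (isRep R) (trunc A h.right) (isRep_trunc R A h.right)).obj K :=
    ObjectProperty.homMk ((NatTrans.mapHomologicalComplex h.proj (.up ℤ)).app K.obj)
  have w : f.hom ≫ g.hom = 0 := by
    ext n : 1
    exact NatTrans.congr_app h.inl_proj (K.obj.X n)
  refine exists_distinguished_of_shortExact (isRep R) f g w ?_
  exact HomologicalComplex.shortExact_of_degreewise_shortExact _
    (fun n => h.shortExact (K.obj.X n))

end PathCut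

end BoundedDerived

namespace CategoryTheory

/-- The image of the identity of `X` is a sum of morphisms through shifts of the zero object `F.obj
U`. -/
lemma ShiftGenerates.isZero_obj {D : Type*} [Category* D] [Preadditive D] [HasShift D ℤ]
    [∀ n : ℤ, (shiftFunctor D n).Additive]
    {S : Type*} [Category* S] [Preadditive S] [HasShift S ℤ]
    [∀ n : ℤ, (shiftFunctor S n).Additive] {U : D} (hU : ShiftGenerates U) (F : D ⥤ S)
    [F.Additive] [F.CommShift ℤ] (h : IsZero (F.obj U)) (X : D) : IsZero (F.obj X) := by
  obtain ⟨ι, _, n, a, b, hab⟩ := hU X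
  rw [IsZero.iff_id_eq_zero, ← F.map_id, ← hab, F.map_sum]
  refine Finset.sum_eq_zero (fun t _ => ?_)
  have : IsZero (F.obj (U⟦n t⟧)) :=
    ((shiftFunctor S (n t)).map_isZero h).of_iso ((F.commShiftIso (n t)).app U)
  rw [F.map_comp, this.eq_of_tgt (F.map (b t)) 0, zero_comp]

end CategoryTheory

namespace BoundedDerived

open HomologicalComplex Pretriangulated

/-! ### Composition of induced functors -/

section MapKbComp

variable {A : Type*} [Category* A] [Abelian A] {B : Type*} [Category* B] [Abelian B]
  {C : Type*} [Category* C] [Abelian C]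

/-- The functors induced on homotopy categories are compatible with composition. -/
def mapHomotopyCategoryComp (Φ : A ⥤ B) (Ψ : B ⥤ C) [Φ.Additive] [Ψ.Additive] :
    Φ.mapHomotopyCategory (.up ℤ) ⋙ Ψ.mapHomotopyCategory (.up ℤ) ⟶
      (Φ ⋙ Ψ).mapHomotopyCategory (.up ℤ) where
  app _ := 𝟙 _
  naturality K L f := by
    obtain ⟨f, rfl⟩ := (HomotopyCategory.quotient A (.up ℤ)).map_surjective f
    exact (Category.comp_id _).trans (Category.id_comp _).symm

/-- The functors induced on complexes are compatible with composition. -/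
def mapHomologicalComplexComp (Φ : A ⥤ B) (Ψ : B ⥤ C) [Φ.Additive] [Ψ.Additive] :
    Φ.mapHomologicalComplex (.up ℤ) ⋙ Ψ.mapHomologicalComplex (.up ℤ) ⟶
      (Φ ⋙ Ψ).mapHomologicalComplex (.up ℤ) where
  app _ := 𝟙 _
  naturality _ _ _ := (Category.comp_id _).trans (Category.id_comp _).symm

instance (Φ : A ⥤ B) (Ψ : B ⥤ C) [Φ.Additive] [Ψ.Additive] :
    NatTrans.CommShift (mapHomologicalComplexComp Φ Ψ) ℤ where
  shift_comm n := by
    ext K i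
    rw [NatTrans.comp_app, Functor.commShiftIso_comp_hom_app]
    change (Ψ.map (𝟙 (Φ.obj (K.X (i + n)))) ≫ 𝟙 (Ψ.obj (Φ.obj (K.X (i + n))))) ≫
      𝟙 (Ψ.obj (Φ.obj (K.X (i + n)))) = 𝟙 _ ≫ 𝟙 _
    simp

instance (Φ : A ⥤ B) (Ψ : B ⥤ C) [Φ.Additive] [Ψ.Additive] :
    NatTrans.CommShift (mapHomotopyCategoryComp Φ Ψ) ℤ := by
  refine .of_whiskerLeft _ (HomotopyCategory.quotient A (.up ℤ)) ?_
  -- All components are identities, so the transformation may be rewritten as a composite of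
  -- structural transformations which are known to commute with shifts.
  have : Functor.whiskerLeft (HomotopyCategory.quotient A (.up ℤ)) (mapHomotopyCategoryComp Φ Ψ) =
      (Functor.associator _ _ _).inv ≫
      Functor.whiskerRight (Φ.mapHomotopyCategoryFactors (.up ℤ)).hom
        (Ψ.mapHomotopyCategory (.up ℤ)) ≫
      (Functor.associator _ _ _).hom ≫
      Functor.whiskerLeft (Φ.mapHomologicalComplex (.up ℤ))
        (Ψ.mapHomotopyCategoryFactors (.up ℤ)).hom ≫
      (Functor.associator _ _ _).inv ≫
      Functor.whiskerRight (mapHomologicalComplexComp Φ Ψ) (HomotopyCategory.quotient C (.up ℤ)) ≫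
      ((Φ ⋙ Ψ).mapHomotopyCategoryFactors (.up ℤ)).inv := by
    ext K
    let X := (HomotopyCategory.quotient C (.up ℤ)).obj ((Ψ.mapHomologicalComplex (.up ℤ)).obj
      ((Φ.mapHomologicalComplex (.up ℤ)).obj K))
    have h1 : (Ψ.mapHomotopyCategory (.up ℤ)).map ((Φ.mapHomotopyCategoryFactors (.up ℤ)).hom.app K)
      = 𝟙 X := (Ψ.mapHomotopyCategory (.up ℤ)).map_id _
    have h2 : (HomotopyCategory.quotient C (.up ℤ)).map ((mapHomologicalComplexComp Φ Ψ).app K) =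
      𝟙 X := (HomotopyCategory.quotient C (.up ℤ)).map_id _
    have h3 : 𝟙 X = 𝟙 X ≫ 𝟙 X ≫ 𝟙 X ≫ 𝟙 X ≫ 𝟙 X ≫ 𝟙 X ≫ 𝟙 X := by simp
    exact h3.trans (congrArg₂ (fun a b => 𝟙 X ≫ a ≫ 𝟙 X ≫ 𝟙 X ≫ 𝟙 X ≫ b ≫ 𝟙 X) h1 h2).symm
  rw [this]
  infer_instance

end MapKbComp

section MapKbComp

variable {A : Type*} [Category* A] [Abelian A] [MonoidalCategory A] [TensorCocomplete A]
  {B : Type*} [Category* B] [Abelian B] [MonoidalCategory B] [TensorCocomplete B]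
  {C : Type*} [Category* C] [Abelian C] [MonoidalCategory C] [TensorCocomplete C]
  (P : ObjectProperty A) [P.IsClosedUnderFiniteProducts] [P.IsClosedUnderIsomorphisms]
  (P' : ObjectProperty B) [P'.IsClosedUnderFiniteProducts] [P'.IsClosedUnderIsomorphisms]
  (P'' : ObjectProperty C) [P''.IsClosedUnderFiniteProducts] [P''.IsClosedUnderIsomorphisms]
  (Φ : A ⥤ B) [Φ.Additive] (hΦ : ∀ X, P X → P' (Φ.obj X))
  (Ψ : B ⥤ C) [Ψ.Additive] (hΨ : ∀ X, P' X → P'' (Ψ.obj X))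

/-- The functors induced on bounded homotopy categories are compatible with composition. -/
def mapKbComp : mapKb P P' Φ hΦ ⋙ mapKb P' P'' Ψ hΨ ⟶
    mapKb P P'' (Φ ⋙ Ψ) (fun X hX => hΨ _ (hΦ X hX)) where
  app K := ObjectProperty.homMk ((mapHomotopyCategoryComp Φ Ψ).app K.obj)
  naturality K L f := by
    ext
    exact (mapHomotopyCategoryComp Φ Ψ).naturality f.hom

instance : IsIso (mapKbComp P P' P'' Φ hΦ Ψ hΨ) := by
  have (K : Kb P) : IsIso ((mapKbComp P P' P'' Φ hΦ Ψ hΨ).app K) :=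
    inferInstanceAs (IsIso (𝟙 ((mapKb P P'' (Φ ⋙ Ψ) (fun X hX => hΨ _ (hΦ X hX))).obj K)))
  exact NatIso.isIso_of_isIso_app _

instance : NatTrans.CommShift (mapKbComp P P' P'' Φ hΦ Ψ hΨ) ℤ := by
  refine .of_whiskerRight _ (boundedH P'').ι ?_
  have : Functor.whiskerRight (mapKbComp P P' P'' Φ hΦ Ψ hΨ) (boundedH P'').ι =
      (Functor.associator _ _ _).hom ≫
      Functor.whiskerLeft (mapKb P P' Φ hΦ) ((boundedH P'').liftCompιIso _ _).hom ≫
      (Functor.associator _ _ _).inv ≫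
      Functor.whiskerRight ((boundedH P').liftCompιIso _ _).hom (Ψ.mapHomotopyCategory (.up ℤ)) ≫
      (Functor.associator _ _ _).hom ≫
      Functor.whiskerLeft (boundedH P).ι (mapHomotopyCategoryComp Φ Ψ) ≫
      ((boundedH P'').liftCompιIso _ _).inv := by
    ext K
    let X := ((Φ ⋙ Ψ).mapHomotopyCategory (.up ℤ)).obj K.obj
    have h1 : (Ψ.mapHomotopyCategory (.up ℤ)).map (((boundedH P').liftCompιIso _
        (boundedH_map P P' Φ hΦ)).hom.app K) = 𝟙 X := (Ψ.mapHomotopyCategory (.up ℤ)).map_id _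
    have h3 : 𝟙 X = 𝟙 X ≫ 𝟙 X ≫ 𝟙 X ≫ 𝟙 X ≫ 𝟙 X ≫ 𝟙 X ≫ 𝟙 X := by simp
    exact h3.trans (congrArg (fun a => 𝟙 X ≫ 𝟙 X ≫ 𝟙 X ≫ a ≫ 𝟙 X ≫ 𝟙 X ≫ 𝟙 X) h1).symm
  rw [this]
  infer_instance

variable {P P'} {Φ} {Φ' : A ⥤ B} [Φ'.Additive] {hΦ} {hΦ' : ∀ X, P X → P' (Φ'.obj X)}

lemma isIso_mapKbNat (α : Φ ⟶ Φ') [IsIso α] : IsIso (mapKbNat P P' hΦ hΦ' α) := by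
  refine ⟨mapKbNat P P' hΦ' hΦ (inv α), ?_, ?_⟩
  · ext K
    obtain ⟨K, rfl⟩ := quotientKb_obj_surjective P K
    have h : (NatTrans.mapHomologicalComplex α (.up ℤ)).app K.obj ≫
        (NatTrans.mapHomologicalComplex (inv α) (.up ℤ)).app K.obj = 𝟙 _ := by
      ext n : 1
      exact NatTrans.congr_app (IsIso.hom_inv_id α) (K.obj.X n)
    exact (congrArg (HomotopyCategory.quotient B (.up ℤ)).map h)
  · ext K
    obtain ⟨K, rfl⟩ := quotientKb_obj_surjective P K
    have h : (NatTrans.mapHomologicalComplex (inv α) (.up ℤ)).app K.obj ≫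
        (NatTrans.mapHomologicalComplex α (.up ℤ)).app K.obj = 𝟙 _ := by
      ext n : 1
      exact NatTrans.congr_app (IsIso.inv_hom_id α) (K.obj.X n)
    exact (congrArg (HomotopyCategory.quotient B (.up ℤ)).map h)

end MapKbComp

/-! ### Representations concentrated at one vertex -/

section Simple

variable {k : Type u} [Field k] {V : Type v} [Quiver.{w} V] (R : Relations k V) [IsTensor R]

lemma act_const (W : ModuleCat.{u} k) {a b : Paths V} (r : (a ⟶ b) →₀ k) :
    act ((Functor.const (Paths V)).obj W) r = (r.sum fun _ c => c) • 𝟙 W := by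
  simp only [act, Finsupp.sum, Finset.sum_smul]
  rfl

/-- A relation acts on a constant representation by the sum of its coefficients. That the unit
representation satisfies the relations therefore says that these sums vanish, so all constant
representations satisfy them, and by truncation so do those concentrated at one vertex. -/
lemma sum_eq_zero_of_mem {a b : Paths V} (r : (a ⟶ b) →₀ k) (hr : r ∈ R a b) :
    (r.sum fun _ c => c) = 0 := by
  have h1 := (act_const (𝟙_ (ModuleCat.{u} k)) r).symm.trans (IsTensor.unit.2 a b r hr)
  have h2 := ConcreteCategory.congr_hom h1 (1 : k)
  exact (mul_one _).symm.trans h2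

lemma isRep_const (W : ModuleCat.{u} k) (hW : ModuleCat.isFG k W) :
    isRep R ((Functor.const (Paths V)).obj W) :=
  ⟨fun _ => hW, fun a b r hr => by rw [act_const, sum_eq_zero_of_mem R r hr, zero_smul]⟩

/-- The representation which is concentrated at one vertex. -/
abbrev simple (i : Paths V) (hi : PathConvex {i}) : ModuleCat.{u} k ⥤ BigRep k V :=
  Functor.const (Paths V) ⋙ trunc {i} hi

instance : (Functor.const (Paths V) : ModuleCat.{u} k ⥤ BigRep k V).Additive where
instance : (Functor.const (Paths V) : ModuleCat.{u} k ⥤ BigRep k V).Linear k where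

lemma isRep_simple (i : Paths V) (hi : PathConvex {i}) (W : ModuleCat.{u} k)
    (hW : ModuleCat.isFG k W) : isRep R ((simple i hi).obj W) :=
  isRep_trunc R _ hi _ (isRep_const R W hW)

lemma truncMap_congr {C D : Set (Paths V)} {x y : Paths V} {M N : ModuleCat.{u} k} {f g : M ⟶ N}
    (h : x ∈ C → y ∈ D → f = g) : truncMap C D x y f = truncMap C D x y g := by
  ext m
  refine (truncMap_val ..).trans (Eq.trans ?_ (truncMap_val ..).symm)
  split_ifs with hy
  · by_cases hx : x ∈ C
    · rw [h hx hy]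
    · rw [m.2 hx, map_zero, map_zero]
  · rfl

open Classical in
/-- The canonical map from the value at `i` to the value at `x`, which is zero for `x ≠ i`. -/
def stalkMap (i : Paths V) (M : BigRep k V) (x : Paths V) : M.obj i ⟶ M.obj x :=
  if h : i = x then M.map (eqToHom h) else 0

open Classical in
/-- The inverse of `stalkMap` for `x = i`. -/
def costalkMap (i : Paths V) (M : BigRep k V) (x : Paths V) : M.obj x ⟶ M.obj i :=
  if h : x = i then M.map (eqToHom h) else 0

lemma stalkMap_self (i : Paths V) (M : BigRep k V) : stalkMap i M i = 𝟙 _ := by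
  simp [stalkMap]

lemma costalkMap_self (i : Paths V) (M : BigRep k V) : costalkMap i M i = 𝟙 _ := by
  simp [costalkMap]

variable (hQ : ∀ (a : V) (p : Quiver.Path a a), p = Quiver.Path.nil)

/-- The truncation to one vertex. -/
def simpleIso (i : Paths V) (hi : PathConvex {i}) :
    (evaluation (Paths V) (ModuleCat.{u} k)).obj i ⋙ simple i hi ≅ trunc {i} hi :=
  NatIso.ofComponents (fun M => NatIso.ofComponents (fun x =>
      { hom := truncMap {i} {i} x x (stalkMap i M x)
        inv := truncMap {i} {i} x x (costalkMap i M x)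
        hom_inv_id := by
          refine (truncMap_comp _ _ _ _ _ _ _ _ (fun _ h => h)).trans ?_
          refine Eq.trans (truncMap_congr (fun hx _ => ?_)) (truncMap_id _ _ _)
          obtain rfl : x = i := hx
          rw [stalkMap_self, costalkMap_self]
          exact Category.comp_id _
        inv_hom_id := by
          refine (truncMap_comp _ _ _ _ _ _ _ _ (fun _ h => h)).trans ?_
          refine Eq.trans (truncMap_congr (fun hx _ => ?_)) (truncMap_id _ _ _)
          obtain rfl : x = i := hx
          rw [stalkMap_self, costalkMap_self, Category.id_comp] })
      (fun {x y} p => by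
        refine (truncMap_comp _ _ _ _ _ _ _ _ (fun _ h => h)).trans (Eq.trans ?_
          (truncMap_comp _ _ _ _ _ _ _ _ (fun h _ => h)).symm)
        refine truncMap_congr (fun hx hy => ?_)
        obtain rfl : x = i := hx
        obtain rfl : y = x := hy
        -- Only the trivial path leads from a vertex to itself, so there is no action of loops to
        -- compare.
        obtain rfl : p = 𝟙 y := hQ y p
        rw [stalkMap_self, M.map_id]
        rfl))
    (fun {M N} f => by
      ext x : 2
      refine (truncMap_comp _ _ _ _ _ _ _ _ (fun _ h => h)).trans (Eq.trans ?_
          (truncMap_comp _ _ _ _ _ _ _ _ (fun h _ => h)).symm)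
      refine truncMap_congr (fun hx hy => ?_)
      obtain rfl : x = i := hx
      rw [stalkMap_self, stalkMap_self]
      exact (Category.comp_id _).trans (Category.id_comp (f.app x)).symm)

/-- Complexes of representations concentrated at one vertex. -/
abbrev simpleKb (i : Paths V) (hi : PathConvex {i}) : Kb (ModuleCat.isFG.{u} k) ⥤ Kb (isRep R) :=
  mapKb (ModuleCat.isFG k) (isRep R) (simple i hi) (isRep_simple R i hi)

/-- The values of a complex of representations at a vertex. -/
abbrev stalkKb (i : Paths V) : Kb (isRep R) ⥤ Kb (ModuleCat.isFG.{u} k) :=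
  mapKb (isRep R) (ModuleCat.isFG k) ((evaluation (Paths V) (ModuleCat.{u} k)).obj i)
    (fun _ h => h.1 i)

include hQ in
-- Without oriented cycles, the part of a representation at `i` carries no more structure than its
-- vector space, so truncation to `{i}` factors through complexes of vector spaces.
lemma exists_simpleKb_iso (i : Paths V) (hi : PathConvex {i}) :
    ∃ α : stalkKb R i ⋙ simpleKb R i hi ⟶ truncKb R {i} hi, IsIso α ∧ NatTrans.CommShift α ℤ := by
  let β := mapKbComp (isRep R) (ModuleCat.isFG k) (isRep R)
    ((evaluation (Paths V) (ModuleCat.{u} k)).obj i) (fun _ h => h.1 i)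
    (simple i hi) (isRep_simple R i hi)
  let γ := mapKbNat (isRep R) (isRep R) (fun X hX => isRep_simple R i hi _ (hX.1 i))
    (isRep_trunc R _ _) (simpleIso hQ i hi).hom
  have : IsIso γ := isIso_mapKbNat _
  exact ⟨β ≫ γ, inferInstance, inferInstance⟩

end Simple

end BoundedDerived

namespace CategoryTheory

/-- Extend `θ` and its inverse to transformations; the composites are identities because they are so
at `U`. -/
lemma exists_natIso_commShift {k : Type*} [Field k] {D : Type*} [Category* D] [Preadditive D]
    [HasShift D ℤ] [∀ n : ℤ, (shiftFunctor D n).Additive] [Linear k D]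
    {S : Type*} [Category* S] [Preadditive S] [HasShift S ℤ]
    [∀ n : ℤ, (shiftFunctor S n).Additive] [Linear k S] {U : D} (F G : D ⥤ S) [F.Additive]
    [G.Additive] [F.Linear k] [G.Linear k] [F.CommShift ℤ] [G.CommShift ℤ]
    (hU : ShiftGenerates U) (h : ShiftExceptional k U) (θ : F.obj U ≅ G.obj U) :
    ∃ τ : F ≅ G, NatTrans.CommShift τ.hom ℤ := by
  obtain ⟨τ, hτ, h1⟩ := exists_natTrans_commShift hU h θ.hom
  obtain ⟨τ', hτ', h1'⟩ := exists_natTrans_commShift hU h θ.inv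
  refine ⟨⟨τ, τ', ?_, ?_⟩, hτ⟩
  · refine hU.natTrans_commShift_eq ?_
    rw [NatTrans.comp_app, h1, h1', Iso.hom_inv_id]
    rfl
  · refine hU.natTrans_commShift_eq ?_
    rw [NatTrans.comp_app, h1, h1', Iso.inv_hom_id]
    rfl

end CategoryTheory

namespace BoundedDerived

open HomologicalComplex Pretriangulated

/-! ### The identity functor, and descent of transformations along localization -/

section MapKbId

/-- The identity functor induces the identity on homotopy categories. -/
def mapHomotopyCategoryId (A : Type*) [Category* A] [Abelian A] :
    (𝟭 A).mapHomotopyCategory (.up ℤ) ⟶ 𝟭 (HomotopyCategory A (.up ℤ)) where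
  app _ := 𝟙 _
  naturality K L f := by
    obtain ⟨f, rfl⟩ := (HomotopyCategory.quotient A (.up ℤ)).map_surjective f
    exact (Category.comp_id _).trans (Category.id_comp _).symm

/-- The identity functor induces the identity on complexes. -/
def mapHomologicalComplexId (A : Type*) [Category* A] [Abelian A] :
    (𝟭 A).mapHomologicalComplex (.up ℤ) ⟶ 𝟭 (CochainComplex A ℤ) where
  app _ := 𝟙 _
  naturality _ _ _ := (Category.comp_id _).trans (Category.id_comp _).symm

instance (A : Type*) [Category* A] [Abelian A] :
    NatTrans.CommShift (mapHomologicalComplexId A) ℤ where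
  shift_comm n := by
    ext K i
    rw [NatTrans.comp_app, NatTrans.comp_app, Functor.commShiftIso_id_hom_app]
    change 𝟙 (K.X (i + n)) ≫ 𝟙 _ = 𝟙 _ ≫ 𝟙 _
    rfl

instance (A : Type*) [Category* A] [Abelian A] :
    NatTrans.CommShift (mapHomotopyCategoryId A) ℤ := by
  refine .of_whiskerLeft _ (HomotopyCategory.quotient A (.up ℤ)) ?_
  have : Functor.whiskerLeft (HomotopyCategory.quotient A (.up ℤ)) (mapHomotopyCategoryId A) =
      ((𝟭 A).mapHomotopyCategoryFactors (.up ℤ)).hom ≫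
      Functor.whiskerRight (mapHomologicalComplexId A) (HomotopyCategory.quotient A (.up ℤ)) ≫
      (Functor.leftUnitor _).hom ≫ (Functor.rightUnitor _).inv := by
    ext K
    let X := (HomotopyCategory.quotient A (.up ℤ)).obj K
    have h2 : (HomotopyCategory.quotient A (.up ℤ)).map ((mapHomologicalComplexId A).app K) =
      𝟙 X := (HomotopyCategory.quotient A (.up ℤ)).map_id _
    have h3 : 𝟙 X = 𝟙 X ≫ 𝟙 X ≫ 𝟙 X ≫ 𝟙 X := by simp
    exact h3.trans (congrArg (fun b => 𝟙 X ≫ b ≫ 𝟙 X ≫ 𝟙 X) h2).symm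
  rw [this]
  infer_instance

variable {A : Type*} [Category* A] [Abelian A] [MonoidalCategory A] [TensorCocomplete A]
  (P : ObjectProperty A) [P.IsClosedUnderFiniteProducts] [P.IsClosedUnderIsomorphisms]

/-- The identity functor induces the identity on bounded homotopy categories. -/
def mapKbId : mapKb P P (𝟭 A) (fun _ h => h) ⟶ 𝟭 (Kb P) where
  app K := ObjectProperty.homMk ((mapHomotopyCategoryId A).app K.obj)
  naturality K L f := by
    ext
    exact (mapHomotopyCategoryId A).naturality f.hom

instance : IsIso (mapKbId P) := by
  have (K : Kb P) : IsIso ((mapKbId P).app K) := inferInstanceAs (IsIso (𝟙 K))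
  exact NatIso.isIso_of_isIso_app _

instance : NatTrans.CommShift (mapKbId P) ℤ := by
  refine .of_whiskerRight _ (boundedH P).ι ?_
  have : Functor.whiskerRight (mapKbId P) (boundedH P).ι =
      ((boundedH P).liftCompιIso _ _).hom ≫
      Functor.whiskerLeft (boundedH P).ι (mapHomotopyCategoryId A) ≫
      (Functor.rightUnitor _).hom ≫ (Functor.leftUnitor _).inv := by
    ext K
    have h3 : 𝟙 K.obj = 𝟙 K.obj ≫ 𝟙 K.obj ≫ 𝟙 K.obj ≫ 𝟙 K.obj := by simp
    exact h3
  rw [this]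
  infer_instance

end MapKbId

section Localization

variable {A : Type u} [Category.{v} A] [Abelian A] [MonoidalCategory A] [TensorCocomplete A]
  (P : ObjectProperty A) [P.IsClosedUnderFiniteProducts] [P.IsClosedUnderIsomorphisms]
  [P.IsMonoidal] [(qis P).IsMonoidal] {S : Type*} [Category* S] [HasShift S ℤ]

/-- Whiskering with a localization functor is fully faithful, and since `QDb` is essentially
surjective, `of_whiskerLeft` lifts the compatibility with shifts. -/
lemma exists_natIso_of_QDb {F G : Db P ⥤ S} [F.CommShift ℤ] [G.CommShift ℤ]
    (τ : QDb P ⋙ F ≅ QDb P ⋙ G) (hτ : NatTrans.CommShift τ.hom ℤ) :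
    ∃ τ' : F ≅ G, NatTrans.CommShift τ'.hom ℤ := by
  let L := Localization.fullyFaithfulWhiskeringLeft (QDb P) (acyclic P).trW S
  refine ⟨L.preimageIso τ, .of_whiskerLeft _ (QDb P) ?_⟩
  have : Functor.whiskerLeft (QDb P) (L.preimageIso τ).hom = τ.hom :=
    L.map_preimage (X := F) (Y := G) τ.hom
  rwa [this]

lemma exists_natTrans_of_QDb {F G : Db P ⥤ S} [F.CommShift ℤ] [G.CommShift ℤ]
    (τ : QDb P ⋙ F ⟶ QDb P ⋙ G) (hτ : NatTrans.CommShift τ ℤ) :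
    ∃ τ' : F ⟶ G, NatTrans.CommShift τ' ℤ ∧ Functor.whiskerLeft (QDb P) τ' = τ := by
  let L := Localization.fullyFaithfulWhiskeringLeft (QDb P) (acyclic P).trW S
  have : Functor.whiskerLeft (QDb P) (L.preimage τ) = τ :=
    L.map_preimage (X := F) (Y := G) τ
  exact ⟨L.preimage τ, .of_whiskerLeft _ (QDb P) (by rwa [this]), this⟩

end Localization

end BoundedDerived

namespace BoundedDerived

open HomologicalComplex Pretriangulated

variable {k : Type u} [Field k] {V : Type v} [Quiver.{w} V]

lemma pathConvex_univ : PathConvex (Set.univ : Set (Paths V)) := fun _ _ _ _ _ _ _ => trivial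

/-! ### Cutting the vertices of a quiver without oriented cycles -/

section Acyclic

variable (hQ : ∀ (a : V) (p : Quiver.Path a a), p = Quiver.Path.nil)
include hQ

lemma eq_of_paths {x y : Paths V} (p : x ⟶ y) (q : y ⟶ x) : x = y := by
  have key (a b : V) (p : Quiver.Path a b) (q : Quiver.Path b a) : a = b := by
    have h1 := congrArg Quiver.Path.length (hQ a (p.comp q))
    rw [Quiver.Path.length_comp, Quiver.Path.length_nil] at h1
    exact Quiver.Path.eq_of_length_zero p (by omega)
  exact key x y p q

lemma pathConvex_singleton (i : Paths V) : PathConvex {i} := by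
  rintro x y z p q rfl rfl
  exact (eq_of_paths hQ p q).symm

/-- Reachability orders the finite set of vertices partially; a minimal element of `C` for strict
reachability is a sink of `C`. -/
lemma exists_sink [Finite V] (C : Set (Paths V)) (hC : C.Nonempty) :
    ∃ j ∈ C, ∀ y ∈ C, Nonempty (j ⟶ y) → y = j := by
  let r : Paths V → Paths V → Prop := fun y x => Nonempty (x ⟶ y) ∧ y ≠ x
  have : Finite (Paths V) := inferInstanceAs (Finite V)
  have : IsTrans (Paths V) r := ⟨by
    rintro a b c ⟨⟨p⟩, hab⟩ ⟨⟨q⟩, hbc⟩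
    refine ⟨⟨q ≫ p⟩, ?_⟩
    rintro rfl
    exact hab (eq_of_paths hQ q p)⟩
  have : Std.Irrefl r := ⟨fun a h => h.2 rfl⟩
  have hr : WellFounded r := Finite.wellFounded_of_trans_of_irrefl r
  refine ⟨hr.min C hC, hr.min_mem C hC, fun y hy hp => ?_⟩
  by_contra hne
  exact hr.not_lt_min C hy ⟨hp, hne⟩

/-- Nothing in `C` other than `j` can be reached from `j`, so no path between the other members of
`C` passes through `j`. This is the inductive step of the dévissage. -/
lemma pathCut_sink {C : Set (Paths V)} (hC : PathConvex C) {j : Paths V} (hj : j ∈ C)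
    (h : ∀ y ∈ C, Nonempty (j ⟶ y) → y = j) : PathCut {j} C (C \ {j}) where
  left := pathConvex_singleton hQ j
  mid := hC
  right := by
    intro x y z p q hx hz
    refine ⟨hC p q hx.1 hz.1, ?_⟩
    rintro rfl
    exact hz.2 (h z hz.1 ⟨q⟩)
  mem_iff x := by
    by_cases hx : x = j
    · subst hx; simp [hj]
    · simp [hx]
  disjoint x hx := hx.2
  closed := by
    rintro x y p rfl hy
    exact h y hy ⟨p⟩

/-- The vertices which can be reached from `i` are closed under successors. -/
lemma pathCut_reachable (i : Paths V) :
    PathCut {x : Paths V | Nonempty (i ⟶ x)} Set.univ {x | ¬ Nonempty (i ⟶ x)} where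
  left := fun _ _ _ p _ ⟨a⟩ _ => ⟨a ≫ p⟩
  mid := pathConvex_univ
  right := fun _ _ _ _ q _ hz ⟨a⟩ => hz ⟨a ≫ q⟩
  mem_iff x := by simpa using (em (Nonempty (i ⟶ x))).symm
  disjoint x hx := hx
  closed := fun _ _ p ⟨a⟩ _ => ⟨a ≫ p⟩

/-- No path returns to `i`, so the vertices reachable from `i` remain closed under successors when
`i` is removed. Together with `pathCut_reachable` this isolates `i` by two cuts. -/
lemma pathCut_source (i : Paths V) :
    PathCut ({x : Paths V | Nonempty (i ⟶ x)} \ {i}) {x : Paths V | Nonempty (i ⟶ x)} {i} where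
  left := by
    rintro x y z p q ⟨⟨a⟩, hx⟩ _
    refine ⟨⟨a ≫ p⟩, ?_⟩
    rintro rfl
    exact hx (eq_of_paths hQ p a)
  mid := fun _ _ _ p _ ⟨a⟩ _ => ⟨a ≫ p⟩
  right := pathConvex_singleton hQ i
  mem_iff x := by
    by_cases hx : x = i
    · subst hx; simpa using ⟨𝟙 x⟩
    · simp [hx]
  disjoint x hx h := h.2 hx
  closed := by
    rintro x y p ⟨⟨a⟩, hx⟩ ⟨b⟩
    refine ⟨⟨b⟩, ?_⟩
    rintro rfl
    exact hx (eq_of_paths hQ p a)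

end Acyclic

/-! ### Dévissage of exact functors by simple representations -/

section Devissage

variable (R : Relations k V) [IsTensor R]
  (hQ : ∀ (a : V) (p : Quiver.Path a a), p = Quiver.Path.nil)
  {S : Type*} [Category* S] [Preadditive S] [HasZeroObject S] [HasShift S ℤ]
  [∀ n : ℤ, (shiftFunctor S n).Additive] [Pretriangulated S]
  (F : DRep R ⥤ S) [F.CommShift ℤ] [F.IsTriangulated]

namespace PathCut

variable {R} {A B C : Set (Paths V)} (h : PathCut B C A) {F}
include h

lemma isZero_mid (K : Kb (isRep R))
    (h₁ : IsZero (F.obj ((QDb _).obj ((truncKb R B h.left).obj K))))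
    (h₃ : IsZero (F.obj ((QDb _).obj ((truncKb R A h.right).obj K)))) :
    IsZero (F.obj ((QDb _).obj ((truncKb R C h.mid).obj K))) := by
  obtain ⟨δ, hδ⟩ := h.exists_distinguished R K
  exact Triangle.isZero₂_of_isZero₁₃ _ (F.map_distinguished _ hδ) h₁ h₃

lemma isIso_inlKb
    (h₃ : ∀ K, IsZero (F.obj ((QDb _).obj ((truncKb R A h.right).obj K)))) :
    IsIso (Functor.whiskerRight (h.inlKb R) (QDb _ ⋙ F)) := by
  have (K : Kb (isRep R)) : IsIso ((Functor.whiskerRight (h.inlKb R) (QDb _ ⋙ F)).app K) := by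
    obtain ⟨δ, hδ⟩ := h.exists_distinguished R K
    exact (Triangle.isZero₃_iff_isIso₁ _ (F.map_distinguished _ hδ)).1 (h₃ K)
  exact NatIso.isIso_of_isIso_app _

lemma isIso_projKb
    (h₁ : ∀ K, IsZero (F.obj ((QDb _).obj ((truncKb R B h.left).obj K)))) :
    IsIso (Functor.whiskerRight (h.projKb R) (QDb _ ⋙ F)) := by
  have (K : Kb (isRep R)) : IsIso ((Functor.whiskerRight (h.projKb R) (QDb _ ⋙ F)).app K) := by
    obtain ⟨δ, hδ⟩ := h.exists_distinguished R K
    exact (Triangle.isZero₁_iff_isIso₂ _ (F.map_distinguished _ hδ)).1 (h₁ K)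
  exact NatIso.isIso_of_isIso_app _

end PathCut

/-- The one-dimensional representation at a vertex. -/
abbrev simpleDb (i : Paths V) : DRep R :=
  (QDb _).obj ((simpleKb R i (pathConvex_singleton hQ i)).obj (unitKb k))

variable {F} in
include hQ in
-- The truncation to `{j}` comes from a complex of vector spaces, and these are generated by the
-- shifts of `k`, which goes to `simpleDb R hQ j`.
lemma isZero_truncKb_singleton (j : Paths V) (hj : PathConvex {j})
    (h : IsZero (F.obj (simpleDb R hQ j))) (K : Kb (isRep R)) :
    IsZero (F.obj ((QDb _).obj ((truncKb R {j} hj).obj K))) := by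
  obtain ⟨α, hα, _⟩ := exists_simpleKb_iso R hQ j hj
  refine IsZero.of_iso ?_ ((QDb _ ⋙ F).mapIso ((asIso α).app K)).symm
  exact (shiftGenerates_unitKb k).isZero_obj (simpleKb R j hj ⋙ QDb _ ⋙ F) h _

variable {F} in
-- Induction on the number of vertices: a sink is split off, and the middle term of a triangle
-- vanishes if the outer terms do.
lemma isZero_truncKb [Finite V] (C : Set (Paths V)) (hC : PathConvex C)
    (h : ∀ j ∈ C, IsZero (F.obj (simpleDb R hQ j))) (K : Kb (isRep R)) :
    IsZero (F.obj ((QDb _).obj ((truncKb R C hC).obj K))) := by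
  have : Finite (Paths V) := inferInstanceAs (Finite V)
  induction hn : C.ncard using Nat.strong_induction_on generalizing C with
  | _ n ih =>
    obtain rfl | hne := C.eq_empty_or_nonempty
    · obtain ⟨K, rfl⟩ := quotientKb_obj_surjective _ K
      refine F.map_isZero (isZero_locDb_obj (isRep R)
        (K := (mapCb _ _ (trunc ∅ hC) (isRep_trunc R ∅ hC)).obj K) ?_)
      rw [IsZero.iff_id_eq_zero]
      ext n x m
      exact Subtype.ext (m.2 (fun h => h))
    · obtain ⟨j, hj, hjC⟩ := exists_sink hQ C hne
      have hcut := pathCut_sink hQ hC hj hjC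
      refine hcut.isZero_mid K (isZero_truncKb_singleton R hQ j _ (h j hj) K) ?_
      refine ih _ ?_ _ hcut.right (fun x hx => h x hx.1) rfl
      rw [← hn]
      exact Set.ncard_lt_ncard (by simpa using hj) (Set.toFinite _)

/-- The truncation to all vertices. -/
def truncUnivIso : trunc (k := k) Set.univ (pathConvex_univ (V := V)) ⟶
    𝟭 (BigRep k V) where
  app M :=
    { app x := ModuleCat.ofHom (truncSub Set.univ x (M.obj x)).subtype
      naturality x y p := by
        ext m
        exact (truncMap_val _ _ _ _ (M.map p) m).trans (if_pos trivial) }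
  naturality M N f := by
    ext x m
    exact (truncMap_val _ _ _ _ (f.app x) m).trans (if_pos trivial)

instance : IsIso (truncUnivIso (k := k) (V := V)) := by
  have (M : BigRep k V) : IsIso (truncUnivIso.app M) := by
    have (x : Paths V) : IsIso ((truncUnivIso.app M).app x) := by
      refine (ConcreteCategory.isIso_iff_bijective _).2 ⟨Subtype.val_injective, fun m => ?_⟩
      exact ⟨⟨m, fun h => absurd trivial h⟩, rfl⟩
    exact NatIso.isIso_of_isIso_app _
  exact NatIso.isIso_of_isIso_app _

lemma exists_truncKb_univ_iso : ∃ α : truncKb R Set.univ (pathConvex_univ (V := V)) ⟶ 𝟭 _, IsIso α ∧ NatTrans.CommShift α ℤ := by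
  let γ := mapKbNat (isRep R) (isRep R) (isRep_trunc R _ pathConvex_univ)
    (fun _ h => h) (truncUnivIso (k := k) (V := V))
  have : IsIso γ := isIso_mapKbNat _
  exact ⟨γ ≫ mapKbId (isRep R), inferInstance, inferInstance⟩

/-- A triangulated functor which vanishes on all but one of the simple representations is
determined by its values on the complexes concentrated at one vertex. -/
lemma exists_stalkKb_iso [Finite V] (i : Paths V)
    (h : ∀ j, j ≠ i → IsZero (F.obj (simpleDb R hQ j))) :
    ∃ τ : stalkKb R i ⋙ simpleKb R i (pathConvex_singleton hQ i) ⋙ QDb _ ⋙ F ≅ QDb _ ⋙ F,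
      NatTrans.CommShift τ.hom ℤ ∧ ∀ (σ : F ⟶ F) (K : Kb (isRep R)),
        τ.hom.app K ≫ σ.app _ = σ.app _ ≫ τ.hom.app K := by
  have c₁ := pathCut_reachable hQ i
  have c₂ := pathCut_source hQ i
  -- Two cuts give the zigzag from `K` back to its part reachable from `i`, and from there on to its
  -- part at `i`. The cones only involve simple representations at vertices other than `i`, so `F`
  -- inverts both maps.
  have h₁ := c₁.isIso_inlKb (F := F) (R := R) (fun K => isZero_truncKb R hQ _ _ (fun j hj => h j (by
    rintro rfl
    exact hj ⟨𝟙 j⟩)) K)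
  have h₂ := c₂.isIso_projKb (F := F) (R := R)
    (fun K => isZero_truncKb R hQ _ _ (fun j hj => h j hj.2) K)
  obtain ⟨α, hα, _⟩ := exists_simpleKb_iso R hQ i (pathConvex_singleton hQ i)
  obtain ⟨β, hβ, _⟩ := exists_truncKb_univ_iso R
  let a := Functor.whiskerRight α (QDb _ ⋙ F)
  let b := Functor.whiskerRight (c₂.projKb R) (QDb _ ⋙ F)
  let c := Functor.whiskerRight (c₁.inlKb R) (QDb _ ⋙ F)
  let d := Functor.whiskerRight β (QDb _ ⋙ F)
  have hb : NatTrans.CommShift (inv b) ℤ := NatTrans.CommShift.of_isIso _ _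
  refine ⟨(Functor.associator _ _ _).symm ≪≫ asIso a ≪≫ (asIso b).symm ≪≫ asIso c ≪≫ asIso d ≪≫
    Functor.leftUnitor _, ?_, fun σ K => ?_⟩
  · have : NatTrans.CommShift ((Functor.associator _ _ _).inv ≫ a ≫ inv b ≫ c ≫ d ≫
      (Functor.leftUnitor _).hom) ℤ := inferInstance
    exact this
  -- The isomorphism is composed of images under `F` of morphisms and of inverses of such images, so
  -- it commutes with every endomorphism of `F`. This is what determines the endomorphisms of a
  -- tensor functor later.
  · have hb' : b.app K ≫ (inv b).app K = 𝟙 _ := NatTrans.congr_app (IsIso.hom_inv_id b) K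
    have hb'' : (inv b).app K ≫ b.app K = 𝟙 _ := NatTrans.congr_app (IsIso.inv_hom_id b) K
    have na : a.app K ≫ σ.app _ = σ.app _ ≫ a.app K := σ.naturality _
    have nb : b.app K ≫ σ.app _ = σ.app _ ≫ b.app K := σ.naturality _
    have nc : c.app K ≫ σ.app _ = σ.app _ ≫ c.app K := σ.naturality _
    have nd : d.app K ≫ σ.app _ = σ.app _ ≫ d.app K := σ.naturality _
    have nb' : (inv b).app K ≫ σ.app _ = σ.app _ ≫ (inv b).app K := by
      have h1 : (inv b).app K ≫ (σ.app _ ≫ b.app K) ≫ (inv b).app K =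
        (inv b).app K ≫ (b.app K ≫ σ.app _) ≫ (inv b).app K := by rw [nb]
      simp only [Category.assoc, hb', reassoc_of% hb''] at h1
      exact (congrArg ((inv b).app K ≫ ·) (Category.comp_id _)).symm.trans h1
    have e : a.app K ≫ (inv b).app K ≫ c.app K ≫ d.app K ≫ σ.app _ =
        σ.app _ ≫ a.app K ≫ (inv b).app K ≫ c.app K ≫ d.app K := by
      rw [nd, reassoc_of% nc, reassoc_of% nb', reassoc_of% na]
      rfl
    have hZ : ((Functor.associator _ _ _).symm ≪≫ asIso a ≪≫ (asIso b).symm ≪≫ asIso c ≪≫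
        asIso d ≪≫ Functor.leftUnitor (QDb _ ⋙ F)).hom.app K =
        a.app K ≫ (inv b).app K ≫ c.app K ≫ d.app K := by
      simp
    rw [hZ]
    simpa only [Category.assoc] using! e

end Devissage

end BoundedDerived

namespace TensorTriangulated.TensorFunctor

variable {k : Type w} [CommRing k]
  {T : Type*} [Category* T] [Preadditive T] [HasZeroObject T] [HasShift T ℤ]
  [∀ n : ℤ, (shiftFunctor T n).Additive] [Pretriangulated T] [MonoidalCategory T] [Linear k T]
  {S : Type*} [Category* S] [Preadditive S] [HasZeroObject S] [HasShift S ℤ]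
  [∀ n : ℤ, (shiftFunctor S n).Additive] [Pretriangulated S] [MonoidalCategory S] [Linear k S]
  [∀ n : ℤ, (shiftFunctor S n).Linear k]

/-- An isomorphism of exact functors. -/
def isoMk {F G : TensorFunctor k T S} (e : F.functor ≅ G.functor)
    (he : NatTrans.CommShift e.hom ℤ) : F ≅ G where
  hom := ⟨e.hom, he⟩
  inv := ⟨e.inv, inferInstanceAs (NatTrans.CommShift e.inv ℤ)⟩
  hom_inv_id := Subtype.ext e.hom_inv_id
  inv_hom_id := Subtype.ext e.inv_hom_id

end TensorTriangulated.TensorFunctor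

namespace BoundedDerived

open HomologicalComplex Pretriangulated TensorTriangulated

/-! ### Classification of the points -/

section Classification

variable {k : Type u} [Field k] {V : Type v} [Quiver.{w} V]
  (R : Relations k V) [IsTensor R]
  (hQ : ∀ (a : V) (p : Quiver.Path a a), p = Quiver.Path.nil)

lemma isZero_trunc_obj {C : Set (Paths V)} (hC : PathConvex C) (M : BigRep k V) {x : Paths V}
    (hx : x ∉ C) : IsZero (((trunc C hC).obj M).obj x) := by
  have : Subsingleton (truncSub C x (M.obj x)) :=
    ⟨fun a b => Subtype.ext ((a.2 hx).trans (b.2 hx).symm)⟩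
  exact ModuleCat.isZero_of_subsingleton (ModuleCat.of k (truncSub C x (M.obj x)))

/-- At every vertex one of the two factors is zero, so every summand of the tensor product of
complexes vanishes. -/
lemma isZero_simple_tensor {i j : Paths V} (hij : i ≠ j) :
    IsZero (simpleDb R hQ i ⊗ simpleDb R hQ j) := by
  let K (i : Paths V) : Cb (isRep R) := (mapCb _ _ (simple i (pathConvex_singleton hQ i))
    (isRep_simple R i (pathConvex_singleton hQ i))).obj (𝟙_ (Cb (ModuleCat.isFG k)))
  refine IsZero.of_iso ?_ (Functor.Monoidal.μIso (locDb (isRep R)) (K i) (K j))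
  refine isZero_locDb_obj _ ?_
  have h (n : ℤ) : IsZero (((K i).obj ⊗ (K j).obj).X n) := by
    let X := ((GradedObject.mapBifunctor (curriedTensor (BigRep k V)) ℤ ℤ).obj (K i).obj.X).obj
      (K j).obj.X
    refine isZero_cofan (X.isColimitCofanMapObj (fun p : ℤ × ℤ => p.1 + p.2) n) (fun p => ?_)
    refine Functor.isZero _ (fun x => ?_)
    by_cases hx : x = i
    · exact (tensorLeft (((K i).obj.X p.1.1).obj x)).map_isZero
        (isZero_trunc_obj (pathConvex_singleton hQ j) _ (fun h => hij (hx.symm.trans h)))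
    · exact (tensorRight (((K j).obj.X p.1.2).obj x)).map_isZero
        (isZero_trunc_obj (pathConvex_singleton hQ i) _ hx)
  rw [IsZero.iff_id_eq_zero]
  ext n : 1
  exact (h n).eq_of_src _ _

variable (F : TensorFunctor k (DRep R) (DVect k))

lemma exists_iso_unit : Nonempty (F.functor.obj (𝟙_ (DRep R)) ≅ 𝟙_ (DVect k)) := by
  obtain ⟨_⟩ := F.monoidal
  exact ⟨(Functor.Monoidal.εIso F.functor).symm⟩

lemma isZero_or_isZero_of_isZero_tensor {X Y : DRep R} (h : IsZero (F.functor.obj (X ⊗ Y))) :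
    IsZero (F.functor.obj X) ∨ IsZero (F.functor.obj Y) := by
  obtain ⟨_⟩ := F.monoidal
  exact isZero_or_isZero_of_tensor (h.of_iso (Functor.Monoidal.μIso F.functor X Y))

/-- A tensor functor does not vanish on exactly one of the one-dimensional representations. -/
lemma exists_vertex [Finite V] : ∃ i : Paths V, ∀ j, j ≠ i →
    IsZero (F.functor.obj (simpleDb R hQ j)) := by
  -- If `F` killed all the simple representations, dévissage over all vertices would make it kill
  -- the unit.
  have h : ∃ i, ¬ IsZero (F.functor.obj (simpleDb R hQ i)) := by
    by_contra! h
    obtain ⟨α, hα, _⟩ := exists_truncKb_univ_iso R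
    obtain ⟨e⟩ := exists_iso_unit R F
    have h1 := isZero_truncKb R hQ Set.univ pathConvex_univ (fun j _ => h j)
      ((quotientKb _).obj (𝟙_ _))
    have h2 : IsZero (F.functor.obj ((locDb _).obj (𝟙_ _))) := h1.of_iso
      ((QDb _ ⋙ F.functor).mapIso ((asIso α).app ((quotientKb _).obj (𝟙_ _)))).symm
    have h3 : IsZero (F.functor.obj (𝟙_ (DRep R))) :=
      h2.of_iso (F.functor.mapIso (Functor.Monoidal.εIso (locDb (isRep R))))
    exact not_isZero_unit k (h3.of_iso e.symm)
  obtain ⟨i, hi⟩ := h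
  refine ⟨i, fun j hj => ?_⟩
  -- The tensor product with the surviving simple representation is zero, and the target has no zero
  -- divisors.
  exact (isZero_or_isZero_of_isZero_tensor R F (F.functor.map_isZero
    (isZero_simple_tensor R hQ hj))).resolve_right hi

include hQ in
/-- Every tensor functor is given by the evaluation at a vertex. -/
theorem exists_iso_evalTensorFunctor [Finite V] :
    ∃ i : Paths V, Nonempty (F ≅ evalTensorFunctor R i) := by
  obtain ⟨i, hi⟩ := exists_vertex R hQ F
  obtain ⟨τ, hτ, -⟩ := exists_stalkKb_iso R hQ F.functor i hi
  let G := simpleKb R i (pathConvex_singleton hQ i) ⋙ QDb _ ⋙ F.functor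
  obtain ⟨e⟩ := exists_iso_unit R F
  let e₁ : (stalkKb R i).obj ((quotientKb _).obj (𝟙_ _)) ≅ unitKb k :=
    (quotientKb _).mapIso (Functor.Monoidal.εIso (mapCb (isRep R) (ModuleCat.isFG k)
      ((evaluation (Paths V) (ModuleCat.{u} k)).obj i) (fun _ h => h.1 i))).symm
  -- Both `F` and the evaluation at `i` factor through the stalk complex at `i`, by `G` and by `QDb`
  -- respectively. The stalk of the unit is `k`, so `G` takes `k` to `F(U)`, which is the unit; two
  -- functors that agree at `k` are isomorphic.
  let θ : G.obj (unitKb k) ≅ (QDb _).obj (unitKb k) :=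
    (G.mapIso e₁).symm ≪≫ τ.app ((quotientKb _).obj (𝟙_ _)) ≪≫
      F.functor.mapIso (Functor.Monoidal.εIso (locDb (isRep R))).symm ≪≫ e ≪≫ (QDbUnitKb k).symm
  obtain ⟨σ, hσ⟩ := exists_natIso_commShift G (QDb _) (shiftGenerates_unitKb k)
    (shiftExceptional_unitKb k) θ
  let ρ : QDb _ ⋙ F.functor ≅ QDb _ ⋙ (evalTensorFunctor R i).functor :=
    τ.symm ≪≫ Functor.isoWhiskerLeft (stalkKb R i) σ ≪≫
      (liftDbIso (isRep R) (evalKb (isRep R) (ModuleCat.isFG k) i (fun _ h => h.1 i))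
        (isZero_evalKb _ _ _ _)).symm
  have hρ : NatTrans.CommShift ρ.hom ℤ := by
    have : NatTrans.CommShift (τ.inv ≫ Functor.whiskerLeft (stalkKb R i) σ.hom ≫
      (liftDbIso (isRep R) (evalKb (isRep R) (ModuleCat.isFG k) i (fun _ h => h.1 i))
        (isZero_evalKb _ _ _ _)).inv) ℤ := inferInstance
    exact this
  obtain ⟨ρ', hρ'⟩ := exists_natIso_of_QDb _ ρ hρ
  exact ⟨i, ⟨TensorFunctor.isoMk ρ' hρ'⟩⟩

/-- The point given by a vertex. -/
def vertexPoint (i : Paths V) : Points k (DRep R) (DVect k) :=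
  Quotient.mk (isIsomorphicSetoid _) (evalTensorFunctor R i)

lemma nonempty_vertexPoint_iso (i : Paths V) :
    Nonempty ((vertexPoint R i).functor ≅ evalTensorFunctor R i) :=
  Quotient.exact (s := isIsomorphicSetoid _) (Quotient.out_eq _)

include hQ in
lemma vertexPoint_surjective [Finite V] : Function.Surjective (vertexPoint R) := by
  intro x
  obtain ⟨i, ⟨e⟩⟩ := exists_iso_evalTensorFunctor R hQ x.functor
  refine ⟨i, ?_⟩
  exact (Quotient.sound (s := isIsomorphicSetoid _) ⟨e.symm⟩).trans (Quotient.out_eq x)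

include hQ in
lemma finite_points [Finite V] : Finite (Points k (DRep R) (DVect k)) :=
  have : Finite (Paths V) := inferInstanceAs (Finite V)
  Finite.of_surjective _ (vertexPoint_surjective R hQ)

end Classification

end BoundedDerived

namespace BoundedDerived

open HomologicalComplex Pretriangulated TensorTriangulated

/-! ### Endomorphisms of points, and transformations along paths -/

section Endomorphisms

variable {k : Type u} [Field k] {V : Type v} [Quiver.{w} V]
  (R : Relations k V) [IsTensor R]
  (hQ : ∀ (a : V) (p : Quiver.Path a a), p = Quiver.Path.nil)
  (F : TensorFunctor k (DRep R) (DVect k))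

include hQ in
/-- The endomorphisms of a tensor functor are scalars. -/
lemma end_eq_smul [Finite V] (a : F ⟶ F) : ∃ c : k, a = c • 𝟙 F := by
  obtain ⟨i, hi⟩ := exists_vertex R hQ F
  obtain ⟨τ, hτ, hnat⟩ := exists_stalkKb_iso R hQ F.functor i hi
  let J := simpleKb R i (pathConvex_singleton hQ i) ⋙ QDb _
  obtain ⟨e⟩ := exists_iso_unit R F
  let e₁ : (stalkKb R i).obj ((quotientKb _).obj (𝟙_ _)) ≅ unitKb k :=
    (quotientKb _).mapIso (Functor.Monoidal.εIso (mapCb (isRep R) (ModuleCat.isFG k)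
      ((evaluation (Paths V) (ModuleCat.{u} k)).obj i) (fun _ h => h.1 i))).symm
  let θ : F.functor.obj (simpleDb R hQ i) ≅ 𝟙_ (DVect k) :=
    ((J ⋙ F.functor).mapIso e₁).symm ≪≫ τ.app ((quotientKb _).obj (𝟙_ _)) ≪≫
      F.functor.mapIso (Functor.Monoidal.εIso (locDb (isRep R))).symm ≪≫ e
  -- `F` takes `S_i` to the unit, as it does `U`, so `a` acts there by a scalar `c`. The difference
  -- `b` of `a` and `c` vanishes at `S_i`, hence on all complexes concentrated at `i`, hence
  -- everywhere by the isomorphism `τ`, which commutes with `b`.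
  obtain ⟨c, hc⟩ := unit_end_eq_smul (θ.inv ≫ a.1.app (simpleDb R hQ i) ≫ θ.hom)
  refine ⟨c, ?_⟩
  let b : F ⟶ F := a - c • 𝟙 F
  have hb (X : DRep R) : b.1.app X = a.1.app X - c • 𝟙 _ := rfl
  have hb0 : b.1.app (simpleDb R hQ i) = 0 := by
    rw [hb, ← cancel_epi θ.inv, ← cancel_mono θ.hom]
    simp [Preadditive.comp_sub, Preadditive.sub_comp, hc]
  have hbc : NatTrans.CommShift b.1 ℤ := b.2
  have h1 : Functor.whiskerLeft J b.1 = 0 := by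
    refine (shiftGenerates_unitKb k).natTrans_app_eq (fun n => ?_)
    have := NatTrans.app_shift (Functor.whiskerLeft J b.1) n (unitKb k)
    rw [this, Functor.whiskerLeft_app]
    have h0 : b.1.app (J.obj (unitKb k)) = 0 := hb0
    rw [h0]
    simp
  have h2 (K : Kb (isRep R)) : b.1.app ((QDb _).obj K) = 0 := by
    have h3 : b.1.app (J.obj ((stalkKb R i).obj K)) = 0 := NatTrans.congr_app h1 _
    have h4 := hnat b.1 K
    rw [← cancel_epi (τ.hom.app K), comp_zero]
    refine h4.trans ?_
    exact (congrArg (· ≫ τ.hom.app K) h3).trans zero_comp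
  have h5 : b = 0 := by
    apply Subtype.ext
    ext X
    let e := (QDb _).objObjPreimageIso X
    rw [← cancel_epi (F.functor.map e.hom), b.1.naturality, h2, zero_comp]
    exact comp_zero.symm
  exact sub_eq_zero.1 h5

lemma isZero_eval_simple {i j : Paths V} (hij : j ≠ i) :
    IsZero ((evalTensorFunctor R i).functor.obj (simpleDb R hQ j)) := by
  let P := ModuleCat.isFG.{u} k
  refine IsZero.of_iso ?_ ((liftDbIso (isRep R) (evalKb (isRep R) P i (fun _ h => h.1 i))
        (isZero_evalKb _ _ _ _)).app _)
  let K : Cb P := (mapCb _ _ ((evaluation (Paths V) (ModuleCat.{u} k)).obj i)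
    (fun _ h => h.1 i)).obj ((mapCb P (isRep R) (simple j (pathConvex_singleton hQ j))
    (isRep_simple R j (pathConvex_singleton hQ j))).obj (𝟙_ (Cb P)))
  refine isZero_locDb_obj P (K := K) ?_
  rw [IsZero.iff_id_eq_zero]
  ext n : 1
  exact (isZero_trunc_obj (pathConvex_singleton hQ j) _ (fun h => hij h.symm)).eq_of_src _ _

/-- Otherwise `F` would kill all simple representations, and by dévissage the unit. -/
lemma not_isZero_simple {i : Paths V} [Finite V]
    (h : ∀ j, j ≠ i → IsZero (F.functor.obj (simpleDb R hQ j))) :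
    ¬ IsZero (F.functor.obj (simpleDb R hQ i)) := by
  intro hi
  obtain ⟨α, hα, _⟩ := exists_truncKb_univ_iso R
  obtain ⟨e⟩ := exists_iso_unit R F
  have h1 := isZero_truncKb R hQ Set.univ pathConvex_univ
    (fun j _ => by
      by_cases hj : j = i
      · subst hj; exact hi
      · exact h j hj) ((quotientKb _).obj (𝟙_ _))
  have h2 : IsZero (F.functor.obj ((locDb _).obj (𝟙_ _))) := h1.of_iso
    ((QDb _ ⋙ F.functor).mapIso ((asIso α).app ((quotientKb _).obj (𝟙_ _)))).symm
  have h3 : IsZero (F.functor.obj (𝟙_ (DRep R))) :=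
    h2.of_iso (F.functor.mapIso (Functor.Monoidal.εIso (locDb (isRep R))))
  exact not_isZero_unit k (h3.of_iso e.symm)

/-- A path induces a transformation between the tensor functors given by its ends, which does not
vanish on the unit object. -/
lemma exists_hom_of_path {i j : Paths V} (p : i ⟶ j) :
    ∃ h : evalTensorFunctor R i ⟶ evalTensorFunctor R j, h.1.app (𝟙_ (DRep R)) ≠ 0 := by
  let P := ModuleCat.isFG.{u} k
  let γ : stalkKb R i ⟶ stalkKb R j := mapKbNat (isRep R) P (fun _ h => h.1 i) (fun _ h => h.1 j)
    ((evaluation (Paths V) (ModuleCat.{u} k)).map p)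
  let l (i : Paths V) := liftDbIso (isRep R) (evalKb (isRep R) P i (fun _ h => h.1 i))
        (isZero_evalKb _ _ _ _)
  let δ : QDb _ ⋙ (evalTensorFunctor R i).functor ⟶ QDb _ ⋙ (evalTensorFunctor R j).functor :=
    (l i).hom ≫ Functor.whiskerRight γ (QDb P) ≫ (l j).inv
  have hδ : NatTrans.CommShift δ ℤ := inferInstanceAs (NatTrans.CommShift
    ((l i).hom ≫ Functor.whiskerRight γ (QDb P) ≫ (l j).inv) ℤ)
  obtain ⟨τ, hτ, h⟩ := exists_natTrans_of_QDb _ δ hδ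
  refine ⟨⟨τ, hτ⟩, fun h0 => ?_⟩
  let K : Cb (isRep R) := 𝟙_ _
  -- Paths act on the unit representation by the identity, so the transformation is invertible at
  -- the unit complex.
  have hγ : IsIso (γ.app ((quotientKb _).obj K)) := by
    let g : (mapCb (isRep R) P ((evaluation (Paths V) (ModuleCat.{u} k)).obj i)
      (fun _ h => h.1 i)).obj K ⟶ (mapCb (isRep R) P ((evaluation (Paths V) (ModuleCat.{u} k)).obj j)
      (fun _ h => h.1 j)).obj K := ObjectProperty.homMk ((NatTrans.mapHomologicalComplex
        ((evaluation (Paths V) (ModuleCat.{u} k)).map p) (.up ℤ)).app K.obj)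
    have hg : IsIso ((bounded P).ι.map g) := by
      have (n : ℤ) : IsIso (((bounded P).ι.map g).f n) := by
        change IsIso ((K.obj.X n).map p)
        by_cases hn : n = 0
        · subst hn
          let e : K.obj.X 0 ≅ 𝟙_ (BigRep k V) := singleObjXSelf (.up ℤ) 0 _
          have h1 : (K.obj.X 0).map p ≫ e.hom.app j = e.hom.app i ≫ 𝟙 _ := e.hom.naturality p
          have h2 : (K.obj.X 0).map p = e.hom.app i ≫ e.inv.app j := by
            rw [← cancel_mono (e.hom.app j), h1]
            simp
          rw [h2]
          infer_instance
        · have h1 : IsZero (K.obj.X n) := isZero_single_obj_X (.up ℤ) 0 _ n hn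
          have h2 (x : Paths V) : IsZero ((K.obj.X n).obj x) :=
            ((evaluation (Paths V) (ModuleCat.{u} k)).obj x).map_isZero h1
          exact ⟨0, (h2 _).eq_of_src _ _, (h2 _).eq_of_src _ _⟩
      exact HomologicalComplex.Hom.isIso_of_components _
    have hg' : IsIso g := isIso_of_reflects_iso g (bounded P).ι
    exact inferInstanceAs (IsIso ((quotientKb P).map g))
  have hiso : IsIso (τ.app ((QDb _).obj ((quotientKb _).obj K))) := by
    have h1 : τ.app ((QDb _).obj ((quotientKb _).obj K)) = δ.app ((quotientKb _).obj K) :=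
      NatTrans.congr_app h _
    rw [h1]
    exact inferInstanceAs (IsIso ((l i).hom.app _ ≫ (QDb P).map (γ.app ((quotientKb _).obj K)) ≫
      (l j).inv.app _))
  have hiso' : IsIso (τ.app (𝟙_ (DRep R))) :=
    (NatTrans.isIso_app_iff_of_iso τ (Functor.Monoidal.εIso (locDb (isRep R)))).2 hiso
  obtain ⟨e⟩ := exists_iso_unit R (evalTensorFunctor R j)
  -- A zero component which is invertible would force the unit of the target to be zero.
  refine not_isZero_unit k (IsZero.of_iso ?_ e.symm)
  have h3 : IsIso (0 : (evalTensorFunctor R i).functor.obj (𝟙_ (DRep R)) ⟶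
      (evalTensorFunctor R j).functor.obj (𝟙_ (DRep R))) := by
    rw [← h0]
    exact hiso'
  rw [IsZero.iff_id_eq_zero, ← IsIso.inv_hom_id (0 : (evalTensorFunctor R i).functor.obj
    (𝟙_ (DRep R)) ⟶ (evalTensorFunctor R j).functor.obj (𝟙_ (DRep R))), comp_zero]

end Endomorphisms

end BoundedDerived

namespace BoundedDerived

open HomologicalComplex Pretriangulated TensorTriangulated

/-! ### Endomorphisms of the unit are determined at the vertices -/

section UnitEnd

variable {k : Type u} [Field k] {V : Type v} [Quiver.{w} V] (R : Relations k V)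

/-- Quotients inherit finite dimension and relations. Hence the truncation `truncGE`, a quotient of
the complex, stays among the complexes of representations. -/
lemma isRep_of_epi {M N : BigRep k V} (f : M ⟶ N) [Epi f] (hM : isRep R M) : isRep R N := by
  have hf (i : Paths V) : Epi (f.app i) := inferInstance
  refine ⟨fun i => ?_, fun a b r hr => ?_⟩
  · have : Module.Finite k (M.obj i) := hM.1 i
    exact Module.Finite.of_surjective (f.app i).hom ((ModuleCat.epi_iff_surjective _).1 (hf i))
  · rw [← cancel_epi (f.app a), ← act_naturality, hM.2 a b r hr, zero_comp, comp_zero]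

lemma bounded_truncGE {L : CochainComplex (BigRep k V) ℤ} (hL : bounded (isRep R) L) (n : ℤ) :
    bounded (isRep R) (L.truncGE n) := by
  obtain ⟨⟨a, b, hab⟩, hL⟩ := hL
  have (m : ℤ) : Epi ((L.πTruncGE n).f m) :=
    inferInstanceAs (Epi ((HomologicalComplex.πTruncGE L _).f m))
  exact ⟨⟨a, b, fun m hm => IsZero.of_epi ((L.πTruncGE n).f m) (hab m hm)⟩,
    fun m => isRep_of_epi R ((L.πTruncGE n).f m) (hL m)⟩

/-- The truncation of a bounded complex of representations. -/
def truncGECb (L : Cb (isRep R)) (n : ℤ) : Cb (isRep R) :=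
  ⟨L.obj.truncGE n, bounded_truncGE R L.property n⟩

/-- The projection to the truncation. -/
def πTruncGECb (L : Cb (isRep R)) (n : ℤ) : L ⟶ truncGECb R L n :=
  ObjectProperty.homMk (L.obj.πTruncGE n)

/-- A morphism of complexes from a representation to a complex in non-negative degrees vanishes if
it is pointwise homotopic to zero. -/
lemma eq_zero_of_stalkKb {U L : Cb (isRep R)} (g : U ⟶ L) (hU : ∀ n ≠ 0, IsZero (U.obj.X n))
    (hL : IsZero (L.obj.X (-1)))
    (h : ∀ i, (stalkKb R i).map ((quotientKb _).map g) = 0) : g = 0 := by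
  ext n : 2
  by_cases hn : n = 0
  · subst hn
    ext i : 2
    have h1 : (HomotopyCategory.quotient (ModuleCat.{u} k) (.up ℤ)).map ((evalC i).map g.hom) = 0 :=
      congrArg (fun f => f.hom) (h i)
    have H := HomotopyCategory.homotopyOfEq ((evalC i).map g.hom) 0
      (h1.trans (Functor.map_zero _ _ _).symm)
    have h2 := H.comm 0
    have h3 : dNext 0 H.hom = 0 := by
      -- Both terms of the homotopy vanish in degree `0`: one passes through `U` in degree `1`, the
      -- other through `L` in degree `-1`.
      rw [dNext_eq H.hom (show (ComplexShape.up ℤ).Rel 0 1 by simp)]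
      have : ((evalC i).obj U.obj).d 0 1 = 0 :=
        (((evaluation (Paths V) (ModuleCat.{u} k)).obj i).map_isZero (hU 1 (by simp))).eq_of_tgt _ _
      rw [this, zero_comp]
    have h4 : prevD 0 H.hom = 0 := by
      rw [prevD_eq H.hom (show (ComplexShape.up ℤ).Rel (-1) 0 by simp)]
      have : H.hom 0 (-1) = 0 :=
        (((evaluation (Paths V) (ModuleCat.{u} k)).obj i).map_isZero hL).eq_of_tgt _ _
      rw [this, zero_comp]
    rw [h3, h4] at h2
    rw [zero_add, zero_add] at h2
    exact h2
  · exact (hU n hn).eq_of_src _ _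

variable [IsTensor R]

/-- For vector spaces `QDb` is faithful, so vanishing in the derived category is vanishing up to
homotopy. -/
lemma QDb_map_eq_zero_of_stalkKb {K : Kb (isRep R)} {i : Paths V} {L : Kb (isRep R)} (g : K ⟶ L)
    (h : (evalTensorFunctor R i).functor.map ((QDb _).map g) = 0) : (stalkKb R i).map g = 0 := by
  let P := ModuleCat.isFG.{u} k
  let l := liftDbIso (isRep R) (evalKb (isRep R) P i (fun _ h => h.1 i)) (isZero_evalKb _ _ _ _)
  have h1 := l.hom.naturality g
  have h2 : (QDb P).map ((stalkKb R i).map g) = 0 := by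
    rw [← cancel_epi (l.hom.app K), comp_zero]
    refine h1.symm.trans ?_
    exact (congrArg (· ≫ l.hom.app L) h).trans zero_comp
  exact (QDb P).map_injective (h2.trans ((QDb P).map_zero _ _).symm)

lemma unitCb_isZero {n : ℤ} (hn : n ≠ 0) : IsZero ((𝟙_ (Cb (isRep R))).obj.X n) :=
  isZero_single_obj_X (.up ℤ) 0 (𝟙_ (BigRep k V)) n hn

/-- Represent `ψ` by a roof `U ⟶ L ⟵ U` whose second leg `s` is a quasi-isomorphism. Then `L` has
cohomology only in degree `0`, so it may be replaced by its truncation, which lives in non-negative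
degrees. The composite of `f` with the projection is null-homotopic at every vertex, and there is no
room for homotopies, so it is zero as a chain map. -/
lemma hom_unit_eq_zero (ψ : (QDb (isRep R)).obj ((quotientKb _).obj (𝟙_ _)) ⟶
      (QDb _).obj ((quotientKb _).obj (𝟙_ _)))
    (hψ : ∀ i, (evalTensorFunctor R i).functor.map ψ = 0) : ψ = 0 := by
  obtain ⟨z, hz⟩ := Localization.exists_leftFraction (QDb (isRep R)) (acyclic _).trW ψ
  have hz1 := z.map_comp_map_s (QDb (isRep R)) (Localization.inverts _ _)
  rw [← hz] at hz1
  obtain ⟨f, s, hs⟩ := z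
  rename_i Y
  obtain ⟨L, rfl⟩ := quotientKb_obj_surjective _ Y
  obtain ⟨f, rfl⟩ := (quotientKb _).map_surjective f
  obtain ⟨s, rfl⟩ := (quotientKb _).map_surjective s
  have hs' : QuasiIso s.hom := (qis_iff _ s).2 hs
  have hUL (n : ℤ) (hn : n ≠ 0) : L.obj.ExactAt n := by
    rw [← exactAt_iff_of_quasiIsoAt s.hom n]
    exact ExactAt.of_isZero (unitCb_isZero R hn)
  have hGE : L.obj.IsGE 0 := by
    rw [CochainComplex.isGE_iff]
    exact fun i hi => hUL i (by omega)
  let π := πTruncGECb R L 0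
  have hπ : IsIso ((QDb _).map ((quotientKb _).map π)) := by
    refine Localization.inverts (QDb (isRep R)) (acyclic _).trW _ ((qis_iff _ π).1 ?_)
    exact inferInstanceAs (QuasiIso (L.obj.πTruncGE 0))
  have hs2 : IsIso ((QDb (isRep R)).map ((quotientKb _).map s)) :=
    Localization.inverts (QDb (isRep R)) (acyclic _).trW _ hs
  have hπ' := IsIso.mono_of_iso ((QDb _).map ((quotientKb _).map π))
  have hs3 := IsIso.mono_of_iso ((QDb (isRep R)).map ((quotientKb _).map s))
  have hf0 : f ≫ π = 0 := by
    refine eq_zero_of_stalkKb R (f ≫ π) (fun n hn => unitCb_isZero R hn) ?_ (fun i => ?_)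
    · have : (L.obj.truncGE 0).IsStrictlyGE 0 := inferInstance
      exact CochainComplex.isZero_of_isStrictlyGE (L.obj.truncGE 0) 0 (-1) (by omega)
    · rw [Functor.map_comp, Functor.map_comp]
      rw [QDb_map_eq_zero_of_stalkKb R ((quotientKb _).map f), zero_comp]
      have h3 : (QDb (isRep R)).map ((quotientKb _).map f) =
        ψ ≫ (QDb (isRep R)).map ((quotientKb _).map s) := hz1.symm
      rw [h3, Functor.map_comp, hψ i, zero_comp]
  have hf1 : (QDb (isRep R)).map ((quotientKb _).map f) = 0 := by
    rw [← cancel_mono ((QDb (isRep R)).map ((quotientKb _).map π)), zero_comp, ← Functor.map_comp,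
      ← Functor.map_comp, hf0, Functor.map_zero, Functor.map_zero]
  rw [← cancel_mono ((QDb (isRep R)).map ((quotientKb _).map s)), zero_comp]
  exact hz1.trans hf1

/-- The endomorphisms of the unit object are determined by their values at the vertices. -/
lemma end_unit_eq_zero (φ : 𝟙_ (DRep R) ⟶ 𝟙_ (DRep R))
    (h : ∀ i, (evalTensorFunctor R i).functor.map φ = 0) : φ = 0 := by
  let e := Functor.Monoidal.εIso (locDb (isRep R))
  have h0 : e.inv ≫ φ ≫ e.hom = 0 := by
    refine hom_unit_eq_zero R _ (fun i => ?_)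
    have : (evalTensorFunctor R i).functor.map (e.inv ≫ φ ≫ e.hom) =
        (evalTensorFunctor R i).functor.map e.inv ≫
        (evalTensorFunctor R i).functor.map φ ≫ (evalTensorFunctor R i).functor.map e.hom :=
      ((evalTensorFunctor R i).functor.map_comp _ _).trans
        (congrArg (_ ≫ ·) ((evalTensorFunctor R i).functor.map_comp _ _))
    refine this.trans ?_
    rw [h i, zero_comp, comp_zero]
    rfl
  rw [← cancel_epi e.inv, ← cancel_mono e.hom, Category.assoc, h0, comp_zero, zero_comp]

end UnitEnd

end BoundedDerived

namespace BoundedDerived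

open HomologicalComplex Pretriangulated TensorTriangulated

/-! ### Endomorphisms of the unit from functions constant along paths -/

section UnitEnd

variable {k : Type u} [Field k] {V : Type v} [Quiver.{w} V] (R : Relations k V)

/-- The endomorphism of the unit representation given by scalars which are constant along paths. -/
def unitScalars (c : Paths V → k) (hc : ∀ (i j : Paths V) (_ : i ⟶ j), c i = c j) :
    𝟙_ (BigRep k V) ⟶ 𝟙_ (BigRep k V) where
  app i := c i • 𝟙 (𝟙_ (ModuleCat.{u} k))
  naturality i j p := by
    rw [hc i j p]
    exact (Category.id_comp _).trans (Category.comp_id _).symm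

/-- The same endomorphism as an endomorphism of the unit complex. -/
def unitScalarsCb [IsTensor R] (c : Paths V → k) (hc : ∀ (i j : Paths V) (_ : i ⟶ j), c i = c j) :
    𝟙_ (Cb (isRep R)) ⟶ 𝟙_ (Cb (isRep R)) :=
  ObjectProperty.homMk ((single (BigRep k V) (.up ℤ) 0).map (unitScalars c hc))

variable [IsTensor R]

lemma mapCb_unitScalarsCb (c : Paths V → k) (hc : ∀ (i j : Paths V) (_ : i ⟶ j), c i = c j)
    (i : Paths V) :
    (mapCb (isRep R) (ModuleCat.isFG.{u} k) ((evaluation (Paths V) (ModuleCat.{u} k)).obj i)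
      (fun _ h => h.1 i)).map (unitScalarsCb R c hc) = c i • 𝟙 _ := by
  ext n : 2
  change (((single (BigRep k V) (.up ℤ) 0).map (unitScalars c hc)).f n).app i =
    c i • 𝟙 ((((single (BigRep k V) (.up ℤ) 0).obj (𝟙_ (BigRep k V))).X n).obj i)
  by_cases hn : n = 0
  · subst hn
    rw [single_map_f_self, NatTrans.comp_app, NatTrans.comp_app]
    change _ ≫ (c i • 𝟙 (𝟙_ (ModuleCat.{u} k))) ≫ _ = _
    rw [Linear.smul_comp, Linear.comp_smul]
    congr 1
  · exact (((evaluation (Paths V) (ModuleCat.{u} k)).obj i).map_isZero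
      (isZero_single_obj_X (.up ℤ) 0 (𝟙_ (BigRep k V)) n hn)).eq_of_src _ _

/-- Scalars which are constant along paths are the values of an endomorphism of the unit
object. -/
lemma exists_end_unit (c : Paths V → k) (hc : ∀ (i j : Paths V) (_ : i ⟶ j), c i = c j) :
    ∃ φ : 𝟙_ (DRep R) ⟶ 𝟙_ (DRep R),
      ∀ i, (evalTensorFunctor R i).functor.map φ = c i • 𝟙 _ := by
  let e := Functor.Monoidal.εIso (locDb (isRep R))
  refine ⟨e.hom ≫ (locDb _).map (unitScalarsCb R c hc) ≫ e.inv, fun i => ?_⟩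
  let E := (evalTensorFunctor R i).functor
  have h1 : E.map ((locDb _).map (unitScalarsCb R c hc)) = c i • 𝟙 _ := by
    let P := ModuleCat.isFG.{u} k
    let l := locDbEvalDb (isRep R) P i (fun _ h => h.1 i)
    have h2 := l.hom.naturality (unitScalarsCb R c hc)
    refine (cancel_mono (l.hom.app (𝟙_ _))).1 (h2.trans ?_)
    have h3 : (locDb P).map (c i • 𝟙 ((mapCb (isRep R) P
        ((evaluation (Paths V) (ModuleCat.{u} k)).obj i) (fun _ h => h.1 i)).obj (𝟙_ _))) =
        c i • 𝟙 _ := by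
      change (QDb P).map ((quotientKb P).map _) = _
      rw [Functor.map_smul, Functor.map_smul, CategoryTheory.Functor.map_id, CategoryTheory.Functor.map_id]
      rfl
    refine (congrArg (fun f => l.hom.app (𝟙_ _) ≫ (locDb P).map f)
      (mapCb_unitScalarsCb R c hc i)).trans ?_
    refine (congrArg (l.hom.app (𝟙_ _) ≫ ·) h3).trans ?_
    refine (Linear.comp_smul _ _ _ _ _ _).trans (Eq.trans ?_ (Linear.smul_comp _ _ _ _ _ _).symm)
    exact congrArg (c i • ·) ((Category.comp_id _).trans (Category.id_comp _).symm)
  refine (E.map_comp _ _).trans ?_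
  refine (congrArg (_ ≫ ·) (E.map_comp _ _)).trans ?_
  rw [h1, Linear.smul_comp, Linear.comp_smul]
  congr 1
  refine (congrArg (_ ≫ ·) (Category.id_comp _)).trans ?_
  rw [← E.map_comp, e.hom_inv_id, E.map_id]

end UnitEnd

end BoundedDerived

namespace BoundedDerived

open HomologicalComplex Pretriangulated TensorTriangulated

/-! ### The endomorphism ring of the unit as functions on components -/

section UnitScalars

lemma smul_id_injective {k : Type*} [Field k] {S : Type*} [Category* S] [Preadditive S]
    [Linear k S] {X : S} (hX : ¬ IsZero X) {c c' : k} (h : c • 𝟙 X = c' • 𝟙 X) : c = c' := by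
  by_contra hn
  refine hX ((IsZero.iff_id_eq_zero _).2 ?_)
  rw [← sub_eq_zero, ← sub_smul] at h
  exact (smul_eq_zero.1 h).resolve_left (sub_ne_zero.2 hn)

variable {k : Type u} [Field k] {V : Type v} [Quiver.{w} V] (R : Relations k V) [IsTensor R]

section

variable (F : TensorFunctor k (DRep R) (DVect k))

lemma not_isZero_map_unit : ¬ IsZero (F.functor.obj (𝟙_ (DRep R))) := by
  obtain ⟨e⟩ := exists_iso_unit R F
  exact fun h => not_isZero_unit k (h.of_iso e.symm)

lemma exists_map_eq_smul (φ : End (𝟙_ (DRep R))) :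
    ∃ c : k, F.functor.map φ = c • 𝟙 (F.functor.obj (𝟙_ (DRep R))) := by
  obtain ⟨e⟩ := exists_iso_unit R F
  obtain ⟨c, hc⟩ := unit_end_eq_smul (e.inv ≫ F.functor.map φ ≫ e.hom)
  refine ⟨c, ?_⟩
  rw [← cancel_epi e.inv, ← cancel_mono e.hom, Category.assoc, hc]
  simp

/-- The scalar by which an endomorphism of the unit object acts on the image of the unit object. -/
def unitScalar (φ : End (𝟙_ (DRep R))) : k := (exists_map_eq_smul R F φ).choose

lemma map_eq_unitScalar (φ : End (𝟙_ (DRep R))) :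
    F.functor.map φ = unitScalar R F φ • 𝟙 (F.functor.obj (𝟙_ (DRep R))) :=
  (exists_map_eq_smul R F φ).choose_spec

variable {F} in
lemma unitScalar_eq {φ : End (𝟙_ (DRep R))} {c : k}
    (h : F.functor.map φ = c • 𝟙 (F.functor.obj (𝟙_ (DRep R)))) : unitScalar R F φ = c :=
  smul_id_injective (not_isZero_map_unit R F) ((map_eq_unitScalar R F φ).symm.trans h)

lemma unitScalar_add (φ ψ : End (𝟙_ (DRep R))) :
    unitScalar R F (φ + ψ) = unitScalar R F φ + unitScalar R F ψ := by
  refine unitScalar_eq R (F.functor.map_add.trans ?_)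
  rw [map_eq_unitScalar, map_eq_unitScalar, add_smul]

lemma unitScalar_smul (c : k) (φ : End (𝟙_ (DRep R))) :
    unitScalar R F (c • φ) = c * unitScalar R F φ := by
  refine unitScalar_eq R ((F.functor.map_smul c φ).trans ?_)
  rw [map_eq_unitScalar, smul_smul]

lemma unitScalar_one : unitScalar R F 1 = 1 :=
  unitScalar_eq R ((F.functor.map_id _).trans (one_smul k _).symm)

lemma unitScalar_mul (φ ψ : End (𝟙_ (DRep R))) :
    unitScalar R F (φ * ψ) = unitScalar R F φ * unitScalar R F ψ := by
  refine unitScalar_eq R ((F.functor.map_comp ψ φ).trans ?_)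
  rw [map_eq_unitScalar, map_eq_unitScalar, Linear.comp_smul, Linear.smul_comp,
    Category.id_comp, smul_smul]

/-- The scalars by which the endomorphisms of the unit object act form a homomorphism. -/
def unitScalarHom : End (𝟙_ (DRep R)) →ₐ[k] k :=
  AlgHom.ofLinearMap
    { toFun := unitScalar R F
      map_add' := unitScalar_add R F
      map_smul' := unitScalar_smul R F }
    (unitScalar_one R F) (unitScalar_mul R F)

variable {F} in
-- Naturality of `h` at `φ` says that the two scalars agree after multiplication with the component
-- of `h` at the unit, which is non-zero.
lemma unitScalar_eq_of_hom {G : TensorFunctor k (DRep R) (DVect k)} (h : F ⟶ G)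
    (hh : h.1.app (𝟙_ (DRep R)) ≠ 0) (φ : End (𝟙_ (DRep R))) :
    unitScalar R F φ = unitScalar R G φ := by
  have h1 := h.1.naturality φ
  rw [map_eq_unitScalar, map_eq_unitScalar, Linear.comp_smul, Linear.smul_comp, Category.comp_id,
    Category.id_comp, ← sub_eq_zero, ← sub_smul] at h1
  exact sub_eq_zero.1 ((smul_eq_zero.1 h1).resolve_right hh)

variable {F} in
lemma unitScalar_eq_of_iso {G : TensorFunctor k (DRep R) (DVect k)} (e : F ≅ G)
    (φ : End (𝟙_ (DRep R))) : unitScalar R F φ = unitScalar R G φ := by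
  refine unitScalar_eq_of_hom R e.hom (fun h => not_isZero_map_unit R F ?_) φ
  rw [IsZero.iff_id_eq_zero]
  have h1 : e.hom.1.app (𝟙_ (DRep R)) ≫ e.inv.1.app (𝟙_ (DRep R)) = 𝟙 _ :=
    NatTrans.congr_app (congrArg Subtype.val e.hom_inv_id) _
  rw [← h1, h, zero_comp]

end

/-- A function which is constant along paths is constant on connected components. -/
lemma eq_of_zigzag {c : V → k} (hc : ∀ (i j : Paths V) (_ : i ⟶ j), c i = c j) {i j : V}
    (p : @Quiver.Path (Quiver.Symmetrify V) _ i j) : c i = c j := by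
  induction p with
  | nil => rfl
  | cons p f ih =>
    refine ih.trans ?_
    rcases f with f | f
    · exact hc _ _ (Quiver.Hom.toPath f)
    · exact (hc _ _ (Quiver.Hom.toPath f)).symm

/-- A representative of a connected component. -/
def representative (C : Quiver.WeaklyConnectedComponent V) : V := Quotient.out C

lemma mk_representative (C : Quiver.WeaklyConnectedComponent V) :
    Quiver.WeaklyConnectedComponent.mk (representative C) = C := Quotient.out_eq C

lemma eq_representative {c : V → k} (hc : ∀ (i j : Paths V) (_ : i ⟶ j), c i = c j) (i : V) :
    c (representative (Quiver.WeaklyConnectedComponent.mk i)) = c i := by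
  obtain ⟨p⟩ := (Quiver.WeaklyConnectedComponent.eq _ _).1
    (mk_representative (Quiver.WeaklyConnectedComponent.mk i))
  exact eq_of_zigzag hc p

lemma mk_eq_of_path {i j : V} (p : Quiver.Path i j) :
    Quiver.WeaklyConnectedComponent.mk i = Quiver.WeaklyConnectedComponent.mk j := by
  induction p with
  | nil => rfl
  | cons p f ih =>
    exact ih.trans ((Quiver.WeaklyConnectedComponent.eq _ _).2 ⟨Quiver.Hom.toPath (Sum.inl f)⟩)

lemma unitScalar_eq_of_path (φ : End (𝟙_ (DRep R))) (i j : Paths V) (p : i ⟶ j) :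
    unitScalar R (evalTensorFunctor R i) φ = unitScalar R (evalTensorFunctor R j) φ := by
  obtain ⟨h, hh⟩ := exists_hom_of_path R p
  exact unitScalar_eq_of_hom R h hh φ

/-- The values of the endomorphisms of the unit object at the connected components. -/
def componentScalars : End (𝟙_ (DRep R)) →ₐ[k] (Quiver.WeaklyConnectedComponent V → k) :=
  AlgHom.pi (fun C => unitScalarHom R (evalTensorFunctor R (representative (V := V) C)))

lemma componentScalars_mk (φ : End (𝟙_ (DRep R))) (i : V) :
    componentScalars R φ (Quiver.WeaklyConnectedComponent.mk i) =
      unitScalar R (evalTensorFunctor R i) φ :=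
  eq_representative (c := fun i : V => unitScalar R (evalTensorFunctor R i) φ)
    (unitScalar_eq_of_path R φ) i

/-- Injectivity: the scalar at any vertex is the one of its component, and the scalars at all
vertices determine `φ`. Surjectivity: a function on components is constant along paths. -/
lemma componentScalars_bijective : Function.Bijective (componentScalars R) := by
  refine ⟨(injective_iff_map_eq_zero _).2 (fun φ h => ?_), fun f => ?_⟩
  · refine end_unit_eq_zero R φ (fun i => ?_)
    rw [map_eq_unitScalar]
    have h1 : unitScalar R (evalTensorFunctor R i) φ = 0 :=
      (componentScalars_mk R φ i).symm.trans (congrFun h _)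
    rw [h1, zero_smul]
  · obtain ⟨φ, hφ⟩ := exists_end_unit R (fun i : V => f (Quiver.WeaklyConnectedComponent.mk i))
      (fun _ _ p => congrArg f (mk_eq_of_path (V := V) p))
    refine ⟨φ, funext fun C => ?_⟩
    refine (unitScalar_eq R (hφ (representative (V := V) C))).trans ?_
    exact congrArg f (mk_representative C)

/-- The endomorphisms of the unit object are the functions on the set of connected
components. -/
def componentEquiv : End (𝟙_ (DRep R)) ≃ₐ[k] (Quiver.WeaklyConnectedComponent V → k) :=
  AlgEquiv.ofBijective (componentScalars R) (componentScalars_bijective R)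

end UnitScalars

end BoundedDerived

/-! ### Central elements of the algebra of transformations -/

namespace TensorTriangulated

namespace PointAlgebra

variable {k : Type w} [CommRing k]
  {T : Type u} [Category.{v} T] [Preadditive T] [HasZeroObject T] [HasShift T ℤ]
  [∀ n : ℤ, (shiftFunctor T n).Additive] [Pretriangulated T] [MonoidalCategory T] [Linear k T]
  {S : Type*} [Category* S] [Preadditive S] [HasZeroObject S] [HasShift S ℤ]
  [∀ n : ℤ, (shiftFunctor S n).Additive] [Pretriangulated S] [MonoidalCategory S] [Linear k S]
  [∀ n : ℤ, (shiftFunctor S n).Linear k] [Finite (Points k T S)]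

lemma diagonal_mul_apply (f : ∀ x : Points k T S, (x.functor ⟶ x.functor))
    (a : PointAlgebra k T S) (x y : Points k T S) : (diagonal f * a) x y = f x ≫ a x y := by
  have := Fintype.ofFinite (Points k T S)
  rw [mul_apply, Finset.sum_eq_single x]
  · exact congrArg (· ≫ a x y) (diagonal_self f x)
  · intro z _ hz
    exact (congrArg (· ≫ a z y) (diagonal_ne f hz.symm)).trans zero_comp
  · simp

lemma mul_diagonal_apply (f : ∀ x : Points k T S, (x.functor ⟶ x.functor))
    (a : PointAlgebra k T S) (x y : Points k T S) : (a * diagonal f) x y = a x y ≫ f y := by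
  have := Fintype.ofFinite (Points k T S)
  rw [mul_apply, Finset.sum_eq_single y]
  · exact congrArg (a x y ≫ ·) (diagonal_self f y)
  · intro z _ hz
    exact (congrArg (a x z ≫ ·) (diagonal_ne f hz)).trans comp_zero
  · simp

/-- The diagonal element with given scalar components. -/
def scalar (f : Points k T S → k) : PointAlgebra k T S :=
  diagonal (fun x => f x • 𝟙 x.functor)

lemma scalar_self (f : Points k T S → k) (x : Points k T S) :
    scalar f x x = f x • 𝟙 x.functor := diagonal_self _ _

lemma scalar_ne (f : Points k T S → k) {x y : Points k T S} (h : x ≠ y) :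
    scalar f x y = 0 := diagonal_ne _ h

lemma scalar_mul_apply (f : Points k T S → k) (a : PointAlgebra k T S) (x y : Points k T S) :
    (scalar f * a) x y = f x • a x y := by
  rw [scalar, diagonal_mul_apply, Linear.smul_comp, Category.id_comp]

lemma mul_scalar_apply (f : Points k T S → k) (a : PointAlgebra k T S) (x y : Points k T S) :
    (a * scalar f) x y = f y • a x y := by
  rw [scalar, mul_diagonal_apply, Linear.comp_smul, Category.comp_id]

/-- The diagonal elements whose components are scalars form a subalgebra. -/
def scalars : (Points k T S → k) →ₐ[k] PointAlgebra k T S :=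
  AlgHom.ofLinearMap
    { toFun := scalar
      map_add' := fun f g => by
        ext x y
        by_cases h : x = y
        · subst h
          rw [add_apply, scalar_self, scalar_self, scalar_self, Pi.add_apply, add_smul]
        · rw [add_apply, scalar_ne _ h, scalar_ne _ h, scalar_ne _ h, add_zero]
      map_smul' := fun c f => by
        ext x y
        rw [RingHom.id_apply]
        by_cases h : x = y
        · subst h
          rw [smul_apply, scalar_self, scalar_self, Pi.smul_apply, smul_smul, smul_eq_mul]
        · rw [smul_apply, scalar_ne _ h, scalar_ne _ h, smul_zero] }
    (congrArg diagonal (funext fun x => one_smul k _))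
    (fun f g => by
      ext x y
      refine Eq.trans ?_ (scalar_mul_apply f (scalar g) x y).symm
      change scalar (f * g) x y = _
      by_cases h : x = y
      · subst h
        rw [scalar_self, scalar_self, smul_smul]
        rfl
      · rw [scalar_ne _ h, scalar_ne _ h, smul_zero])

open Classical in
/-- The element with a single component. -/
def single {x y : Points k T S} (h : x.functor ⟶ y.functor) : PointAlgebra k T S :=
  fun x' y' => if e : x = x' ∧ y = y' then eqToHom (e.1 ▸ rfl) ≫ h ≫ eqToHom (e.2 ▸ rfl) else 0

lemma single_self {x y : Points k T S} (h : x.functor ⟶ y.functor) : single h x y = h := by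
  simp [single]

/-- If the endomorphisms of all points are scalars, then the central elements are diagonal with
scalar components which agree at any two points with a non-zero transformation between
them. -/
lemma exists_eq_scalar_of_mem_center (hs : ∀ (x : Points k T S) (a : x.functor ⟶ x.functor),
      ∃ c : k, a = c • 𝟙 x.functor)
    {a : PointAlgebra k T S} (ha : a ∈ Subalgebra.center k (PointAlgebra k T S)) :
    ∃ f : Points k T S → k, a = scalar f ∧
      ∀ (x y : Points k T S) (h : x.functor ⟶ y.functor), f x • h = f y • h := by
  classical
  rw [Subalgebra.mem_center_iff] at ha
  choose f hf using fun x => hs x (a x x)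
  have h1 : a = scalar f := by
    ext x y
    by_cases h : x = y
    · subst h
      rw [scalar_self]
      exact hf x
    -- Commuting with the idempotent of the point `x` removes the entries off the diagonal.
    · have h2 := congrArg (fun b : PointAlgebra k T S => b x y)
        (ha (scalar (Pi.single x (1 : k))))
      refine Eq.trans ?_ (scalar_ne f h).symm
      have h3 := (scalar_mul_apply (Pi.single x (1 : k)) a x y).symm.trans
        (h2.trans (mul_scalar_apply (Pi.single x (1 : k)) a x y))
      rwa [Pi.single_eq_same, Pi.single_eq_of_ne (fun e => h e.symm), one_smul, zero_smul] at h3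
  refine ⟨f, h1, fun x y h => ?_⟩
  -- Commuting with the element whose only entry is `h` compares the scalars at its two ends.
  have h2 := congrArg (fun b : PointAlgebra k T S => b x y) (ha (single h))
  rw [h1] at h2
  have h3 := (scalar_mul_apply f (single h) x y).symm.trans
    (h2.symm.trans (mul_scalar_apply f (single h) x y))
  rwa [single_self] at h3

end PointAlgebra

/-- The left and right unitors agree at the unit. So the scalar by which `F(Φ)` acts can be read off
from `F(φ)`. -/
lemma unitAction_unit {T : Type u} [Category.{v} T] [MonoidalCategory T] (φ : End (𝟙_ T)) :
    (unitAction φ).app (𝟙_ T) = φ := by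
  rw [unitAction_app, id_whiskerLeft, unitors_equal, unitors_inv_equal]
  simp

section UnitAction

variable {k : Type w} [CommRing k]
  {T : Type u} [Category.{v} T] [Preadditive T] [HasZeroObject T] [HasShift T ℤ]
  [∀ n : ℤ, (shiftFunctor T n).Additive] [Pretriangulated T] [MonoidalCategory T] [Linear k T]
  [TensorShift T]
  {S : Type*} [Category* S] [Preadditive S] [HasZeroObject S] [HasShift S ℤ]
  [∀ n : ℤ, (shiftFunctor S n).Additive] [Pretriangulated S] [MonoidalCategory S] [Linear k S]
  [∀ n : ℤ, (shiftFunctor S n).Linear k]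

lemma TensorFunctor.mapUnitAction_comp {F G : TensorFunctor k T S} (b : F ⟶ G) (φ : End (𝟙_ T)) :
    F.mapUnitAction φ ≫ b = b ≫ G.mapUnitAction φ :=
  Subtype.ext (NatTrans.ext (funext fun _ => b.1.naturality _))

/-- Every entry of `b` is natural with respect to the components of `Φ`. -/
lemma unitToPointAlgebra_mem_center [Finite (Points k T S)] (φ : End (𝟙_ T)) :
    unitToPointAlgebra k S φ ∈ Subalgebra.center k (PointAlgebra k T S) := by
  rw [Subalgebra.mem_center_iff]
  intro b
  ext x y
  let f (x : Points k T S) := x.functor.mapUnitAction φ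
  exact (PointAlgebra.mul_diagonal_apply f b x y).trans
    ((TensorFunctor.mapUnitAction_comp (b x y) φ).symm.trans
      (PointAlgebra.diagonal_mul_apply f b x y).symm)

end UnitAction

end TensorTriangulated

namespace BoundedDerived

open HomologicalComplex Pretriangulated TensorTriangulated

/-! ### The center is the endomorphism ring of the unit -/

section Center

variable {k : Type u} [Field k] {V : Type v} [Quiver.{w} V] (R : Relations k V) [IsTensor R]

lemma smul_id_functor_injective (F : TensorFunctor k (DRep R) (DVect k)) {c c' : k}
    (h : c • 𝟙 F = c' • 𝟙 F) : c = c' :=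
  smul_id_injective (not_isZero_map_unit R F)
    (congrArg (fun a : F ⟶ F => a.1.app (𝟙_ (DRep R))) h)

lemma unitScalar_vertexPoint (i : Paths V) (φ : End (𝟙_ (DRep R))) :
    unitScalar R (vertexPoint R i).functor φ = unitScalar R (evalTensorFunctor R i) φ := by
  obtain ⟨e⟩ := nonempty_vertexPoint_iso R i
  exact unitScalar_eq_of_iso R e φ

/-- A path induces a non-zero transformation between the points given by its ends. -/
lemma exists_hom_vertexPoint {i j : Paths V} (p : i ⟶ j) :
    ∃ h : (vertexPoint R i).functor ⟶ (vertexPoint R j).functor, h ≠ 0 := by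
  obtain ⟨h, hh⟩ := exists_hom_of_path R p
  obtain ⟨e⟩ := nonempty_vertexPoint_iso R i
  obtain ⟨e'⟩ := nonempty_vertexPoint_iso R j
  refine ⟨e.hom ≫ h ≫ e'.inv, fun h0 => hh ?_⟩
  have h1 : h = 0 := by
    rw [← cancel_epi e.hom, ← cancel_mono e'.inv, Category.assoc, h0, comp_zero, zero_comp]
  rw [h1]
  rfl

variable (hQ : ∀ (a : V) (p : Quiver.Path a a), p = Quiver.Path.nil) [Finite V]

include hQ in
-- Endomorphisms of `F` are scalars, so it suffices to look at the unit, where `Φ` is `φ`.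
lemma mapUnitAction_eq_smul (F : TensorFunctor k (DRep R) (DVect k)) (φ : End (𝟙_ (DRep R))) :
    F.mapUnitAction φ = unitScalar R F φ • 𝟙 F := by
  obtain ⟨c, hc⟩ := end_eq_smul R hQ F (F.mapUnitAction φ)
  rw [hc]
  congr 1
  refine (unitScalar_eq R ?_).symm
  have h1 : F.functor.map ((unitAction φ).app (𝟙_ (DRep R))) = c • 𝟙 _ :=
    congrArg (fun a : F ⟶ F => a.1.app (𝟙_ (DRep R))) hc
  rwa [unitAction_unit] at h1

variable [Finite (Points k (DRep R) (DVect k))]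

/-- The map from the endomorphisms of the unit object to the algebra of transformations between
points, as a homomorphism. -/
def unitToScalars : End (𝟙_ (DRep R)) →ₐ[k] PointAlgebra k (DRep R) (DVect k) :=
  PointAlgebra.scalars.comp (AlgHom.pi (fun x => unitScalarHom R x.functor))

lemma unitToScalars_apply (φ : End (𝟙_ (DRep R))) :
    unitToScalars R φ = PointAlgebra.scalar (fun x => unitScalar R x.functor φ) := rfl

include hQ in
lemma unitToPointAlgebra_eq (φ : End (𝟙_ (DRep R))) :
    unitToPointAlgebra k (DVect k) φ = unitToScalars R φ :=
  congrArg PointAlgebra.diagonal (funext fun x => mapUnitAction_eq_smul R hQ x.functor φ)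

lemma unitToScalars_injective : Function.Injective (unitToScalars R) := by
  refine (injective_iff_map_eq_zero _).2 (fun φ h => end_unit_eq_zero R φ (fun i => ?_))
  have h1 := congrArg (fun a : PointAlgebra k (DRep R) (DVect k) =>
    a (vertexPoint R i) (vertexPoint R i)) h
  have h2 : unitScalar R (vertexPoint R i).functor φ • 𝟙 (vertexPoint R i).functor =
      (0 : k) • 𝟙 (vertexPoint R i).functor :=
    (PointAlgebra.scalar_self (fun x => unitScalar R x.functor φ) _).symm.trans
      (h1.trans (zero_smul k _).symm)
  rw [map_eq_unitScalar, ← unitScalar_vertexPoint, smul_id_functor_injective R _ h2, zero_smul]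

include hQ in
-- A central element is given by scalars at the points. The non-zero transformations along paths
-- make them constant along paths, so they come from an endomorphism of the unit; every point is
-- given by a vertex.
lemma exists_unitToScalars_eq {a : PointAlgebra k (DRep R) (DVect k)}
    (ha : a ∈ Subalgebra.center k (PointAlgebra k (DRep R) (DVect k))) :
    ∃ φ, unitToScalars R φ = a := by
  obtain ⟨f, rfl, hf⟩ := PointAlgebra.exists_eq_scalar_of_mem_center
    (fun x b => end_eq_smul R hQ x.functor b) ha
  obtain ⟨φ, hφ⟩ := exists_end_unit R (fun i => f (vertexPoint R i)) (fun i j p => by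
    obtain ⟨h, hh⟩ := exists_hom_vertexPoint R p
    have h1 := hf _ _ h
    rw [← sub_eq_zero, ← sub_smul] at h1
    exact sub_eq_zero.1 ((smul_eq_zero.1 h1).resolve_right hh))
  refine ⟨φ, (unitToScalars_apply R φ).trans (congrArg PointAlgebra.scalar (funext fun x => ?_))⟩
  obtain ⟨i, rfl⟩ := vertexPoint_surjective R hQ x
  rw [unitScalar_vertexPoint]
  exact unitScalar_eq R (hφ i)

/-- The endomorphisms of the unit object are the center of the algebra of transformations between
points. -/
def centerEquiv : End (𝟙_ (DRep R)) ≃ₐ[k]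
    Subalgebra.center k (PointAlgebra k (DRep R) (DVect k)) :=
  AlgEquiv.ofBijective
    ((unitToScalars R).codRestrict _ (fun φ => by
      rw [← unitToPointAlgebra_eq R hQ]
      exact unitToPointAlgebra_mem_center φ))
    ⟨fun φ ψ h => unitToScalars_injective R (congrArg Subtype.val h), fun a => by
      obtain ⟨φ, hφ⟩ := exists_unitToScalars_eq R hQ a.2
      exact ⟨φ, Subtype.ext hφ⟩⟩

end Center

/-! ### Diagonal scalars and the retraction -/

section Retraction

variable {k : Type u} [Field k] {V : Type v} [Quiver.{w} V] (R : Relations k V) [IsTensor R]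
  (hQ : ∀ (a : V) (p : Quiver.Path a a), p = Quiver.Path.nil) [Finite V]

/-- The scalar given by an endomorphism of a tensor functor. -/
def endScalar (F : TensorFunctor k (DRep R) (DVect k)) (a : F ⟶ F) : k :=
  (end_eq_smul R hQ F a).choose

lemma endScalar_spec (F : TensorFunctor k (DRep R) (DVect k)) (a : F ⟶ F) :
    a = endScalar R hQ F a • 𝟙 F :=
  (end_eq_smul R hQ F a).choose_spec

lemma endScalar_eq {F : TensorFunctor k (DRep R) (DVect k)} {a : F ⟶ F} {c : k}
    (h : a = c • 𝟙 F) : endScalar R hQ F a = c :=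
  smul_id_functor_injective R F ((endScalar_spec R hQ F a).symm.trans h)

include hQ in
/-- The composition of transformations from a point to a different point and back vanishes. -/
lemma comp_eq_zero_of_ne {x y : Points k (DRep R) (DVect k)} (hxy : y ≠ x)
    (a : x.functor ⟶ y.functor) (b : y.functor ⟶ x.functor) : a ≫ b = 0 := by
  obtain ⟨i, rfl⟩ := vertexPoint_surjective R hQ x
  obtain ⟨j, rfl⟩ := vertexPoint_surjective R hQ y
  have hij : i ≠ j := fun h => hxy (by rw [h])
  obtain ⟨ei⟩ := nonempty_vertexPoint_iso R i
  obtain ⟨ej⟩ := nonempty_vertexPoint_iso R j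
  have isZero_of_iso {F G : TensorFunctor k (DRep R) (DVect k)} (e : F ≅ G) (X : DRep R)
      (h : IsZero (G.functor.obj X)) : IsZero (F.functor.obj X) :=
    h.of_iso ⟨e.hom.1.app _, e.inv.1.app _,
      NatTrans.congr_app (congrArg Subtype.val e.hom_inv_id) _,
      NatTrans.congr_app (congrArg Subtype.val e.inv_hom_id) _⟩
  -- The composite is a scalar, tested at the simple representation at `i`: there it passes through
  -- the value of the point `j`, which is zero, while the value of the point `i` is not.
  have h1 : IsZero ((vertexPoint R j).functor.functor.obj (simpleDb R hQ i)) :=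
    isZero_of_iso ej _ (isZero_eval_simple R hQ hij)
  have h2 : ¬ IsZero ((vertexPoint R i).functor.functor.obj (simpleDb R hQ i)) :=
    not_isZero_simple R hQ _ (fun l hl => isZero_of_iso ei _ (isZero_eval_simple R hQ hl))
  obtain ⟨c, hc⟩ := end_eq_smul R hQ (vertexPoint R i).functor (a ≫ b)
  have h3 : a.1.app (simpleDb R hQ i) ≫ b.1.app (simpleDb R hQ i) = c • 𝟙 _ :=
    congrArg (fun t : (vertexPoint R i).functor ⟶ (vertexPoint R i).functor =>
      t.1.app (simpleDb R hQ i)) hc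
  have h4 : a.1.app (simpleDb R hQ i) = 0 := h1.eq_of_tgt _ _
  rw [h4, zero_comp] at h3
  have h5 : c = 0 := (smul_id_injective h2 ((zero_smul k _).trans h3)).symm
  rw [hc, h5, zero_smul]

variable [Finite (Points k (DRep R) (DVect k))]

include hQ in
-- In the sum over intermediate points, those other than `x` contribute zero. Hence the diagonal
-- entries are multiplicative although the algebra is not diagonal.
lemma mul_apply_self (a b : PointAlgebra k (DRep R) (DVect k)) (x : Points k (DRep R) (DVect k)) :
    (a * b) x x = a x x ≫ b x x := by
  have := Fintype.ofFinite (Points k (DRep R) (DVect k))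
  rw [PointAlgebra.mul_apply, Finset.sum_eq_single x]
  · intro y _ hy
    exact comp_eq_zero_of_ne R hQ hy _ _
  · simp

/-- The scalars on the diagonal of an element of the algebra of transformations between
points. -/
def diagonalScalar (x : Points k (DRep R) (DVect k)) :
    PointAlgebra k (DRep R) (DVect k) →+* k where
  toFun a := endScalar R hQ x.functor (a x x)
  map_one' := endScalar_eq R hQ ((PointAlgebra.diagonal_self _ x).trans (one_smul k _).symm)
  map_mul' a b := endScalar_eq R hQ ((mul_apply_self R hQ a b x).trans (by
    conv_lhs => rw [endScalar_spec R hQ _ (a x x), endScalar_spec R hQ _ (b x x)]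
    rw [Linear.comp_smul, Linear.smul_comp, Category.comp_id, smul_smul, mul_comm]))
  map_zero' := endScalar_eq R hQ (zero_smul k _).symm
  map_add' a b := endScalar_eq R hQ ((PointAlgebra.add_apply a b x x).trans (by
    conv_lhs => rw [endScalar_spec R hQ _ (a x x), endScalar_spec R hQ _ (b x x)]
    rw [add_smul]))

lemma diagonalScalar_unitToScalars (x : Points k (DRep R) (DVect k)) (φ : End (𝟙_ (DRep R))) :
    diagonalScalar R hQ x (unitToScalars R φ) = unitScalar R x.functor φ :=
  endScalar_eq R hQ (PointAlgebra.scalar_self _ x)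

/-- A retraction onto the endomorphisms of the unit object. -/
def retraction : PointAlgebra k (DRep R) (DVect k) →+* End (𝟙_ (DRep R)) :=
  (componentEquiv R).symm.toRingEquiv.toRingHom.comp
    (RingHom.pi (fun C => diagonalScalar R hQ (vertexPoint R (representative (V := V) C))))

lemma retraction_unitToScalars (φ : End (𝟙_ (DRep R))) :
    retraction R hQ (unitToScalars R φ) = φ := by
  refine (componentEquiv R).injective (((componentEquiv R).apply_symm_apply _).trans
    (funext fun C => ?_))
  exact (diagonalScalar_unitToScalars R hQ _ φ).trans (unitScalar_vertexPoint R _ φ)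

end Retraction

end BoundedDerived

namespace TensorTriangulated

open TopologicalSpace Pretriangulated

/-! ### Maps from global sections to skyscrapers -/

section GlobalSections

variable {T : Type u} [Category.{v} T] [Preadditive T] [HasZeroObject T] [HasShift T ℤ]
  [∀ n : ℤ, (shiftFunctor T n).Additive] [Pretriangulated T] [MonoidalCategory T]
  [IsTriangulated T]
  {S : Type*} [Category* S] [Preadditive S] [HasZeroObject S] [HasShift S ℤ]
  [∀ n : ℤ, (shiftFunctor S n).Additive] [Pretriangulated S]
  (F : T ⥤ S) [F.CommShift ℤ] [F.IsTriangulated]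
  {p : Spc T} (hF : ∀ X, p.ideal X → IsZero (F.obj X))

include hF in
-- For `p ∉ Z` an object supported on `Z` belongs to `p`, so `F` kills the cones of the morphisms to
-- be inverted.
lemma supported_trW_isInvertedBy {Z : Set (Spc T)} (hZ : p ∉ Z) :
    (supported Z).trW.IsInvertedBy F := by
  intro X Y f hf
  rw [ObjectProperty.trW_iff] at hf
  obtain ⟨C, g, h, mem, hC⟩ := hf
  exact (Triangle.isZero₃_iff_isIso₁ _ (F.map_distinguished _ mem)).1
    (hF C ((supported_iff Z C).1 hC p hZ))

/-- A functor whose kernel contains a prime extends to the Verdier quotients by the objects supported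
on the subsets which do not contain the prime. -/
def liftQuot {Z : Set (Spc T)} (hZ : p ∉ Z) : Quot Z ⥤ S :=
  Localization.Construction.lift F (supported_trW_isInvertedBy F hF hZ)

lemma toQuot_liftQuot {Z : Set (Spc T)} (hZ : p ∉ Z) : toQuot Z ⋙ liftQuot F hF hZ = F :=
  Localization.Construction.fac _ _

lemma quotMap_liftQuot {Z Z' : Set (Spc T)} (h : Z ⊆ Z') (hZ' : p ∉ Z') :
    quotMap h ⋙ liftQuot F hF hZ' = liftQuot F hF (fun hZ => hZ' (h hZ)) :=
  Localization.Construction.uniq _ _ (by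
    rw [← Functor.assoc, toQuot_quotMap, toQuot_liftQuot, toQuot_liftQuot])

instance {Z : Set (Spc T)} (hZ : p ∉ Z) : (liftQuot F hF hZ).Additive := by
  rw [Localization.functor_additive_iff (toQuot Z) (supported Z).trW, toQuot_liftQuot]
  infer_instance

/-- The map on the endomorphisms of the unit object induced by `liftQuot`. -/
def endLiftQuot {Z : Set (Spc T)} (hZ : p ∉ Z) : EndQuot Z →+* End (F.obj (𝟙_ T)) where
  toFun f := (liftQuot F hF hZ).map f
  map_one' := (liftQuot F hF hZ).map_id _
  map_mul' f g := (liftQuot F hF hZ).map_comp g f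
  map_zero' := (liftQuot F hF hZ).map_zero _ _
  map_add' _ _ := (liftQuot F hF hZ).map_add

lemma endLiftQuot_endQuotMap {Z Z' : Set (Spc T)} (h : Z ⊆ Z') (hZ' : p ∉ Z') (f : EndQuot Z) :
    endLiftQuot F hF hZ' (endQuotMap h f) = endLiftQuot F hF (fun hZ => hZ' (h hZ)) f :=
  (Functor.congr_hom (quotMap_liftQuot F hF h hZ') f).trans
    ((Category.id_comp _).trans (Category.comp_id _))

lemma endLiftQuot_toQuot {Z : Set (Spc T)} (hZ : p ∉ Z) (φ : End (𝟙_ T)) :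
    endLiftQuot F hF hZ ((toQuot Z).map φ) = F.map φ :=
  (Functor.congr_hom (toQuot_liftQuot F hF hZ) φ).trans
    ((Category.id_comp _).trans (Category.comp_id _))

variable {A : Type (max u v)} [Ring A] (σ : End (F.obj (𝟙_ T)) →+* A)

/-- The map on sections over a neighbourhood of a prime induced by a functor which vanishes on the
prime. -/
def sectionHom (W : (Opens (Spc T))ᵒᵖ) (h : p ∈ W.unop) :
    presheaf (T := T).obj W ⟶ RingCat.of A :=
  RingCat.ofHom (σ.comp (endLiftQuot F hF (Set.notMem_compl_iff.2 h)))

lemma map_sectionHom {W W' : (Opens (Spc T))ᵒᵖ} (i : W ⟶ W') (h' : p ∈ W'.unop) :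
    presheaf.map i ≫ sectionHom F hF σ W' h' =
      sectionHom F hF σ W (leOfHom i.unop h') := by
  ext f
  exact congrArg σ (endLiftQuot_endQuotMap F hF _ _ f)

open Classical in
variable (p A) in
/-- The skyscraper presheaf at a prime. -/
abbrev skyscraper : (Opens (Spc T))ᵒᵖ ⥤ RingCat.{max u v} :=
  skyscraperPresheaf (X := TopCat.of (Spc T)) p (RingCat.of A)

open Classical in
lemma skyscraper_obj {W : (Opens (Spc T))ᵒᵖ} (h : p ∈ W.unop) :
    (skyscraper p A).obj W = RingCat.of A := if_pos h

open Classical in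
lemma skyscraper_map {W W' : (Opens (Spc T))ᵒᵖ} (i : W ⟶ W') (h : p ∈ W.unop) (h' : p ∈ W'.unop) :
    (skyscraper p A).map i = eqToHom ((skyscraper_obj h).trans (skyscraper_obj h').symm) :=
  dif_pos h'

open Classical in
/-- The skyscraper presheaf is terminal away from the prime. -/
def isTerminalSkyscraper {W : (Opens (Spc T))ᵒᵖ} (h : p ∉ W.unop) :
    IsTerminal ((skyscraper p A).obj W) :=
  (if_neg h).symm.ndrec terminalIsTerminal

open Classical in
/-- The components of `toSkyscraper`. -/
def toSkyscraperApp (W : (Opens (Spc T))ᵒᵖ) : presheaf.obj W ⟶ (skyscraper p A).obj W :=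
  if h : p ∈ W.unop then sectionHom F hF σ W h ≫ eqToHom (skyscraper_obj h).symm
  else (isTerminalSkyscraper h).from _

lemma toSkyscraperApp_eq {W : (Opens (Spc T))ᵒᵖ} (h : p ∈ W.unop) :
    toSkyscraperApp F hF σ W = sectionHom F hF σ W h ≫ eqToHom (skyscraper_obj h).symm :=
  dif_pos h

/-- The map from the presheaf of endomorphisms of the unit object to the skyscraper presheaf at a prime
induced by a functor which vanishes on the prime. -/
def toSkyscraper : presheaf (T := T) ⟶ skyscraper p A where
  app := toSkyscraperApp F hF σ
  naturality {W W'} i := by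
    by_cases h' : p ∈ W'.unop
    · have h : p ∈ W.unop := leOfHom i.unop h'
      rw [toSkyscraperApp_eq F hF σ h, toSkyscraperApp_eq F hF σ h', skyscraper_map i h h',
        Category.assoc, eqToHom_trans, ← Category.assoc, map_sectionHom]
    · exact (isTerminalSkyscraper h').hom_ext _ _

include hF in
/-- A functor which vanishes on a prime induces a map on the global sections of the structure
sheaf. -/
lemma exists_globalSections_hom : ∃ d : globalSections T →+* A,
    ∀ φ : End (𝟙_ T), d (toGlobalSections T φ) = σ (F.map φ) := by
  classical
  let K := skyscraper p A
  let η : presheaf (T := T) ⟶ K := toSkyscraper F hF σ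
  -- The skyscraper presheaf is already a sheaf, so the map to it factors through the
  -- sheafification.
  have hK : Presheaf.IsSheaf (Opens.grothendieckTopology (Spc T)) K :=
    skyscraperPresheaf_isSheaf (X := TopCat.of (Spc T)) p (RingCat.of A)
  have hp : p ∈ (⊤ : Opens (Spc T)) := trivial
  let γ : (structureSheaf T).obj.obj (.op ⊤) ⟶ RingCat.of A :=
    (sheafifyLift (Opens.grothendieckTopology (Spc T)) η hK).app (.op ⊤) ≫ eqToHom (skyscraper_obj hp)
  refine ⟨γ.hom, fun φ => ?_⟩
  have h1 : (toSheafify (Opens.grothendieckTopology (Spc T)) presheaf).app (.op ⊤) ≫ γ =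
      sectionHom F hF σ (.op ⊤) hp := by
    have h2 : (toSheafify (Opens.grothendieckTopology (Spc T)) presheaf).app (.op ⊤) ≫
        (sheafifyLift (Opens.grothendieckTopology (Spc T)) η hK).app (.op ⊤) = η.app (.op ⊤) :=
      NatTrans.congr_app (toSheafify_sheafifyLift _ η hK) _
    have h3 : η.app (.op ⊤) = sectionHom F hF σ (.op ⊤) hp ≫ eqToHom (skyscraper_obj hp).symm :=
      toSkyscraperApp_eq F hF σ hp
    refine (Category.assoc _ _ _).symm.trans ?_
    refine (congrArg (· ≫ eqToHom (skyscraper_obj hp)) (h2.trans h3)).trans ?_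
    rw [Category.assoc, eqToHom_trans, eqToHom_refl, Category.comp_id]
  have h4 := congrArg (fun g => g.hom ((toQuot _).map φ)) h1
  exact h4.trans (congrArg σ (endLiftQuot_toQuot F hF _ φ))

end GlobalSections

end TensorTriangulated

namespace BoundedDerived

open Pretriangulated TensorTriangulated ZeroObject

/-! ### Characters of the global sections given by points -/

section Comparison

variable {k : Type u} [Field k] {V : Type v} [Quiver.{w} V] (R : Relations k V) [IsTensor R]

section

variable (F : TensorFunctor k (DRep R) (DVect k))

/-- The kernel of a tensor functor. -/
def kernel : ObjectProperty (DRep R) := fun X => IsZero (F.functor.obj X)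

lemma isTensorIdeal_kernel : IsTensorIdeal (kernel R F) where
  exists_zero := ⟨0, isZero_zero _, F.functor.map_isZero (isZero_zero _)⟩
  isStableUnderShiftBy n := ⟨fun X hX =>
    ((shiftFunctor (DVect k) n).map_isZero hX).of_iso ((F.functor.commShiftIso n).app X)⟩
  ext₂' D hD h₁ h₃ := ObjectProperty.le_isoClosure _ _
    ((Triangle.isZero₂_iff _ (F.functor.map_distinguished _ hD)).2
      ⟨h₁.eq_of_src _ _, h₃.eq_of_tgt _ _⟩)
  of_retract r hY := by
    refine (IsZero.iff_id_eq_zero _).2 ?_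
    have h1 : F.functor.map r.i ≫ F.functor.map r.r = 𝟙 _ := by
      rw [← F.functor.map_comp, r.retract, F.functor.map_id]
    have h2 : F.functor.map r.i = 0 := IsZero.eq_of_tgt hY _ _
    rw [← h1, h2, zero_comp]
  tensorLeft X Y hY := by
    obtain ⟨_⟩ := F.monoidal
    exact (isZero_tensor _ (Or.inr hY)).of_iso (Functor.Monoidal.μIso F.functor X Y).symm
  tensorRight X Y hX := by
    obtain ⟨_⟩ := F.monoidal
    exact (isZero_tensor _ (Or.inl hX)).of_iso (Functor.Monoidal.μIso F.functor X Y).symm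

/-- The kernel of a tensor functor as a point of the spectrum. -/
def kernelPrime : Spc (DRep R) where
  ideal := kernel R F
  isTensorIdeal := isTensorIdeal_kernel R F
  proper := ⟨𝟙_ _, not_isZero_map_unit R F⟩
  prime _ _ h := isZero_or_isZero_of_isZero_tensor R F h

lemma exists_end_map_unit_eq_smul (g : End (F.functor.obj (𝟙_ (DRep R)))) :
    ∃ c : k, g = c • 𝟙 (F.functor.obj (𝟙_ (DRep R))) := by
  obtain ⟨e⟩ := exists_iso_unit R F
  obtain ⟨c, hc⟩ := unit_end_eq_smul (e.inv ≫ g ≫ e.hom)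
  refine ⟨c, ?_⟩
  rw [← cancel_epi e.inv, ← cancel_mono e.hom, Category.assoc, hc]
  simp

lemma algebraMap_end_map_unit_bijective :
    Function.Bijective (algebraMap k (End (F.functor.obj (𝟙_ (DRep R))))) := by
  refine ⟨fun c c' h => smul_id_injective (not_isZero_map_unit R F) ?_, fun g => ?_⟩
  · exact (Algebra.algebraMap_eq_smul_one c).symm.trans
      (h.trans (Algebra.algebraMap_eq_smul_one c'))
  · obtain ⟨c, hc⟩ := exists_end_map_unit_eq_smul R F g
    exact ⟨c, (Algebra.algebraMap_eq_smul_one c).trans hc.symm⟩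

/-- The endomorphisms of the image of the unit object are scalars. -/
def endMapUnitEquiv : k ≃+* End (F.functor.obj (𝟙_ (DRep R))) :=
  RingEquiv.ofBijective _ (algebraMap_end_map_unit_bijective R F)

lemma endMapUnitEquiv_symm_map (φ : End (𝟙_ (DRep R))) :
    (endMapUnitEquiv R F).symm (F.functor.map φ) = unitScalar R F φ := by
  rw [RingEquiv.symm_apply_eq]
  exact (map_eq_unitScalar R F φ).trans (Algebra.algebraMap_eq_smul_one
    (A := End (F.functor.obj (𝟙_ (DRep R)))) (unitScalar R F φ)).symm

/-- A tensor functor induces a character of the ring of global sections. -/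
lemma exists_character : ∃ d : globalSections (DRep R) →+* k,
    ∀ φ : End (𝟙_ (DRep R)), d (toGlobalSections (DRep R) φ) = unitScalar R F φ := by
  -- The field is lifted to the universe of the structure sheaf and lowered again afterwards.
  obtain ⟨d, hd⟩ := exists_globalSections_hom (A := ULift.{max (max (u + 1) v) w} k) F.functor
    (p := kernelPrime R F) (fun _ h => h)
    (ULift.ringEquiv.symm.toRingHom.comp (endMapUnitEquiv R F).symm.toRingHom)
  refine ⟨ULift.ringEquiv.toRingHom.comp d, fun φ => ?_⟩
  exact (congrArg ULift.down (hd φ)).trans (endMapUnitEquiv_symm_map R F φ)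

end

variable [Finite (Points k (DRep R) (DVect k))]

/-- The characters of the points are collected on the diagonal, where elements with scalar entries
form a subalgebra. -/
lemma exists_globalSections_hom_pointAlgebra :
    ∃ d : globalSections (DRep R) →+* PointAlgebra k (DRep R) (DVect k),
      ∀ φ : End (𝟙_ (DRep R)), d (toGlobalSections (DRep R) φ) = unitToScalars R φ := by
  choose d hd using fun x : Points k (DRep R) (DVect k) => exists_character R x.functor
  refine ⟨PointAlgebra.scalars.toRingHom.comp (RingHom.pi d), fun φ => ?_⟩
  exact congrArg PointAlgebra.scalar (funext fun x => hd x φ)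

end Comparison

end BoundedDerived

end

theorem mainTheorem6 {k : Type u} [Field k] {V : Type v} [Quiver.{w} V]
    [Finite V] [∀ a b : V, Finite (a ⟶ b)]
    (hQ : ∀ (a : V) (p : Quiver.Path a a), p = Quiver.Path.nil)
    (R : BoundedDerived.Relations k V) [BoundedDerived.IsTensor R] :
    ∃ _ : Finite (TensorTriangulated.Points k (BoundedDerived.DRep R) (BoundedDerived.DVect k)),
      (∃ (d : TensorTriangulated.globalSections (BoundedDerived.DRep R) →+*
            TensorTriangulated.PointAlgebra k (BoundedDerived.DRep R) (BoundedDerived.DVect k))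
          (u : TensorTriangulated.PointAlgebra k (BoundedDerived.DRep R) (BoundedDerived.DVect k) →+*
            TensorTriangulated.globalSections (BoundedDerived.DRep R)),
          (∀ φ : End (𝟙_ (BoundedDerived.DRep R)),
            d (TensorTriangulated.toGlobalSections (BoundedDerived.DRep R) φ) =
              TensorTriangulated.unitToPointAlgebra k (BoundedDerived.DVect k) φ) ∧
          (∀ φ : End (𝟙_ (BoundedDerived.DRep R)),
            u (TensorTriangulated.unitToPointAlgebra k (BoundedDerived.DVect k) φ) =
              TensorTriangulated.toGlobalSections (BoundedDerived.DRep R) φ)) ∧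
      (∃ e : End (𝟙_ (BoundedDerived.DRep R)) ≃ₐ[k] Subalgebra.center k
            (TensorTriangulated.PointAlgebra k (BoundedDerived.DRep R) (BoundedDerived.DVect k)),
          ∀ φ : End (𝟙_ (BoundedDerived.DRep R)),
            (e φ : TensorTriangulated.PointAlgebra k (BoundedDerived.DRep R)
              (BoundedDerived.DVect k)) =
              TensorTriangulated.unitToPointAlgebra k (BoundedDerived.DVect k) φ) ∧
      Nonempty (End (𝟙_ (BoundedDerived.DRep R)) ≃ₐ[k]
        (Quiver.WeaklyConnectedComponent V → k)) := by
  have hfin := BoundedDerived.finite_points R hQ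
  obtain ⟨d, hd⟩ := BoundedDerived.exists_globalSections_hom_pointAlgebra R
  -- The map `u` is the retraction of the algebra of transformations onto the endomorphisms of the
  -- unit, followed by the canonical map `α`.
  refine ⟨hfin, ⟨d, (TensorTriangulated.toGlobalSections (BoundedDerived.DRep R)).comp
    (BoundedDerived.retraction R hQ), fun φ => ?_, fun φ => ?_⟩,
    ⟨BoundedDerived.centerEquiv R hQ, fun φ => ?_⟩, ⟨BoundedDerived.componentEquiv R⟩⟩
  · exact (hd φ).trans (BoundedDerived.unitToPointAlgebra_eq R hQ φ).symm
  · rw [BoundedDerived.unitToPointAlgebra_eq R hQ]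
    exact congrArg (TensorTriangulated.toGlobalSections (BoundedDerived.DRep R))
      (BoundedDerived.retraction_unitToScalars R hQ φ)
  · exact (BoundedDerived.unitToPointAlgebra_eq R hQ φ).symm
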